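/- Let $X$ be a compact complex manifold of complex dimension $n$ with complex structure $J$, let $g$ be a Kähler metric on $X$ with Kähler form $\omega=g(J\cdot,\cdot)$, and let $\alpha$ be a smooth closed real $(1,1)$-form on $X$. Let $A=\{s\in\mathbb C: 1\le|s|\le 2\}$ and $M=A\times X$ with the product of the Euclidean metric and $g$, and split the bundle of two-jets by the Riemannian Hessian, $J^2(M)=\mathbb R\oplus T^*M\oplus \mathrm{Sym}^2(T^*M)$, $J^2_pu=(u(p),du_p,\mathrm{Hess}_p u)$. *The angle.* On $\mathbb R^{2n+2}=\mathbb C\times\mathbb C^{n}$ with standard complex structure $J$ put $p(N)=\frac12(N+J^TNJ)$ for $N\in\mathrm{Sym}^2(\mathbb R^{2n+2})$, let $p(N)^+$ be the matrix obtained from $p(N)$ by deleting the two rows and two columns of the first factor $\mathbb C$, let $I_{2n}$ be the orthogonal projection onto $\mathbb C^n$, and let $\mathcal S$ be the set of $N$ for which the deleted rows and columns of $p(N)$ vanish. For a complex matrix $B$ let $\mathrm{tr}\arg B$ be the sum of the principal arguments of its eigenvalues, with algebraic multiplicity. Define $$\tilde\Phi(N)=\begin{cases}\frac12\,\mathrm{tr}\arg\big(I_{2n}+i\,p(N)\big),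 & N\notin\mathcal S,\\[2pt] \frac\pi2+\frac12\,\mathrm{tr}\arg\big(\mathrm{Id}_{\mathbb R^{2n}}+i\,p(N)^+\big), & N\in\mathcal S,\end{cases}$$ and $\mathcal F_c=\{N\in\mathrm{Sym}^2(\mathbb R^{2n+2}) : \tilde\Phi(N)\ge c\}$. By means of the frames $(1,e_1,\dots,e_n,i,Je_1,\dots,Je_n)$ of $T_pM$, where $(e_1,\dots,e_n)$ is a unitary frame of the tangent space of $X$, $\mathcal F_c$ also denotes the corresponding subset of $J^2(M)$ (a condition on the $\mathrm{Sym}^2$-component only). *The shift.* Let $\Lambda=\omega^{-1}\alpha$, and let $\iota(\Lambda)$ be the symmetric bilinear form on $T_pM$ which is the pullback of the form $(v,w)\mapsto\alpha(v,Jw)$ on $X$. Put $\sigma(r,\ell,N)=(r,\ell,N+\iota(\Lambda))$, $\tilde\sigma(r,\ell,N)=(r,\ell,N-\iota(\Lambda))$, $\mathcal F_{\sigma,c}=\sigma^{-1}(\mathcal F_c)$ and $\mathcal F_{\tilde\sigma,c}=\tilde\sigma^{-1}(\mathcal F_c)$. *Subequations.* A set $F\subset J^2(M)$ is a subequation if it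 is closed; $F_p+(0,0,P)\subset F_p$ for all $P\ge0$; $F_p+(r,0,0)\subset F_p$ for all $r\le0$; $F=\overline{\mathrm{int}\,F}$; $F_p=\overline{\mathrm{int}(F_p)}$ and $(\mathrm{int}\,F)_p=\mathrm{int}(F_p)$ for all $p\in M$. It is purely second order if $F=\mathbb R\oplus T^*M\oplus F'$ with $F'\subset\mathrm{Sym}^2(T^*M)$. The Dirichlet dual of $F$ is $\tilde F=J^2(M)\setminus(-\mathrm{int}\,F)$. **Proposition.** Let $|c|<\frac{(n+1)\pi}2$. Then $\mathcal F_{\sigma,c}\subset J^2(M)$ is a globally defined, purely second order subequation: at each $p\in M$, and with respect to every unitary frame, a two-jet $u$ lies in $\mathcal F_{\sigma,c}$ if and only if $\tilde\Phi(\mathrm{Hess}_p u+\iota(\Lambda)(p))\ge c$. Its Dirichlet dual is $\mathcal F_{\tilde\sigma,-c}$. -/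

import Mathlib

open Set Filter Topology Bundle Manifold
open scoped ContDiff Matrix

noncomputable section

namespace SpaceTimeAngle

/-! ### The space-time Lagrangian angle of a real symmetric matrix

Coordinates on `ℝ^(2n+2) = ℂ^(n+1)` are indexed by `Fin (n+1) ⊕ Fin (n+1)`: `inl k` is the real part
and `inr k` the imaginary part of the complex coordinate number `k`. The complex coordinate number
`0` is the one of the annulus. -/

/-- The index set of the real coordinates of `ℂ^m`. -/
abbrev RealIdx (m : ℕ) : Type := Fin m ⊕ Fin m

/-- The standard complex structure of `ℝ^(2m)`. -/
def stdJ (m : ℕ) : Matrix (RealIdx m) (RealIdx m) ℝ :=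
  Matrix.fromBlocks 0 (-1) 1 0

/-- The projection `p(N) = (N + Jᵀ N J) / 2` onto the `J`-invariant matrices. -/
def projJ {m : ℕ} (N : Matrix (RealIdx m) (RealIdx m) ℝ) : Matrix (RealIdx m) (RealIdx m) ℝ :=
  (1 / 2 : ℝ) • (N + (stdJ m)ᵀ * N * stdJ m)

/-- The matrix `I_{2n}`, with entry `0` at the two real coordinates of the annulus direction and
entry `1` at the other diagonal places. -/
def degenerateId (n : ℕ) : Matrix (RealIdx (n + 1)) (RealIdx (n + 1)) ℝ :=
  Matrix.diagonal (Sum.elim (fun k => if k = 0 then 0 else 1) (fun k => if k = 0 then 0 else 1))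

/-- `tr arg B`: the sum, with algebraic multiplicity, of the principal arguments (in `(-π, π]`) of
the complex eigenvalues of `B`. -/
def trArg {ι : Type} [Fintype ι] [DecidableEq ι] (B : Matrix ι ι ℂ) : ℝ :=
  (B.charpoly.roots.map Complex.arg).sum

/-- The complex matrix `R + i P` with real part `R` and imaginary part `P`. -/
def complexMatrix {ι : Type} (R P : Matrix ι ι ℝ) : Matrix ι ι ℂ :=
  R.map Complex.ofReal + Complex.I • P.map Complex.ofReal

/-- The inclusion of the coordinates of `ℂ^n` into those of `ℂ^(n+1) = ℂ × ℂ^n`. -/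
def spaceIdx (n : ℕ) : RealIdx n → RealIdx (n + 1) := Sum.map Fin.succ Fin.succ

/-- The truncation `P⁺` of `P`: the rows and columns of the annulus direction are deleted. -/
def truncation {n : ℕ} (P : Matrix (RealIdx (n + 1)) (RealIdx (n + 1)) ℝ) :
    Matrix (RealIdx n) (RealIdx n) ℝ :=
  P.submatrix (spaceIdx n) (spaceIdx n)

/-- The degenerate set `𝒮 = {A | p(A) = diag(0, p(A)⁺)}`: the two rows and the two columns of `p(A)`
which belong to the annulus direction vanish. -/
def degenerateSet (n : ℕ) : Set (Matrix (RealIdx (n + 1)) (RealIdx (n + 1)) ℝ) :=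
  {A | ∀ k : RealIdx (n + 1),
    projJ A (Sum.inl 0) k = 0 ∧ projJ A (Sum.inr 0) k = 0 ∧
      projJ A k (Sum.inl 0) = 0 ∧ projJ A k (Sum.inr 0) = 0}

open Classical in
/-- The (upper semicontinuous) lifted space-time Lagrangian angle. -/
def spaceTimeAngle {n : ℕ} (A : Matrix (RealIdx (n + 1)) (RealIdx (n + 1)) ℝ) : ℝ :=
  if A ∈ degenerateSet n then
    Real.pi / 2 + (1 / 2) * trArg (complexMatrix 1 (truncation (projJ A)))
  else (1 / 2) * trArg (complexMatrix (degenerateId n) (projJ A))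

/-- `𝓕_c ⊂ Sym²(ℝ^(2n+2))`: the symmetric matrices of space-time angle at least `c`. -/
def localSet (n : ℕ) (c : ℝ) : Set (Matrix (RealIdx (n + 1)) (RealIdx (n + 1)) ℝ) :=
  {A | A.IsSymm ∧ c ≤ spaceTimeAngle A}

/-! ### Complex manifolds, real forms and Kähler metrics -/

/-- The model `ℂ^n`. -/
abbrev Model (n : ℕ) : Type := EuclideanSpace ℂ (Fin n)

/-- The underlying smooth real manifold of a complex manifold. -/
instance realManifold (n : ℕ) (X : Type*) [TopologicalSpace X] [ChartedSpace (Model n) X]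
    [IsManifold 𝓘(ℂ, Model n) ω X] : IsManifold 𝓘(ℝ, Model n) ∞ X := by
  refine isManifold_of_contDiffOn _ _ _ ?_
  intro e e' he he'
  have h := (HasGroupoid.compatible (G := contDiffGroupoid ω 𝓘(ℂ, Model n)) he he').1
  have h1 : ContDiffOn ℂ ω (e.symm ≫ₕ e') (e.symm ≫ₕ e').source := by
    simpa [contDiffPregroupoid] using h
  simpa using (h1.restrict_scalars ℝ).of_le le_top

variable (n : ℕ) (X : Type*) [TopologicalSpace X] [ChartedSpace (Model n) X]

/-- The real tangent space of `X` at `x`. -/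
abbrev TSpace {X : Type*} [TopologicalSpace X] [ChartedSpace (Model n) X] (x : X) : Type :=
  TangentSpace 𝓘(ℝ, Model n) x

/-- The complex structure of the real tangent space: multiplication by `i` in a holomorphic chart. -/
def complexStr {X : Type*} [TopologicalSpace X] [ChartedSpace (Model n) X] (x : X) :
    TSpace n x →L[ℝ] TSpace n x :=
  (show Model n →L[ℝ] Model n from
    (Complex.I • ContinuousLinearMap.id ℂ (Model n)).restrictScalars ℝ)

/-- A field of real bilinear forms on the tangent spaces of `X`. -/
abbrev BilinField : Type _ := ∀ x : X, TSpace n x →L[ℝ] TSpace n x →L[ℝ] ℝ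

variable {n X}

/-- The expression of a field of bilinear forms in the chart around `x₀`: the pullback by the inverse
of the chart. -/
def BilinField.inChart (b : BilinField n X) (x₀ : X) (y : Model n) :
    Model n →L[ℝ] Model n →L[ℝ] ℝ :=
  let D : Model n →L[ℝ] Model n :=
    mfderiv 𝓘(ℝ, Model n) 𝓘(ℝ, Model n) (chartAt (Model n) x₀).symm y
  let β : Model n →L[ℝ] Model n →L[ℝ] ℝ := b ((chartAt (Model n) x₀).symm y)
  β.bilinearComp D D

/-- A field of alternating bilinear forms is closed: in all charts the cyclic sum of the derivatives,
which is its exterior derivative, vanishes. -/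
def BilinField.IsClosedForm (b : BilinField n X) : Prop :=
  ∀ x₀ : X, ∀ y ∈ (chartAt (Model n) x₀).target, ∀ u v w : Model n,
    fderiv ℝ (b.inChart x₀) y u v w + fderiv ℝ (b.inChart x₀) y v w u
      + fderiv ℝ (b.inChart x₀) y w u v = 0

variable (n X) in
/-- A smooth closed real form of type `(1,1)` on the complex manifold `X`. -/
structure ClosedRealOneOneForm [IsManifold 𝓘(ℂ, Model n) ω X] where
  /-- The real two-form. -/
  form : BilinField n X
  alternating : ∀ (x : X) (v : TSpace n x), form x v v = 0
  type_one_one : ∀ (x : X) (v w : TSpace n x),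
    form x (complexStr n x v) (complexStr n x w) = form x v w
  smooth : ContMDiff 𝓘(ℝ, Model n) (𝓘(ℝ, Model n).prod 𝓘(ℝ, Model n →L[ℝ] Model n →L[ℝ] ℝ)) ∞
    (fun x ↦ TotalSpace.mk' (Model n →L[ℝ] Model n →L[ℝ] ℝ)
      (E := fun x : X ↦ (TSpace n x →L[ℝ] TSpace n x →L[ℝ] ℝ)) x (form x))
  closed : form.IsClosedForm

variable (n X) in
/-- A Kähler metric on the complex manifold `X`: a smooth Riemannian metric `g` that is invariant
under the complex structure `J` and whose Kähler form `ω(v, w) = g(J v, w)` is closed. -/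
structure KahlerMetric [IsManifold 𝓘(ℂ, Model n) ω X] where
  /-- The Riemannian metric. -/
  metric : ContMDiffRiemannianMetric (B := X) 𝓘(ℝ, Model n) ∞ (Model n)
    (fun x : X ↦ TangentSpace 𝓘(ℝ, Model n) x)
  invariant : ∀ (x : X) (v w : TSpace n x),
    metric.inner x (complexStr n x v) (complexStr n x w) = metric.inner x v w
  closed : BilinField.IsClosedForm (n := n) (X := X)
    (fun x ↦ (metric.inner x).comp (complexStr n x))

/-! ### Christoffel symbols and Hessians in a chart -/

section Chart

variable {V : Type*} [NormedAddCommGroup V] [NormedSpace ℝ V]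

/-- The right side of the Koszul formula `2 G(Γ(a, b), e) = (∂_a G)(b, e) + (∂_b G)(a, e) -
(∂_e G)(a, b)` for the Christoffel symbols of a metric `G` at `v`, as a linear form in `e`. -/
def koszul (G : V → V →L[ℝ] V →L[ℝ] ℝ) (v a b : V) : V →L[ℝ] ℝ :=
  fderiv ℝ G v a b + fderiv ℝ G v b a - ((fderiv ℝ G v).flip a).flip b

/-- The Christoffel symbols `Γ(a, b)` at `v` of the Levi-Civita connection of a metric `G`. -/
def christoffel (G : V → V →L[ℝ] V →L[ℝ] ℝ) (v a b : V) : V :=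
  (G v).inverse ((1 / 2 : ℝ) • koszul G v a b)

theorem koszul_apply (G : V → V →L[ℝ] V →L[ℝ] ℝ) (v a b e : V) :
    koszul G v a b e = fderiv ℝ G v a b e + fderiv ℝ G v b a e - fderiv ℝ G v e a b := rfl

theorem christoffel_left (G : V → V →L[ℝ] V →L[ℝ] ℝ) (v a a' b : V) (r r' : ℝ) :
    christoffel G v (r • a + r' • a') b = r • christoffel G v a b + r' • christoffel G v a' b := by
  have h : koszul G v (r • a + r' • a') b = r • koszul G v a b + r' • koszul G v a' b := by
    have h1 : fderiv ℝ G v (r • a + r' • a') = r • fderiv ℝ G v a + r' • fderiv ℝ G v a' := by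
      rw [ContinuousLinearMap.map_add, ContinuousLinearMap.map_smul, ContinuousLinearMap.map_smul]
    ext e
    have h2 := (fderiv ℝ G v b).map_add (r • a) (r' • a')
    have h3 := (fderiv ℝ G v e).map_add (r • a) (r' • a')
    rw [ContinuousLinearMap.map_smul, ContinuousLinearMap.map_smul] at h2 h3
    rw [koszul_apply, h1, h2, h3]
    change _ = r * koszul G v a b e + r' * koszul G v a' b e
    rw [koszul_apply, koszul_apply]
    change (r * fderiv ℝ G v a b e + r' * fderiv ℝ G v a' b e) +
      (r * fderiv ℝ G v b a e + r' * fderiv ℝ G v b a' e) -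
      (r * fderiv ℝ G v e a b + r' * fderiv ℝ G v e a' b) = _
    ring
  simp only [christoffel, h, smul_add, map_add, map_smul]
  rw [smul_comm r, smul_comm r']

theorem christoffel_right (G : V → V →L[ℝ] V →L[ℝ] ℝ) (v a b b' : V) (r r' : ℝ) :
    christoffel G v a (r • b + r' • b') = r • christoffel G v a b + r' • christoffel G v a b' := by
  have h : koszul G v a (r • b + r' • b') = r • koszul G v a b + r' • koszul G v a b' := by
    have h1 : fderiv ℝ G v (r • b + r' • b') = r • fderiv ℝ G v b + r' • fderiv ℝ G v b' := by
      rw [ContinuousLinearMap.map_add, ContinuousLinearMap.map_smul, ContinuousLinearMap.map_smul]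
    ext e
    have h2 := (fderiv ℝ G v a).map_add (r • b) (r' • b')
    have h3 := (fderiv ℝ G v e a).map_add (r • b) (r' • b')
    rw [ContinuousLinearMap.map_smul, ContinuousLinearMap.map_smul] at h2 h3
    rw [koszul_apply, h1, h2, h3]
    change _ = r * koszul G v a b e + r' * koszul G v a b' e
    rw [koszul_apply, koszul_apply]
    change (r * fderiv ℝ G v a b e + r' * fderiv ℝ G v a b' e) +
      (r * fderiv ℝ G v b a e + r' * fderiv ℝ G v b' a e) -
      (r * fderiv ℝ G v e a b + r' * fderiv ℝ G v e a b') = _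
    ring
  simp only [christoffel, h, smul_add, map_add, map_smul]
  rw [smul_comm r, smul_comm r']

/-- The Riemannian Hessian `∂_a ∂_b u - du(Γ(a, b))` at `v`, for a function `u` with first and second
derivatives `l` and `B` at `v`. -/
def hessianInChart (G : V → V →L[ℝ] V →L[ℝ] ℝ) (v : V) (l : V →L[ℝ] ℝ) (B : V →L[ℝ] V →L[ℝ] ℝ) :
    LinearMap.BilinForm ℝ V :=
  LinearMap.mk₂ ℝ (fun a b => B a b - l (christoffel G v a b))
    (fun a a' b => by
      have h := christoffel_left G v a a' b 1 1
      simp only [one_smul] at h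
      simp only [h, map_add, add_apply]
      ring)
    (fun r a b => by
      have h := christoffel_left G v a 0 b r 0
      simp only [zero_smul, add_zero] at h
      simp only [h, map_smul, smul_apply, smul_eq_mul]
      ring)
    (fun a b b' => by
      have h := christoffel_right G v a b b' 1 1
      simp only [one_smul] at h
      simp only [h, map_add]
      ring)
    (fun r a b => by
      have h := christoffel_right G v a b 0 r 0
      simp only [zero_smul, add_zero] at h
      simp only [h, map_smul, smul_eq_mul]
      ring)

theorem fderiv_fderiv_sum {f g : V → ℝ} {v : V} (hf : ContDiffAt ℝ ∞ f v)
    (hg : ContDiffAt ℝ ∞ g v) : fderiv ℝ (f + g) v = fderiv ℝ f v + fderiv ℝ g v ∧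
      fderiv ℝ (fderiv ℝ (f + g)) v = fderiv ℝ (fderiv ℝ f) v + fderiv ℝ (fderiv ℝ g) v := by
  have hd : ∀ u : V → ℝ, ContDiffAt ℝ ∞ u v → ∀ᶠ w in 𝓝 v, DifferentiableAt ℝ u w := by
    intro u hu
    filter_upwards [(hu.of_le (m := 1) ENat.LEInfty.out).eventually (by simp)] with w hw
      using hw.differentiableAt one_ne_zero
  have hd' : ∀ u : V → ℝ, ContDiffAt ℝ ∞ u v → DifferentiableAt ℝ (fderiv ℝ u) v := fun u hu =>
    ((hu.of_le (m := 2) ENat.LEInfty.out).fderiv_right (m := 1)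
      (by norm_num)).differentiableAt one_ne_zero
  have h1 : fderiv ℝ (f + g) =ᶠ[𝓝 v] fderiv ℝ f + fderiv ℝ g := by
    filter_upwards [hd f hf, hd g hg] with w h1 h2 using fderiv_add h1 h2
  refine ⟨h1.self_of_nhds, ?_⟩
  rw [h1.fderiv_eq]
  exact fderiv_add (hd' f hf) (hd' g hg)

theorem fderiv_fderiv_smul (c : ℝ) (f : V → ℝ) (v : V) :
    fderiv ℝ (c • f) v = c • fderiv ℝ f v ∧
      fderiv ℝ (fderiv ℝ (c • f)) v = c • fderiv ℝ (fderiv ℝ f) v := by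
  have h1 : fderiv ℝ (c • f) = c • fderiv ℝ f := by
    funext w
    exact congrFun (fderiv_const_smul_field c) w
  refine ⟨congrFun h1 v, ?_⟩
  rw [h1]
  exact congrFun (fderiv_const_smul_field (f := fderiv ℝ f) c) v

end Chart

/-! ### The bundle of two-jets of `M = A × X`

`A` is the closed annulus. A smooth function near a boundary point of `M` is the restriction of a
smooth function on an open subset of `ℂ × X`, and the restriction determines the two-jet; hence the
two-jets of `M` at `p` are those of functions on `ℂ × X`. -/

/-- The closed annulus `A = {s ∈ ℂ | 1 ≤ |s| ≤ 2}`. -/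
def annulus : Set ℂ := {s | 1 ≤ ‖s‖ ∧ ‖s‖ ≤ 2}

variable (X) in
/-- `M = A × X`. -/
abbrev SpaceTime : Type _ := annulus × X

/-- The point of `ℂ × X` given by a point of `M`. -/
def SpaceTime.pt (p : SpaceTime X) : ℂ × X := (p.1, p.2)

variable (n) in
/-- The model `ℂ × ℂ^n` of `ℂ × X`; it is also the tangent space of `M` at every point `p`, where
`{0} × ℂ^n` is the tangent space of `X`. -/
abbrev STModel : Type := ℂ × Model n

/-- A shortcut for instance search. -/
instance : NormedAddCommGroup (STModel n →L[ℝ] ℝ) :=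
  ContinuousLinearMap.toNormedAddCommGroup

/-- A shortcut for instance search. -/
instance : NormedAddCommGroup (STModel n →L[ℝ] STModel n →L[ℝ] ℝ) :=
  ContinuousLinearMap.toNormedAddCommGroup

variable (n) in
/-- The chart of `ℂ × X` around points `(s, x₀)`. -/
def stChart (x₀ : X) (q : ℂ × X) : STModel n := (q.1, chartAt (Model n) x₀ q.2)

variable (n) in
/-- A function on `ℂ × X`, read in the chart around `x₀`. -/
def readInChart (x₀ : X) (f : ℂ × X → ℝ) (v : STModel n) : ℝ :=
  f (v.1, (chartAt (Model n) x₀).symm v.2)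

variable (n) in
/-- The functions that are smooth near `p`. -/
def smoothNear [IsManifold 𝓘(ℂ, Model n) ω X] (p : SpaceTime X) : Submodule ℝ (ℂ × X → ℝ) where
  carrier := {f | ∀ᶠ q in 𝓝 p.pt, ContMDiffAt (𝓘(ℝ, ℂ).prod 𝓘(ℝ, Model n)) 𝓘(ℝ, ℝ) ∞ f q}
  add_mem' := by
    intro f g hf hg
    filter_upwards [hf, hg] with q h1 h2 using h1.add h2
  zero_mem' := Eventually.of_forall fun q => contMDiffAt_const
  smul_mem' := by
    intro c f hf
    filter_upwards [hf] with q h1 using (contMDiffAt_const (I' := 𝓘(ℝ, ℝ)) (c := c)).mul h1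

theorem contDiffAt_readInChart [IsManifold 𝓘(ℂ, Model n) ω X] {p : SpaceTime X}
    (f : smoothNear n p) : ContDiffAt ℝ ∞ (readInChart n p.2 f) (stChart n p.2 p.pt) := by
  have hf : ContMDiffAt (𝓘(ℝ, ℂ).prod 𝓘(ℝ, Model n)) 𝓘(ℝ, ℝ) ∞ f.1 p.pt := f.2.self_of_nhds
  have hs : ContMDiffAt 𝓘(ℝ, Model n) 𝓘(ℝ, Model n) ∞ (chartAt (Model n) p.2).symm
      (chartAt (Model n) p.2 p.2) :=
    contMDiffAt_symm_of_mem_maximalAtlas (IsManifold.chart_mem_maximalAtlas p.2)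
      (mem_chart_target _ p.2)
  have h1 : ContMDiffAt 𝓘(ℝ, STModel n) (𝓘(ℝ, ℂ).prod 𝓘(ℝ, Model n)) ∞
      (fun v : STModel n => (v.1, (chartAt (Model n) p.2).symm v.2)) (stChart n p.2 p.pt) := by
    refine ContMDiffAt.prodMk ?_ ?_
    · exact contDiffAt_fst.contMDiffAt
    · exact ContMDiffAt.comp (stChart n p.2 p.pt) hs contDiffAt_snd.contMDiffAt
  have h2 : ((stChart n p.2 p.pt).1, (chartAt (Model n) p.2).symm (stChart n p.2 p.pt).2)
      = p.pt := by
    simp [stChart, SpaceTime.pt]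
  rw [← contMDiffAt_iff_contDiffAt]
  exact ContMDiffAt.comp (stChart n p.2 p.pt) (by rw [h2]; exact hf) h1

variable (n) in
/-- The value, the first and the second derivative at `p` of a smooth function, in the chart
at `p`. -/
def derivatives [IsManifold 𝓘(ℂ, Model n) ω X] (p : SpaceTime X) : smoothNear n p →ₗ[ℝ]
    ℝ × (STModel n →L[ℝ] ℝ) × (STModel n →L[ℝ] STModel n →L[ℝ] ℝ) where
  toFun f := (f.1 p.pt, fderiv ℝ (readInChart n p.2 f) (stChart n p.2 p.pt),
    fderiv ℝ (fderiv ℝ (readInChart n p.2 f)) (stChart n p.2 p.pt))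
  map_add' f g := by
    have h := fderiv_fderiv_sum (contDiffAt_readInChart f) (contDiffAt_readInChart g)
    exact Prod.ext rfl (Prod.ext h.1 h.2)
  map_smul' c f := by
    have h := fderiv_fderiv_smul c (readInChart n p.2 f) (stChart n p.2 p.pt)
    exact Prod.ext rfl (Prod.ext h.1 h.2)

variable (n) in
/-- The smooth functions that vanish to order three at `p`: their derivatives of order zero, one and
two at `p` are zero. -/
def vanishing [IsManifold 𝓘(ℂ, Model n) ω X] (p : SpaceTime X) : Submodule ℝ (smoothNear n p) :=
  LinearMap.ker (derivatives n p)

variable (n) in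
/-- The fibre `J²_p(M)` of the two-jet bundle. -/
def JetAt [IsManifold 𝓘(ℂ, Model n) ω X] (p : SpaceTime X) : Type _ :=
  smoothNear n p ⧸ vanishing n p

section Jets

variable [IsManifold 𝓘(ℂ, Model n) ω X]

instance (p : SpaceTime X) : AddCommGroup (JetAt n p) :=
  inferInstanceAs (AddCommGroup (smoothNear n p ⧸ vanishing n p))

instance (p : SpaceTime X) : Module ℝ (JetAt n p) :=
  inferInstanceAs (Module ℝ (smoothNear n p ⧸ vanishing n p))

/-- The two-jet at `p` of a function that is smooth near `p`. -/
def jetOf (p : SpaceTime X) : smoothNear n p →ₗ[ℝ] JetAt n p :=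
  (vanishing n p).mkQ

/-- The value and the derivatives of a two-jet at `p`, in the chart at `p`. -/
def jetDerivatives (p : SpaceTime X) : JetAt n p →ₗ[ℝ]
    ℝ × (STModel n →L[ℝ] ℝ) × (STModel n →L[ℝ] STModel n →L[ℝ] ℝ) :=
  (vanishing n p).liftQ (derivatives n p) le_rfl

/-- The topology of the finite-dimensional vector space `J²_p(M)`. -/
instance (p : SpaceTime X) : TopologicalSpace (JetAt n p) :=
  TopologicalSpace.induced (jetDerivatives p) inferInstance

variable (n X) in
/-- The two-jet bundle `J²(M)`. -/
structure JetBundle where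
  /-- The base point. -/
  base : SpaceTime X
  /-- The two-jet at the base point. -/
  jet : JetAt n base

variable (n) in
/-- The quadratic Taylor polynomial at `p` with given coefficients in the chart around `x₀`. -/
def taylor (x₀ : X) (p : SpaceTime X) (r : ℝ) (l : STModel n →L[ℝ] ℝ)
    (B : STModel n →L[ℝ] STModel n →L[ℝ] ℝ) (q : ℂ × X) : ℝ :=
  let d := stChart n x₀ q - stChart n x₀ p.pt
  r + l d + (1 / 2) * B d d

theorem taylor_mem (x₀ : X) (p : SpaceTime X) (hp : p.2 ∈ (chartAt (Model n) x₀).source) (r : ℝ)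
    (l : STModel n →L[ℝ] ℝ) (B : STModel n →L[ℝ] STModel n →L[ℝ] ℝ) :
    taylor n x₀ p r l B ∈ smoothNear n p := by
  have hU : ∀ᶠ q : ℂ × X in 𝓝 p.pt, q.2 ∈ (chartAt (Model n) x₀).source :=
    continuous_snd.continuousAt.eventually ((chartAt (Model n) x₀).open_source.mem_nhds hp)
  refine hU.mono fun q hq => ?_
  have hc : ContMDiffAt 𝓘(ℝ, Model n) 𝓘(ℝ, Model n) ∞ (chartAt (Model n) x₀) q.2 :=
    contMDiffAt_of_mem_maximalAtlas (IsManifold.chart_mem_maximalAtlas x₀) hq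
  have h1 : ContMDiffAt (𝓘(ℝ, ℂ).prod 𝓘(ℝ, Model n)) 𝓘(ℝ, STModel n) ∞ (stChart n x₀) q :=
    contMDiffAt_fst.prodMk_space (ContMDiffAt.comp q hc contMDiffAt_snd)
  have h2 : ContDiff ℝ ∞ fun v : STModel n =>
      r + l (v - stChart n x₀ p.pt) +
        (1 / 2) * B (v - stChart n x₀ p.pt) (v - stChart n x₀ p.pt) := by
    fun_prop
  exact ContMDiffAt.comp q h2.contDiffAt.contMDiffAt h1

variable (n) in
/-- The symmetric bilinear forms on `ℂ × ℂ^n`. -/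
abbrev SymForm : Type := {B : STModel n →L[ℝ] STModel n →L[ℝ] ℝ // ∀ v w, B v w = B w v}

/-- The parametrization of the two-jets over the domain of the chart around `x₀` by the base point
and the Taylor coefficients in this chart. -/
def jetChart (x₀ : X) (z : {p : SpaceTime X // p.2 ∈ (chartAt (Model n) x₀).source} ×
    ℝ × (STModel n →L[ℝ] ℝ) × SymForm n) : JetBundle n X :=
  ⟨z.1.1, jetOf z.1.1 ⟨taylor n x₀ z.1.1 z.2.1 z.2.2.1 z.2.2.2.1,
    taylor_mem x₀ z.1.1 z.1.2 z.2.1 z.2.2.1 z.2.2.2.1⟩⟩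

/-- The topology of the two-jet bundle, glued from the parametrizations `jetChart x₀`. -/
instance : TopologicalSpace (JetBundle n X) :=
  ⨆ x₀ : X, TopologicalSpace.coinduced (jetChart x₀) inferInstance

/-- The fibre `F_p` of a set of two-jets. -/
def fibre (F : Set (JetBundle n X)) (p : SpaceTime X) : Set (JetAt n p) := {j | ⟨p, j⟩ ∈ F}

/-! ### The splitting of the jet bundle -/

variable (n) in
/-- The fibre `ℝ ⊕ T*_p M ⊕ (T*_p M)^{⊗ 2}`, in which `J²_p(M) = ℝ ⊕ T*_p M ⊕ Sym²(T*_p M)` lies. -/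
abbrev SplitJet : Type := ℝ × (STModel n →L[ℝ] ℝ) × LinearMap.BilinForm ℝ (STModel n)

/-- The product of the Euclidean metric of `ℂ` and the Kähler metric, in the chart around `x₀`. -/
def KahlerMetric.productInChart (g : KahlerMetric n X) (x₀ : X) (v : STModel n) :
    STModel n →L[ℝ] STModel n →L[ℝ] ℝ :=
  (show ℂ →L[ℝ] ℂ →L[ℝ] ℝ from innerSL ℝ).bilinearComp
      (ContinuousLinearMap.fst ℝ ℂ (Model n)) (ContinuousLinearMap.fst ℝ ℂ (Model n))
    + (BilinField.inChart g.metric.inner x₀ v.2).bilinearComp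
      (ContinuousLinearMap.snd ℝ ℂ (Model n)) (ContinuousLinearMap.snd ℝ ℂ (Model n))

/-- The Riemannian Hessian at `p` of a two-jet, for the product metric. -/
def KahlerMetric.hessian (g : KahlerMetric n X) (p : SpaceTime X) (j : JetAt n p) :
    LinearMap.BilinForm ℝ (STModel n) :=
  hessianInChart (g.productInChart p.2) (stChart n p.2 p.pt) (jetDerivatives p j).2.1
    (jetDerivatives p j).2.2

/-- The splitting `u ↦ (u, du, Hess u)` of the two-jet bundle by the product metric. -/
def KahlerMetric.split (g : KahlerMetric n X) (p : SpaceTime X) (j : JetAt n p) : SplitJet n :=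
  ((jetDerivatives p j).1, (jetDerivatives p j).2.1, g.hessian p j)

/-! ### Subequations -/

/-- Harvey and Lawson's subequations: closed sets of two-jets with positivity (P), negativity (N) and
the topological conditions (T). The Riemannian metric plays no role in the condition (P), since the
jets in question have vanishing value and differential. -/
structure IsSubequation (F : Set (JetBundle n X)) : Prop where
  isClosed : IsClosed F
  positivity : ∀ (p : SpaceTime X) (j k : JetAt n p), j ∈ fibre F p →
    (jetDerivatives p k).1 = 0 → (jetDerivatives p k).2.1 = 0 →
    (∀ v, 0 ≤ (jetDerivatives p k).2.2 v v) → j + k ∈ fibre F p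
  negativity : ∀ (p : SpaceTime X) (j k : JetAt n p), j ∈ fibre F p →
    (jetDerivatives p k).1 ≤ 0 → (jetDerivatives p k).2.1 = 0 →
    (jetDerivatives p k).2.2 = 0 → j + k ∈ fibre F p
  eq_closure_interior : F = closure (interior F)
  fibre_eq_closure_interior : ∀ p : SpaceTime X, fibre F p = closure (interior (fibre F p))
  fibre_interior : ∀ p : SpaceTime X, fibre (interior F) p = interior (fibre F p)

/-- `F` is purely second order: with respect to the metric splitting, `F = ℝ ⊕ T*M ⊕ F'`. -/
def IsPurelySecondOrder (g : KahlerMetric n X) (F : Set (JetBundle n X)) : Prop :=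
  ∃ F' : SpaceTime X → Set (LinearMap.BilinForm ℝ (STModel n)),
    ∀ (p : SpaceTime X) (j : JetAt n p), ⟨p, j⟩ ∈ F ↔ g.hessian p j ∈ F' p

/-- The Dirichlet dual `∼(-int F)`. -/
def dirichletDual (F : Set (JetBundle n X)) : Set (JetBundle n X) :=
  {z | (⟨z.base, -z.jet⟩ : JetBundle n X) ∉ interior F}

/-! ### The set of jets given by the space-time angle -/

/-- `e₁, …, e_n` is a unitary frame of `T_x X`: together with `J e₁, …, J e_n` it is
`g`-orthonormal. -/
def KahlerMetric.IsUnitaryFrame (g : KahlerMetric n X) (x : X) (e : Fin n → TSpace n x) : Prop :=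
  ∀ j k, g.metric.inner x (e j) (e k) = (if j = k then 1 else 0) ∧
    g.metric.inner x (e j) (complexStr n x (e k)) = 0

/-- The orthonormal frame `e₀, e₁, …, e_n, J e₀, J e₁, …, J e_n` of `T_p M` that extends a unitary
frame of `T_x X`, where `e₀ = 1 ∈ ℂ` is tangent to the annulus. -/
def spaceTimeFrame (x : X) (e : Fin n → TSpace n x) : RealIdx (n + 1) → STModel n :=
  Sum.elim (Fin.cases (1, 0) fun k => (0, e k))
    (Fin.cases (Complex.I, 0) fun k => (0, complexStr n x (e k)))

/-- The matrix of a bilinear form on `T_p M` in the orthonormal frame extending `e`. -/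
def frameMatrix (x : X) (e : Fin n → TSpace n x) (B : LinearMap.BilinForm ℝ (STModel n)) :
    Matrix (RealIdx (n + 1)) (RealIdx (n + 1)) ℝ :=
  Matrix.of fun j k => B (spaceTimeFrame x e j) (spaceTimeFrame x e k)

/-- `𝓕_c` in the fibre at `p` of `ℝ ⊕ T*M ⊕ Sym²(T*M)`: the matrix of the quadratic part in a
unitary frame belongs to `𝓕_c ⊂ Sym²(ℝ^(2n+2))`. -/
def KahlerMetric.angleSet (g : KahlerMetric n X) (p : SpaceTime X) (c : ℝ) : Set (SplitJet n) :=
  {z | ∃ e, g.IsUnitaryFrame p.2 e ∧ frameMatrix p.2 e z.2.2 ∈ localSet n c}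

/-- `ι(Λ)` at `p`, for the relative endomorphism `Λ = ω⁻¹ α`, as a symmetric bilinear form on
`T_p M`: it is the pullback to `M` of the form `g(Λ v, w) = α(v, J w)` on `T_x X`. -/
def ClosedRealOneOneForm.iotaLambda (α : ClosedRealOneOneForm n X) (p : SpaceTime X) :
    LinearMap.BilinForm ℝ (STModel n) :=
  let β : Model n →L[ℝ] Model n →L[ℝ] ℝ := α.form p.2
  let J : Model n →L[ℝ] Model n := complexStr n p.2
  LinearMap.mk₂ ℝ (fun a b => β a.2 (J b.2))
    (by intros; simp) (by intros; simp) (by intros; simp) (by intros; simp)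

/-- The bundle automorphism `σ(r, ℓ, A) = (r, ℓ, A + ι(Λ))`. -/
def ClosedRealOneOneForm.sigma (α : ClosedRealOneOneForm n X) (p : SpaceTime X) (z : SplitJet n) :
    SplitJet n :=
  (z.1, z.2.1, z.2.2 + α.iotaLambda p)

/-- The bundle automorphism `σ̃(r, ℓ, A) = (r, ℓ, A - ι(Λ))`. -/
def ClosedRealOneOneForm.sigmaTilde (α : ClosedRealOneOneForm n X) (p : SpaceTime X)
    (z : SplitJet n) : SplitJet n :=
  (z.1, z.2.1, z.2.2 - α.iotaLambda p)

/-- `𝓕_{σ,c} = σ⁻¹(𝓕_c) ⊂ J²(M)`. -/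
def sigmaSet (g : KahlerMetric n X) (α : ClosedRealOneOneForm n X) (c : ℝ) :
    Set (JetBundle n X) :=
  {z | α.sigma z.base (g.split z.base z.jet) ∈ g.angleSet z.base c}

/-- `𝓕_{σ̃,c} = σ̃⁻¹(𝓕_c) ⊂ J²(M)`. -/
def sigmaTildeSet (g : KahlerMetric n X) (α : ClosedRealOneOneForm n X) (c : ℝ) :
    Set (JetBundle n X) :=
  {z | α.sigmaTilde z.base (g.split z.base z.jet) ∈ g.angleSet z.base c}

end Jets

end SpaceTimeAngle

end

noncomputable section

namespace SpaceTimeAngle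

/-! ### Semicontinuity of sums over eigenvalues -/

section Semicontinuity

variable {ι : Type*} [Fintype ι] [DecidableEq ι]

/-! For symmetric `N` the matrix `M_N = I_{2n} + i p(N)` has positive semidefinite real part, so its
eigenvalues lie in the closed right half plane. There `arg` is continuous except at `0`. Let
`upperArg` and `lowerArg` take the values `π/2` and `-π/2` at `0`; the first is upper and the second
lower semicontinuous on the half plane. Summing over eigenvalues gives `upperAngle` and
`lowerAngle`. The two-case definition of the angle is a single formula, `Φ̃(N) = upperAngle(M_N) /
2` (`spaceTimeAngle_eq`): off `𝒮` the matrix is invertible, and on `𝒮` it splits off a zero block of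
size two, whose two zero eigenvalues account for the summand `π/2`. Replacing `N` by `-N` conjugates
the eigenvalues, hence `-Φ̃(-N) = lowerAngle(M_N) / 2` (`neg_spaceTimeAngle_neg`).

Positivity is monotonicity of the angle (`upperAngle_le_add_I_smul`). After a small perturbation the
added matrix `P` is positive definite and the matrices are invertible. Multiplying by `P⁻¹` does not
change the angle (`upperAngle_posDef_mul`, by homotopy) and turns the addition of `iP` into the
shift of every eigenvalue by `i`, which raises arguments in the half plane.

The topological conditions follow from strictness (`lt_neg_spaceTimeAngle_neg_add`): if `Φ̃(N) ≥ c`,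
then the lower angle of `N + t` exceeds `c` for every `t > 0`. For `n ≥ 1` some eigenvalue has
positive real part, because the trace of `M_N` has real part `2n`; for `n = 0` the angle is `±π/2`
and the bound on `c` decides. So the interior of `𝓕_{σ,c}` is the set where the lower angle exceeds
`c`, both globally and in each fibre (`interior_sigmaSet`, `interior_fibre_sigmaSet`), and its
closure is everything, since adding small multiples of the metric leads into it. The duality
`-Φ̃(-N)` then identifies the Dirichlet dual.

To use semicontinuity on the jet bundle one needs matrices that vary continuously, whereas the
unitary frames are chosen pointwise. Since the angle depends only on the characteristic polynomial,
`M_N` may be replaced by the matrix of the same endomorphism in the coordinate frame of a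
holomorphic chart, `chartMatrix`, which is continuous (`charpoly_spaceTimeMatrix_chart`,
`continuous_chartMatrix`). This rests on the tensoriality of the Hessian (`hessianInChart_pullback`)
and the complex linearity of the coordinate changes, and it also gives independence of the frame. -/

theorem exists_charpoly_eq_prod (A : Matrix ι ι ℂ) : ∃ f : ι → ℂ,
    A.charpoly.roots = Finset.univ.val.map f ∧
    ∀ x : ℂ, (Matrix.scalar ι x - A).det = ∏ i, (x - f i) := by
  have hs := IsAlgClosed.splits A.charpoly
  have hcard : A.charpoly.roots.card = Fintype.card ι := by
    rw [← hs.natDegree_eq_card_roots, A.charpoly_natDegree_eq_dim]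
  obtain ⟨f, hf⟩ : ∃ f : ι → ℂ, A.charpoly.roots = Finset.univ.val.map f := by
    have e : ι ≃ Fin A.charpoly.roots.toList.length :=
      Fintype.equivFinOfCardEq (by rw [Multiset.length_toList, hcard])
    refine ⟨fun i => A.charpoly.roots.toList.get (e i), ?_⟩
    have h1 : (Finset.univ : Finset ι).val.map e = Finset.univ.val := by
      exact congrArg Finset.val (Finset.map_univ_equiv e)
    change _ = Finset.univ.val.map (A.charpoly.roots.toList.get ∘ e)
    rw [← Multiset.map_map A.charpoly.roots.toList.get e, h1]
    rw [Fin.univ_val_map, List.ofFn_get, Multiset.coe_toList]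
  refine ⟨f, hf, fun x => ?_⟩
  rw [← Matrix.eval_charpoly]
  conv_lhs => rw [hs.eq_prod_roots_of_monic A.charpoly_monic, hf]
  rw [Multiset.map_map, Polynomial.eval_multiset_prod, Multiset.map_map]
  simp

/-- A polynomial over `ℂ` is determined by its values. Eigenvalues with multiplicity can thus be
read off from determinant identities, which pass to limits and commute with conjugation. -/
theorem roots_charpoly_eq_of_det_eq {A : Matrix ι ι ℂ} {w : ι → ℂ}
    (h : ∀ x : ℂ, (Matrix.scalar ι x - A).det = ∏ i, (x - w i)) :
    A.charpoly.roots = Finset.univ.val.map w := by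
  have h1 : A.charpoly = ∏ i, (Polynomial.X - Polynomial.C (w i)) := by
    apply Polynomial.funext
    intro x
    rw [Matrix.eval_charpoly, Polynomial.eval_prod, h]
    simp
  rw [h1, ← Polynomial.roots_multiset_prod_X_sub_C (Finset.univ.val.map w), Multiset.map_map]
  rfl

open scoped Matrix.Norms.Operator in
/-- If the eigenvalues of a continuous family of matrices stay in a closed set on which `φ` is upper
semicontinuous, then the sum of `φ` over the eigenvalues is upper semicontinuous. -/
theorem upperSemicontinuous_sum_roots {Z : Type*} [TopologicalSpace Z] {M : Z → Matrix ι ι ℂ}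
    (hM : Continuous M) {S : Set ℂ} (hS : IsClosed S) {φ : ℂ → ℝ} (hφ : UpperSemicontinuousOn φ S)
    (hroots : ∀ z, ∀ x ∈ (M z).charpoly.roots, x ∈ S) :
    UpperSemicontinuous fun z => ((M z).charpoly.roots.map φ).sum := by
  intro z₀ y hy
  by_contra hcon
  have hfr : ∃ᶠ z in 𝓝 z₀, ¬ ((M z).charpoly.roots.map φ).sum < y := not_eventually.1 hcon
  choose f hf hdet using fun z => exists_charpoly_eq_prod (M z)
  have hfS : ∀ z i, f z i ∈ S := fun z i => hroots z _ (by
    rw [hf z]; exact Multiset.mem_map_of_mem _ (Finset.mem_univ_val i))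
  -- The spectrum is bounded by the operator norm, so the eigenvalues stay in a compact ball near
  -- `z₀`.
  have hbd : ∀ᶠ z in 𝓝 z₀, ∀ i, f z i ∈ Metric.closedBall (0 : ℂ) ((‖M z₀‖ + 1) * ‖(1 : Matrix ι ι ℂ)‖) := by
    have h1 : ∀ᶠ z in 𝓝 z₀, ‖M z‖ < ‖M z₀‖ + 1 :=
      hM.norm.continuousAt.eventually_lt continuousAt_const (lt_add_one _)
    filter_upwards [h1] with z hz i
    have h2 : f z i ∈ spectrum ℂ (M z) := by
      rw [Matrix.mem_spectrum_iff_isRoot_charpoly]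
      apply Polynomial.isRoot_of_mem_roots
      rw [hf z]; exact Multiset.mem_map_of_mem _ (Finset.mem_univ_val i)
    rw [mem_closedBall_zero_iff]
    exact (spectrum.norm_le_norm_mul_of_mem h2).trans
      (mul_le_mul_of_nonneg_right hz.le (norm_nonneg _))
  -- The labelling `f z` of the eigenvalues is arbitrary and not continuous in `z`. Along an
  -- ultrafilter all labelled eigenvalues converge at once by compactness, while the assumed failure
  -- of semicontinuity persists.
  obtain ⟨𝒰, h𝒰, h𝒰y⟩ : ∃ 𝒰 : Ultrafilter Z, ↑𝒰 ≤ 𝓝 z₀ ∧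
      ∀ᶠ z in (𝒰 : Filter Z), ¬ ((M z).charpoly.roots.map φ).sum < y := by
    have : NeBot (𝓝 z₀ ⊓ 𝓟 {z | ¬ ((M z).charpoly.roots.map φ).sum < y}) :=
      frequently_mem_iff_neBot.1 hfr
    have h := Ultrafilter.of_le (𝓝 z₀ ⊓ 𝓟 {z | ¬ ((M z).charpoly.roots.map φ).sum < y})
    exact ⟨Ultrafilter.of _, h.trans inf_le_left, h.trans inf_le_right (mem_principal_self _)⟩
  have hlim : ∀ i, ∃ w : ℂ, Tendsto (fun z => f z i) 𝒰 (𝓝 w) := by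
    intro i
    obtain ⟨w, -, hw⟩ := (isCompact_closedBall (0 : ℂ)
      ((‖M z₀‖ + 1) * ‖(1 : Matrix ι ι ℂ)‖)).ultrafilter_le_nhds (𝒰.map fun z => f z i) (by
        rw [le_principal_iff]
        exact h𝒰 (hbd.mono fun z hz => hz i))
    exact ⟨w, hw⟩
  choose w hw using hlim
  have hwS : ∀ i, w i ∈ S := fun i =>
    hS.mem_of_tendsto (hw i) (Eventually.of_forall fun z => hfS z i)
  have hroot : (M z₀).charpoly.roots = Finset.univ.val.map w := by
    refine roots_charpoly_eq_of_det_eq fun x => ?_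
    have h2 : Tendsto (fun z => (Matrix.scalar ι x - M z).det) 𝒰
        (𝓝 (Matrix.scalar ι x - M z₀).det) :=
      ((continuous_const.sub hM).matrix_det.tendsto z₀).mono_left h𝒰
    have h3 : Tendsto (fun z => (Matrix.scalar ι x - M z).det) 𝒰 (𝓝 (∏ i, (x - w i))) := by
      simp_rw [hdet]
      exact tendsto_finsetProd _ fun i _ => tendsto_const_nhds.sub (hw i)
    exact tendsto_nhds_unique h2 h3
  have hsum : ∀ z, ((M z).charpoly.roots.map φ).sum = ∑ i, φ (f z i) := by
    intro z; rw [hf z, Multiset.map_map]; rfl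
  have hsum₀ : ((M z₀).charpoly.roots.map φ).sum = ∑ i, φ (w i) := by
    rw [hroot, Multiset.map_map]; rfl
  simp only at hy
  rw [hsum₀] at hy
  -- The gap is shared among the eigenvalues; the extra `1` keeps the final inequality strict and
  -- allows an empty index type.
  set ε : ℝ := (y - ∑ i, φ (w i)) / (Fintype.card ι + 1) with hε
  have hpos : (0 : ℝ) < Fintype.card ι + 1 := by positivity
  have hε0 : 0 < ε := div_pos (sub_pos.2 hy) hpos
  have hlt : ∀ i, ∀ᶠ z in (𝒰 : Filter Z), φ (f z i) < φ (w i) + ε := fun i => by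
    have h1 := hφ (w i) (hwS i) (φ (w i) + ε) (lt_add_of_pos_right _ hε0)
    exact (tendsto_nhdsWithin_iff.2 ⟨hw i, Eventually.of_forall fun z => hfS z i⟩).eventually h1
  obtain ⟨z, hz1, hz2⟩ := ((eventually_all.2 hlt).and h𝒰y).exists
  apply hz2
  rw [hsum z]
  calc ∑ i, φ (f z i) ≤ ∑ i, (φ (w i) + ε) := Finset.sum_le_sum fun i _ => (hz1 i).le
    _ = ∑ i, φ (w i) + Fintype.card ι * ε := by simp [Finset.sum_add_distrib]
    _ < ∑ i, φ (w i) + (Fintype.card ι + 1) * ε := by nlinarith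
    _ = y := by rw [hε]; field_simp; ring

end Semicontinuity

/-! ### Arguments of complex numbers in the closed right half plane -/

/-- The closed right half plane. -/
def rightHalfPlane : Set ℂ := {z | 0 ≤ z.re}

/-- The principal argument, with the value `π / 2` at zero. -/
def upperArg (z : ℂ) : ℝ := if z = 0 then Real.pi / 2 else z.arg

/-- The principal argument, with the value `-π / 2` at zero. -/
def lowerArg (z : ℂ) : ℝ := if z = 0 then -(Real.pi / 2) else z.arg

theorem isClosed_rightHalfPlane : IsClosed rightHalfPlane :=
  isClosed_le continuous_const Complex.continuous_re

theorem mem_slitPlane_of_rightHalfPlane {z : ℂ} (hz : z ∈ rightHalfPlane) (h0 : z ≠ 0) :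
    z ∈ Complex.slitPlane := by
  rw [Complex.mem_slitPlane_iff]
  by_contra! h
  exact h0 (Complex.ext (le_antisymm h.1 hz) h.2)

theorem abs_arg_le_of_rightHalfPlane {z : ℂ} (hz : z ∈ rightHalfPlane) :
    |z.arg| ≤ Real.pi / 2 := Complex.abs_arg_le_pi_div_two_iff.2 hz

/-- At `0` the value `π/2` is the maximum over the half plane; every other point of the half plane
lies in the slit plane, where `arg` is continuous. -/
theorem upperSemicontinuousOn_upperArg : UpperSemicontinuousOn upperArg rightHalfPlane := by
  intro z hz y hy
  by_cases h0 : z = 0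
  · subst h0
    simp only [upperArg, if_true] at hy
    filter_upwards [self_mem_nhdsWithin] with w hw
    simp only [upperArg]
    split_ifs
    · exact hy
    · exact ((le_abs_self _).trans (abs_arg_le_of_rightHalfPlane hw)).trans_lt hy
  · have h1 := Complex.continuousAt_arg (mem_slitPlane_of_rightHalfPlane hz h0)
    simp only [upperArg, if_neg h0] at hy
    filter_upwards [nhdsWithin_le_nhds (h1.eventually_lt continuousAt_const hy),
      nhdsWithin_le_nhds (isOpen_ne.mem_nhds h0)] with w hw hw0
    simpa only [upperArg, if_neg hw0]

/-- The half plane avoids the negative real axis, the only place where `arg` fails to be odd under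
conjugation. This symmetry carries every fact about `upperArg` over to `lowerArg`. -/
theorem neg_lowerArg {z : ℂ} (hz : z ∈ rightHalfPlane) :
    -lowerArg z = upperArg ((starRingEnd ℂ) z) := by
  by_cases h0 : z = 0
  · simp [h0, lowerArg, upperArg]
  · have h1 : (starRingEnd ℂ) z ≠ 0 := by simpa using h0
    have h2 : z.arg ≠ Real.pi :=
      (Complex.mem_slitPlane_iff_arg.1 (mem_slitPlane_of_rightHalfPlane hz h0)).1
    simp [lowerArg, upperArg, h0, Complex.arg_conj, h2]

theorem upperSemicontinuousOn_neg_lowerArg :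
    UpperSemicontinuousOn (fun z => -lowerArg z) rightHalfPlane := by
  intro z hz y hy
  simp only at hy
  have hc : Tendsto (starRingEnd ℂ) (𝓝[rightHalfPlane] z)
      (𝓝[rightHalfPlane] ((starRingEnd ℂ) z)) := by
    refine tendsto_nhdsWithin_iff.2 ⟨(Complex.continuous_conj.tendsto z).mono_left
      nhdsWithin_le_nhds, ?_⟩
    filter_upwards [self_mem_nhdsWithin] with w hw
    simpa [rightHalfPlane] using hw
  rw [neg_lowerArg hz] at hy
  filter_upwards [hc.eventually (upperSemicontinuousOn_upperArg _
    (by simpa [rightHalfPlane] using hz) y hy), self_mem_nhdsWithin] with w hw hw'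
  simpa only [neg_lowerArg hw']

theorem lowerArg_le_upperArg (z : ℂ) : lowerArg z ≤ upperArg z := by
  simp only [lowerArg, upperArg]
  split_ifs
  · linarith [Real.pi_pos]
  · exact le_rfl

theorem arg_eq_arctan_of_re_pos {z : ℂ} (hz : 0 < z.re) :
    z.arg = Real.arctan (z.im / z.re) := by
  have h := abs_lt.1 (Complex.abs_arg_lt_pi_div_two_iff.2 (Or.inl hz))
  rw [← Complex.tan_arg, Real.arctan_tan h.1 h.2]

/-- Adding a positive imaginary number increases the argument in the right half plane. -/
theorem upperArg_le_lowerArg_add {z : ℂ} (hz : z ∈ rightHalfPlane) {t : ℝ} (ht : 0 < t) :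
    upperArg z ≤ lowerArg (z + t * Complex.I) ∧
      (0 < z.re → upperArg z < lowerArg (z + t * Complex.I)) := by
  have hpi := Real.pi_pos
  rcases (show (0 : ℝ) ≤ z.re from hz).eq_or_lt with h | h
  -- On the imaginary axis strictness fails: both arguments may be `π/2`, or both `-π/2`. The sign
  -- of `z.im` shows that either the left side is the minimum or the right side is the maximum.
  · refine ⟨?_, fun h' => absurd h' (h ▸ lt_irrefl _)⟩
    have hz' : z = z.im * Complex.I := by
      apply Complex.ext <;> simp [← h]
    rcases lt_or_ge z.im 0 with hi | hi
    · have h1 : upperArg z = -(Real.pi / 2) := by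
        have h0 : z ≠ 0 := fun h0 => by simp [h0] at hi
        rw [upperArg, if_neg h0]
        exact Complex.arg_eq_neg_pi_div_two_iff.2 ⟨h.symm, hi⟩
      rw [h1, lowerArg]
      split_ifs with h2
      · exact le_rfl
      · refine (abs_le.1 (abs_arg_le_of_rightHalfPlane ?_)).1
        simp [rightHalfPlane, ← h]
    · have h0 : z + t * Complex.I ≠ 0 := fun h0 => by
        have := congrArg Complex.im h0
        simp at this
        linarith
      have h1 : lowerArg (z + t * Complex.I) = Real.pi / 2 := by
        rw [lowerArg, if_neg h0]
        exact Complex.arg_eq_pi_div_two_iff.2 ⟨by simp [← h], by simp; linarith⟩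
      rw [h1, upperArg]
      split_ifs
      · exact le_rfl
      · exact (abs_le.1 (abs_arg_le_of_rightHalfPlane hz)).2
  · have key : upperArg z < lowerArg (z + t * Complex.I) := by
      have h0 : z ≠ 0 := fun h0 => by simp [h0] at h
      have h1 : z + t * Complex.I ≠ 0 := fun h0 => by
        have := congrArg Complex.re h0
        simp at this
        linarith
      rw [upperArg, if_neg h0, lowerArg, if_neg h1, arg_eq_arctan_of_re_pos h,
        arg_eq_arctan_of_re_pos (by simpa using h)]
      apply Real.arctan_strictMono
      simp only [Complex.add_im, Complex.add_re, Complex.mul_im, Complex.mul_re, Complex.ofReal_re,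
        Complex.ofReal_im, Complex.I_re, Complex.I_im, mul_zero, mul_one, sub_zero, add_zero]
      gcongr
      linarith
    exact ⟨key.le, fun _ => key⟩

/-! ### Angles of accretive matrices -/

section Accretive

variable {ι : Type*} [Fintype ι] [DecidableEq ι]

/-- The sum of the upper arguments of the eigenvalues. -/
def upperAngle (B : Matrix ι ι ℂ) : ℝ := (B.charpoly.roots.map upperArg).sum

/-- The sum of the lower arguments of the eigenvalues. -/
def lowerAngle (B : Matrix ι ι ℂ) : ℝ := (B.charpoly.roots.map lowerArg).sum

/-- The real part of the quadratic form `v* B v` is nonnegative. -/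
def IsAccretive (B : Matrix ι ι ℂ) : Prop := ∀ v : ι → ℂ, 0 ≤ (star v ⬝ᵥ B *ᵥ v).re

theorem upperSemicontinuous_upperAngle {Z : Type*} [TopologicalSpace Z] {M : Z → Matrix ι ι ℂ}
    (hM : Continuous M) (hroots : ∀ z, ∀ x ∈ (M z).charpoly.roots, x ∈ rightHalfPlane) :
    UpperSemicontinuous fun z => upperAngle (M z) :=
  upperSemicontinuous_sum_roots hM isClosed_rightHalfPlane upperSemicontinuousOn_upperArg hroots

theorem lowerSemicontinuous_lowerAngle {Z : Type*} [TopologicalSpace Z] {M : Z → Matrix ι ι ℂ}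
    (hM : Continuous M) (hroots : ∀ z, ∀ x ∈ (M z).charpoly.roots, x ∈ rightHalfPlane) :
    LowerSemicontinuous fun z => lowerAngle (M z) := by
  intro z y hy
  have h : ∀ A : Matrix ι ι ℂ, (A.charpoly.roots.map fun x => -lowerArg x).sum = -lowerAngle A :=
    fun A => by rw [Multiset.sum_map_neg]; rfl
  filter_upwards [upperSemicontinuous_sum_roots hM isClosed_rightHalfPlane
    upperSemicontinuousOn_neg_lowerArg hroots z (-y) (by simp only [h]; exact neg_lt_neg hy)]
    with w hw
  simp only [h] at hw
  exact neg_lt_neg_iff.1 hw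

open scoped ComplexOrder

/-- If `QBv = xv`, then `v*Bv = x · v*Q⁻¹v` with `v*Q⁻¹v > 0`; the real part of the left side is
nonnegative. -/
theorem re_nonneg_of_mem_roots_mul {Q B : Matrix ι ι ℂ} (hQ : Q.PosDef) (hB : IsAccretive B) {x : ℂ}
    (hx : x ∈ (Q * B).charpoly.roots) : x ∈ rightHalfPlane := by
  have h1 := Polynomial.isRoot_of_mem_roots hx
  rw [Polynomial.IsRoot, Matrix.eval_charpoly, ← Matrix.exists_mulVec_eq_zero_iff] at h1
  obtain ⟨v, hv, h⟩ := h1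
  have hQu : IsUnit Q.det := hQ.det_pos.ne'.isUnit
  have h2 : (Q * B) *ᵥ v = x • v := by
    rw [Matrix.sub_mulVec, sub_eq_zero] at h
    rw [← h, Matrix.scalar_apply, ← Matrix.smul_one_eq_diagonal, Matrix.smul_mulVec,
      Matrix.one_mulVec]
  have h3 : B *ᵥ v = x • (Q⁻¹ *ᵥ v) := by
    rw [← Matrix.mulVec_smul, ← h2, ← Matrix.mulVec_mulVec, Matrix.mulVec_mulVec,
      Matrix.nonsing_inv_mul _ hQu, Matrix.one_mulVec]
  have h4 := hB v
  have h5 := Complex.pos_iff.1 (hQ.inv.dotProduct_mulVec_pos hv)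
  rw [h3, dotProduct_smul, smul_eq_mul, Complex.mul_re, ← h5.2, mul_zero, sub_zero] at h4
  exact nonneg_of_mul_nonneg_left h4 h5.1

theorem IsAccretive.re_nonneg {B : Matrix ι ι ℂ} (hB : IsAccretive B) {x : ℂ}
    (hx : x ∈ B.charpoly.roots) : x ∈ rightHalfPlane :=
  re_nonneg_of_mem_roots_mul Matrix.PosDef.one hB (by rwa [one_mul])

theorem zero_mem_roots_iff (B : Matrix ι ι ℂ) : (0 : ℂ) ∈ B.charpoly.roots ↔ B.det = 0 := by
  rw [Matrix.det_eq_prod_roots_charpoly, Multiset.prod_eq_zero_iff]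

theorem lowerAngle_le_upperAngle (B : Matrix ι ι ℂ) : lowerAngle B ≤ upperAngle B :=
  Multiset.sum_map_le_sum_map _ _ fun x _ => lowerArg_le_upperArg x

theorem lowerAngle_eq_upperAngle {B : Matrix ι ι ℂ} (hB : B.det ≠ 0) :
    lowerAngle B = upperAngle B := by
  refine congrArg Multiset.sum (Multiset.map_congr rfl fun x hx => ?_)
  have h0 : x ≠ 0 := fun h => hB ((zero_mem_roots_iff B).1 (h ▸ hx))
  simp [lowerArg, upperArg, h0]

/-- The determinant is the product of the eigenvalues, so the sum of their arguments is one of its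
arguments, without reduction modulo `2π`. -/
theorem norm_mul_exp_upperAngle {B : Matrix ι ι ℂ} (hB : B.det ≠ 0) :
    ‖B.det‖ * Complex.exp (upperAngle B * Complex.I) = B.det := by
  have key : ∀ s : Multiset ℂ, (0 : ℂ) ∉ s →
      (‖s.prod‖ : ℂ) * Complex.exp (((s.map upperArg).sum : ℝ) * Complex.I) = s.prod := by
    intro s
    induction s using Multiset.induction_on with
    | empty => simp
    | cons a s ih =>
      intro h
      rw [Multiset.mem_cons, not_or] at h
      have ha : a ≠ 0 := fun h' => h.1 h'.symm
      rw [Multiset.prod_cons, Multiset.map_cons, Multiset.sum_cons, norm_mul]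
      conv_rhs => rw [← ih h.2, ← Complex.norm_mul_exp_arg_mul_I a]
      rw [upperArg, if_neg ha]
      push_cast
      rw [add_mul, Complex.exp_add]
      ring
  rw [Matrix.det_eq_prod_roots_charpoly] at hB ⊢
  exact key _ fun h => hB (Multiset.prod_eq_zero h)

/-- A continuous real function on an interval whose exponential `exp (i F)` is constant is
constant. -/
theorem eq_of_exp_mul_I_eq {F : ℝ → ℝ} (hF : Continuous F) {w : ℂ} {a b : ℝ}
    (h : ∀ s ∈ uIcc a b, Complex.exp (F s * Complex.I) = w) : F a = F b := by
  by_contra hne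
  have hsub := intermediate_value_uIcc (hF.continuousOn (s := uIcc a b))
  wlog hlt : F a < F b generalizing a b
  · exact this (a := b) (b := a) (by rwa [uIcc_comm]) (Ne.symm hne)
      (by rwa [uIcc_comm, uIcc_comm b a]) (lt_of_le_of_ne (not_lt.1 hlt) (Ne.symm hne))
  -- An increment with `0 < d ≤ π` that is attained by the intermediate value theorem cannot be a
  -- multiple of `2π`.
  set d := min (F b - F a) Real.pi with hd
  have hd0 : 0 < d := lt_min (sub_pos.2 hlt) Real.pi_pos
  obtain ⟨s, hs, hFs⟩ := hsub (show F a + d ∈ uIcc (F a) (F b) by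
    rw [uIcc_of_le hlt.le]
    exact ⟨by linarith, by linarith [min_le_left (F b - F a) Real.pi]⟩)
  have h1 := (h s hs).trans (h a left_mem_uIcc).symm
  rw [Complex.exp_eq_exp_iff_exists_int] at h1
  obtain ⟨k, hk⟩ := h1
  have h2 : F s = F a + k * (2 * Real.pi) := by
    have := congrArg Complex.im hk
    simpa using this
  have h3 : d = k * (2 * Real.pi) := by linarith
  have hpi := Real.pi_pos
  have hk0 : (0 : ℝ) < k := by
    by_contra! hk0
    nlinarith
  have hk1 : (1 : ℝ) ≤ k := by exact_mod_cast Int.cast_pos.1 hk0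
  nlinarith [min_le_right (F b - F a) Real.pi]

/-- The segment from the identity to a positive definite matrix, constant outside `[0, 1]`. -/
theorem posDef_segment {κ : Type*} [DecidableEq κ]
    {Q : Matrix κ κ ℂ} (hQ : Q.PosDef) {s : ℝ} (hs : s ∈ Icc (0 : ℝ) 1) :
    ((1 - s) • (1 : Matrix κ κ ℂ) + s • Q).PosDef := by
  rcases hs.1.eq_or_lt with h | h
  · subst h; simpa using Matrix.PosDef.one
  · rw [add_comm]
    exact (hQ.smul h).add_posSemidef (Matrix.PosSemidef.one.smul (sub_nonneg.2 hs.2))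

/-- Along the segment from `1` to `Q` the eigenvalues of `R B` stay in the half plane and away from
`0`, so the angle is continuous; `det (R B)` is a positive multiple of `det B`, so the angle is
constant modulo `2π`, hence constant. -/
theorem upperAngle_posDef_mul {Q B : Matrix ι ι ℂ} (hQ : Q.PosDef) (hB : IsAccretive B)
    (hdet : B.det ≠ 0) : upperAngle (Q * B) = upperAngle B := by
  -- Clamping the parameter to `[0, 1]` makes the path positive definite for all real `s`, so that
  -- continuity can be stated on `ℝ`.
  let R : ℝ → Matrix ι ι ℂ := fun s =>
    (1 - (projIcc (0 : ℝ) 1 zero_le_one s : ℝ)) • (1 : Matrix ι ι ℂ) +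
      (projIcc (0 : ℝ) 1 zero_le_one s : ℝ) • Q
  have hR : ∀ s, (R s).PosDef := fun s => posDef_segment hQ (projIcc (0 : ℝ) 1 zero_le_one s).2
  have hc : Continuous fun s => R s * B := by
    have h1 : Continuous fun s : ℝ => (projIcc (0 : ℝ) 1 zero_le_one s : ℝ) :=
      continuous_subtype_val.comp continuous_projIcc
    exact (((continuous_const.sub h1).smul continuous_const).add
      (h1.smul continuous_const)).mul continuous_const
  have hroots : ∀ s, ∀ x ∈ (R s * B).charpoly.roots, x ∈ rightHalfPlane :=
    fun s x hx => re_nonneg_of_mem_roots_mul (hR s) hB hx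
  have hdet' : ∀ s, (R s * B).det ≠ 0 := fun s => by
    rw [Matrix.det_mul]; exact mul_ne_zero (hR s).det_pos.ne' hdet
  have hF : Continuous fun s => upperAngle (R s * B) := by
    -- For invertible matrices the lower and upper angles agree, so both semicontinuity statements
    -- apply to the same function.
    rw [continuous_iff_lower_upperSemicontinuous]
    refine ⟨?_, upperSemicontinuous_upperAngle hc hroots⟩
    have h1 := lowerSemicontinuous_lowerAngle hc hroots
    simpa only [lowerAngle_eq_upperAngle (hdet' _)] using h1
  have key := eq_of_exp_mul_I_eq hF (w := B.det / ‖B.det‖) (a := 0) (b := 1) (fun s _ => by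
    have h1 := norm_mul_exp_upperAngle (hdet' s)
    have h2 := Complex.pos_iff.1 (hR s).det_pos
    have h3 : (R s).det = ((R s).det.re : ℂ) := Complex.ext rfl (by simpa using h2.2.symm)
    have h4 : ((R s).det.re : ℂ) ≠ 0 := by exact_mod_cast h2.1.ne'
    have h5 : (‖B.det‖ : ℂ) ≠ 0 := by exact_mod_cast (norm_ne_zero_iff.2 hdet)
    rw [Matrix.det_mul, norm_mul, h3, Complex.norm_real, Real.norm_of_nonneg h2.1.le] at h1
    rw [eq_div_iff h5]
    apply mul_left_cancel₀ h4
    rw [← h1]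
    push_cast
    ring)
  have h0 : R 0 = 1 := by simp [R]
  have h1 : R 1 = Q := by simp [R]
  rw [← h1, ← key, h0, one_mul]

theorem roots_charpoly_add_smul_one (B : Matrix ι ι ℂ) (c : ℂ) :
    (B + c • (1 : Matrix ι ι ℂ)).charpoly.roots = B.charpoly.roots.map fun x => x + c := by
  obtain ⟨f, hf, hdet⟩ := exists_charpoly_eq_prod B
  rw [hf, Multiset.map_map]
  refine roots_charpoly_eq_of_det_eq fun x => ?_
  have h1 : Matrix.scalar ι x - (B + c • (1 : Matrix ι ι ℂ)) = Matrix.scalar ι (x - c) - B := by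
    rw [map_sub, Matrix.scalar_apply, Matrix.scalar_apply, Matrix.smul_one_eq_diagonal]
    abel
  rw [h1, hdet]
  exact Finset.prod_congr rfl fun i _ => by simp only [Function.comp]; ring

theorem upperAngle_le_lowerAngle_add {B : Matrix ι ι ℂ}
    (hB : ∀ x ∈ B.charpoly.roots, x ∈ rightHalfPlane) {t : ℝ} (ht : 0 < t) :
    upperAngle B ≤ lowerAngle (B + (t * Complex.I) • (1 : Matrix ι ι ℂ)) := by
  rw [lowerAngle, roots_charpoly_add_smul_one, Multiset.map_map]
  exact Multiset.sum_map_le_sum_map _ _ fun x hx => (upperArg_le_lowerArg_add (hB x hx) ht).1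

/-- A trace with positive real part forces an eigenvalue with positive real part, and for that one
the shift raises the argument strictly. -/
theorem upperAngle_lt_lowerAngle_add {B : Matrix ι ι ℂ} (hB : IsAccretive B)
    (htr : 0 < B.trace.re) {t : ℝ} (ht : 0 < t) :
    upperAngle B < lowerAngle (B + (t * Complex.I) • (1 : Matrix ι ι ℂ)) := by
  rw [lowerAngle, roots_charpoly_add_smul_one, Multiset.map_map]
  refine Multiset.sum_lt_sum (fun x hx => (upperArg_le_lowerArg_add (hB.re_nonneg hx) ht).1) ?_
  by_contra! hcon
  have h1 : ∀ x ∈ B.charpoly.roots, x.re ≤ 0 := fun x hx => by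
    by_contra! h
    exact absurd ((upperArg_le_lowerArg_add (hB.re_nonneg hx) ht).2 h) (not_lt.2 (hcon x hx))
  rw [Matrix.trace_eq_sum_roots_charpoly] at htr
  have h2 : B.charpoly.roots.sum.re = (B.charpoly.roots.map Complex.re).sum :=
    map_multiset_sum Complex.reAddGroupHom _
  rw [h2] at htr
  refine absurd htr (not_lt.2 ?_)
  calc (B.charpoly.roots.map Complex.re).sum ≤ (B.charpoly.roots.map fun _ => (0 : ℝ)).sum :=
        Multiset.sum_map_le_sum_map _ _ h1
    _ = 0 := by simp

theorem IsAccretive.add_I_smul {κ : Type*} [Fintype κ]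
    {B P : Matrix κ κ ℂ} (hB : IsAccretive B) (hP : P.PosSemidef) :
    IsAccretive (B + Complex.I • P) := by
  intro v
  have h := (Complex.nonneg_iff.1 (hP.dotProduct_mulVec_nonneg v)).2
  rw [Matrix.add_mulVec, dotProduct_add, Matrix.smul_mulVec, dotProduct_smul, smul_eq_mul,
    Complex.add_re, Complex.mul_re, ← h]
  simpa using hB v

/-- Only finitely many `t` hit one of the finitely many eigenvalues. The factor `a` allows two
shifts of different speed to be made invertible by a common `t`. -/
theorem eventually_det_add_ne_zero (B : Matrix ι ι ℂ) {a : ℝ} (ha : 0 < a) :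
    ∀ᶠ t : ℝ in 𝓝[>] 0, (B + ((a * t : ℝ) * Complex.I) • (1 : Matrix ι ι ℂ)).det ≠ 0 := by
  have hinj : Function.Injective fun t : ℝ => -((a * t : ℝ) * Complex.I) := fun s t h => by
    have := congrArg Complex.im h
    simpa [ha.ne'] using this
  have hfin : {t : ℝ | -((a * t : ℝ) * Complex.I) ∈ B.charpoly.roots}.Finite :=
    Set.Finite.preimage hinj.injOn (s := {x | x ∈ B.charpoly.roots})
      (B.charpoly.roots.toFinset.finite_toSet.subset fun x hx => by simpa using hx)
  have h1 : ∀ᶠ t : ℝ in 𝓝[>] 0,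
      t ∈ ({t : ℝ | -((a * t : ℝ) * Complex.I) ∈ B.charpoly.roots} \ {0})ᶜ :=
    nhdsWithin_le_nhds ((hfin.subset sdiff_subset).isClosed.isOpen_compl.mem_nhds (by simp))
  filter_upwards [h1, self_mem_nhdsWithin] with t ht ht0 hdet
  rw [← zero_mem_roots_iff, roots_charpoly_add_smul_one, Multiset.mem_map] at hdet
  obtain ⟨x, hx, hxt⟩ := hdet
  refine ht ⟨?_, ne_of_gt ht0⟩
  rw [mem_ofPred_eq, ← eq_neg_of_add_eq_zero_left hxt]
  exact hx

/-- Monotonicity of the angle. -/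
theorem upperAngle_le_add_I_smul {B P : Matrix ι ι ℂ} (hB : IsAccretive B) (hP : P.PosSemidef) :
    upperAngle B ≤ upperAngle (B + Complex.I • P) := by
  have hone : ∀ t : ℝ, (t * Complex.I) • (1 : Matrix ι ι ℂ) = Complex.I • (t • 1) := fun t => by
    rw [mul_comm, mul_smul, Complex.coe_smul]
  have hpsd : ∀ t : ℝ, 0 ≤ t → (t • (1 : Matrix ι ι ℂ)).PosSemidef := fun t ht =>
    Matrix.PosSemidef.one.smul ht
  by_contra! hcon
  -- Truncation at `t = 0` keeps the whole family accretive, as the semicontinuity statement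
  -- requires.
  have hM : Continuous fun t : ℝ =>
      B + Complex.I • P + (((max t 0 : ℝ) : ℂ) * Complex.I) • (1 : Matrix ι ι ℂ) := by
    fun_prop
  have husc := upperSemicontinuous_upperAngle hM (fun t x hx => by
    refine ((hB.add_I_smul hP).add_I_smul (hpsd _ (le_max_right t 0))).re_nonneg ?_
    rwa [← hone])
  have h1 := husc 0 (upperAngle B) (by simpa using hcon)
  have h2 := (h1.filter_mono (nhdsWithin_le_nhds (s := Ioi 0))).and
    ((eventually_det_add_ne_zero B (a := 1 / 2) (by norm_num)).and
      ((eventually_det_add_ne_zero (B + Complex.I • P) one_pos).and self_mem_nhdsWithin))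
  obtain ⟨t, ht1, ht2, ht3, ht0⟩ := h2.exists
  have ht0 : (0 : ℝ) < t := ht0
  simp only [max_eq_left ht0.le] at ht1
  rw [one_mul] at ht3
  refine absurd ht1 (not_lt.2 ?_)
  -- The shift by `t` is split in two halves: one makes `B` invertible, the other makes `P` positive
  -- definite.
  set B' := B + ((1 / 2 * t : ℝ) * Complex.I) • (1 : Matrix ι ι ℂ) with hB'
  have hacc' : IsAccretive B' := by
    rw [hB', hone]; exact hB.add_I_smul (hpsd _ (by positivity))
  set P' : Matrix ι ι ℂ := (1 / 2 * t : ℝ) • (1 : Matrix ι ι ℂ) + P with hP'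
  have hPd : P'.PosDef := (Matrix.PosDef.one.smul (by positivity)).add_posSemidef hP
  have hsum : B + Complex.I • P + ((t : ℂ) * Complex.I) • (1 : Matrix ι ι ℂ) =
      B' + Complex.I • P' := by
    rw [hB', hP', hone, hone, smul_add]
    have : (t • (1 : Matrix ι ι ℂ)) = (1 / 2 * t) • 1 + (1 / 2 * t) • 1 := by
      rw [← add_smul]; congr 1; ring
    rw [this, smul_add]
    abel
  rw [hsum] at ht3 ⊢
  have hacc'' : IsAccretive (B' + Complex.I • P') := hacc'.add_I_smul hPd.posSemidef
  have hu : IsUnit P'.det := hPd.det_pos.ne'.isUnit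
  have hroots : ∀ x ∈ (P'⁻¹ * B').charpoly.roots, x ∈ rightHalfPlane := fun x hx =>
    re_nonneg_of_mem_roots_mul hPd.inv hacc' hx
  -- After multiplication by `P'⁻¹` the summand `i P'` becomes `i` times the identity, and the
  -- comparison reduces to single eigenvalues.
  calc upperAngle B ≤ lowerAngle B' := upperAngle_le_lowerAngle_add
        (fun x hx => hB.re_nonneg hx) (by positivity)
    _ = upperAngle B' := lowerAngle_eq_upperAngle ht2
    _ = upperAngle (P'⁻¹ * B') := (upperAngle_posDef_mul hPd.inv hacc' ht2).symm
    _ ≤ lowerAngle (P'⁻¹ * B' + ((1 : ℝ) * Complex.I) • (1 : Matrix ι ι ℂ)) :=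
        upperAngle_le_lowerAngle_add hroots one_pos
    _ = lowerAngle (P'⁻¹ * (B' + Complex.I • P')) := by
        rw [Matrix.mul_add P'⁻¹ B' (Complex.I • P'), Matrix.mul_smul, Matrix.nonsing_inv_mul _ hu,
          Complex.ofReal_one, one_mul]
    _ ≤ upperAngle (P'⁻¹ * (B' + Complex.I • P')) := lowerAngle_le_upperAngle _
    _ = upperAngle (B' + Complex.I • P') := upperAngle_posDef_mul hPd.inv hacc'' ht3

end Accretive

/-! ### The space-time angle as a sum of upper arguments -/

section Angle

variable {ι : Type} [Fintype ι] [DecidableEq ι]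

theorem complexMatrix_apply {κ : Type} (R P : Matrix κ κ ℝ) (j k : κ) :
    complexMatrix R P j k = R j k + Complex.I * P j k := rfl

open scoped ComplexOrder in
-- Split `v = x + iy`: by symmetry of `P` the mixed terms cancel and `v*Pv = xᵀPx + yᵀPy`.
theorem posSemidef_map_ofReal {κ : Type} [Fintype κ] {P : Matrix κ κ ℝ} (hP : P.PosSemidef) :
    (P.map Complex.ofReal).PosSemidef := by
  refine .of_dotProduct_mulVec_nonneg ?_ fun v => ?_
  · ext j k
    have := congrFun (congrFun hP.1 j) k
    simpa [Matrix.conjTranspose_apply] using this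
  · have h : ∀ j, v j = ((v j).re : ℂ) + (v j).im * Complex.I := fun j => (Complex.re_add_im _).symm
    have hx := hP.dotProduct_mulVec_nonneg fun j => (v j).re
    have hy := hP.dotProduct_mulVec_nonneg fun j => (v j).im
    have hs : ∀ j k, P j k = P k j := fun j k => by
      simpa using (congrFun (congrFun hP.1 k) j)
    simp only [dotProduct, Matrix.mulVec, Pi.star_apply, star_trivial] at hx hy
    rw [Complex.nonneg_iff]
    simp only [dotProduct, Matrix.mulVec, Pi.star_apply, Finset.mul_sum, Complex.re_sum,
      Complex.im_sum, Matrix.map_apply] at hx hy ⊢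
    constructor
    · refine (add_nonneg hx hy).trans_eq ?_
      simp only [← Finset.sum_add_distrib]
      refine Finset.sum_congr rfl fun j _ => Finset.sum_congr rfl fun k _ => ?_
      simp
    · have hcomm : ∑ j, ∑ k, (v j).re * (P j k * (v k).im) =
          ∑ j, ∑ k, (v j).im * (P j k * (v k).re) := by
        rw [Finset.sum_comm]
        refine Finset.sum_congr rfl fun j _ => Finset.sum_congr rfl fun k _ => ?_
        rw [hs]; ring
      symm
      calc _ = ∑ j, ∑ k, (v j).re * (P j k * (v k).im) - ∑ j, ∑ k, (v j).im * (P j k * (v k).re) := by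
            simp only [← Finset.sum_sub_distrib]
            refine Finset.sum_congr rfl fun j _ => Finset.sum_congr rfl fun k _ => ?_
            simp
            ring
        _ = 0 := by rw [hcomm, sub_self]

open scoped ComplexOrder in
-- A real symmetric `P` has real values `v*Pv`, so `iP` contributes nothing to the real part.
theorem isAccretive_complexMatrix {κ : Type} [Fintype κ]
    {R P : Matrix κ κ ℝ} (hR : R.PosSemidef) (hP : P.IsSymm) :
    IsAccretive (complexMatrix R P) := by
  intro v
  have h1 := (Complex.nonneg_iff.1 ((posSemidef_map_ofReal hR).dotProduct_mulVec_nonneg v)).1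
  have hH : (P.map Complex.ofReal).IsHermitian := by
    ext j k
    simpa [Matrix.conjTranspose_apply] using congrFun (congrFun hP j) k
  have h2 := hH.im_star_dotProduct_mulVec_self v
  rw [complexMatrix, Matrix.add_mulVec, dotProduct_add, Matrix.smul_mulVec, dotProduct_smul,
    smul_eq_mul, Complex.add_re, Complex.mul_re]
  have h3 : (star v ⬝ᵥ P.map Complex.ofReal *ᵥ v).im = 0 := h2
  rw [h3]
  simpa using h1

theorem roots_charpoly_complexMatrix_neg (R P : Matrix ι ι ℝ) :
    (complexMatrix R (-P)).charpoly.roots =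
      (complexMatrix R P).charpoly.roots.map (starRingEnd ℂ) := by
  obtain ⟨f, hf, hdet⟩ := exists_charpoly_eq_prod (complexMatrix R P)
  rw [hf, Multiset.map_map]
  refine roots_charpoly_eq_of_det_eq fun x => ?_
  have h1 : Matrix.scalar ι x - complexMatrix R (-P) =
      (starRingEnd ℂ).mapMatrix (Matrix.scalar ι ((starRingEnd ℂ) x) - complexMatrix R P) := by
    ext j k
    simp only [Matrix.scalar_apply, Matrix.sub_apply, RingHom.mapMatrix_apply, Matrix.map_apply,
      complexMatrix_apply, Matrix.diagonal_apply, Matrix.neg_apply]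
    split_ifs <;> simp
  rw [h1, ← RingHom.map_det, hdet, map_prod]
  simp

theorem neg_upperAngle_complexMatrix_neg {R P : Matrix ι ι ℝ} (hR : R.PosSemidef)
    (hP : P.IsSymm) :
    -upperAngle (complexMatrix R (-P)) = lowerAngle (complexMatrix R P) := by
  rw [upperAngle, roots_charpoly_complexMatrix_neg, Multiset.map_map, lowerAngle,
    ← Multiset.sum_map_neg]
  refine congrArg Multiset.sum (Multiset.map_congr rfl fun x hx => ?_)
  rw [Function.comp, ← neg_lowerArg ((isAccretive_complexMatrix hR hP).re_nonneg hx), neg_neg]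

/-! ### Algebra of the projection onto the `J`-invariant matrices. -/

theorem stdJ_transpose (m : ℕ) : (stdJ m)ᵀ = -stdJ m := by
  rw [stdJ, Matrix.fromBlocks_transpose, Matrix.fromBlocks_neg]
  simp

theorem stdJ_mul_self (m : ℕ) : stdJ m * stdJ m = -1 := by
  rw [stdJ, Matrix.fromBlocks_multiply, ← Matrix.fromBlocks_one, Matrix.fromBlocks_neg]
  simp

/-- Averaging over `J` makes `p(N)` complex linear. Its kernel is therefore `J`-invariant, and for
`m = 1` and symmetric `N` it is a scalar. -/
theorem projJ_mul_stdJ {m : ℕ} (N : Matrix (RealIdx m) (RealIdx m) ℝ) :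
    projJ N * stdJ m = stdJ m * projJ N := by
  have h := stdJ_mul_self m
  simp only [projJ, stdJ_transpose, Matrix.smul_mul, Matrix.mul_smul, Matrix.add_mul,
    Matrix.mul_add, Matrix.neg_mul, Matrix.mul_neg, Matrix.mul_assoc, h]
  simp only [← Matrix.mul_assoc, h]
  simp [add_comm]

theorem projJ_isSymm {m : ℕ} {N : Matrix (RealIdx m) (RealIdx m) ℝ} (hN : N.IsSymm) :
    (projJ N).IsSymm := by
  have h : Nᵀ = N := hN
  rw [Matrix.IsSymm, projJ, Matrix.transpose_smul, Matrix.transpose_add, Matrix.transpose_mul,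
    Matrix.transpose_mul, Matrix.transpose_transpose, h, Matrix.mul_assoc]

theorem projJ_add {m : ℕ} (N P : Matrix (RealIdx m) (RealIdx m) ℝ) :
    projJ (N + P) = projJ N + projJ P := by
  simp only [projJ, Matrix.mul_add, Matrix.add_mul, smul_add]
  abel

theorem projJ_smul {m : ℕ} (t : ℝ) (N : Matrix (RealIdx m) (RealIdx m) ℝ) :
    projJ (t • N) = t • projJ N := by
  simp only [projJ, Matrix.mul_smul, Matrix.smul_mul, ← smul_add]
  rw [smul_comm]

theorem projJ_neg {m : ℕ} (N : Matrix (RealIdx m) (RealIdx m) ℝ) : projJ (-N) = -projJ N := by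
  rw [← neg_one_smul ℝ, projJ_smul, neg_one_smul]

theorem projJ_one (m : ℕ) : projJ (1 : Matrix (RealIdx m) (RealIdx m) ℝ) = 1 := by
  rw [projJ, Matrix.mul_one, stdJ_transpose, Matrix.neg_mul, stdJ_mul_self, neg_neg, ← two_smul ℝ,
    smul_smul]
  norm_num

theorem projJ_posSemidef {m : ℕ} {P : Matrix (RealIdx m) (RealIdx m) ℝ} (hP : P.PosSemidef) :
    (projJ P).PosSemidef := by
  refine (hP.add ?_).smul (by norm_num)
  have := hP.conjTranspose_mul_mul_same (stdJ m)
  rwa [Matrix.conjTranspose_eq_transpose_of_trivial] at this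

variable {n : ℕ}

/-- The complex matrix `I_{2n} + i p(N)`. -/
def spaceTimeMatrix (N : Matrix (RealIdx (n + 1)) (RealIdx (n + 1)) ℝ) :
    Matrix (RealIdx (n + 1)) (RealIdx (n + 1)) ℂ :=
  complexMatrix (degenerateId n) (projJ N)

theorem degenerateId_posSemidef (n : ℕ) : (degenerateId n).PosSemidef := by
  refine Matrix.PosSemidef.diagonal fun k => ?_
  rcases k with k | k <;> by_cases h : k = 0 <;> simp [h]

theorem isAccretive_spaceTimeMatrix {N : Matrix (RealIdx (n + 1)) (RealIdx (n + 1)) ℝ}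
    (hN : N.IsSymm) : IsAccretive (spaceTimeMatrix N) :=
  isAccretive_complexMatrix (degenerateId_posSemidef n) (projJ_isSymm hN)

/-- The equivalence of indices that splits off the two real coordinates of the annulus. -/
def splitIdx (n : ℕ) : Bool ⊕ RealIdx n ≃ RealIdx (n + 1) :=
  Equiv.ofBijective (Sum.elim (fun b => if b then Sum.inl 0 else Sum.inr 0) (spaceIdx n)) (by
    constructor
    · rintro (a | a | a) (b | b | b) h <;> (try cases a) <;> (try cases b) <;>
        simp_all [spaceIdx, eq_comm]
    · rintro (k | k) <;> refine Fin.cases ?_ (fun k => ?_) k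
      · exact ⟨Sum.inl true, rfl⟩
      · exact ⟨Sum.inr (Sum.inl k), rfl⟩
      · exact ⟨Sum.inl false, rfl⟩
      · exact ⟨Sum.inr (Sum.inr k), rfl⟩)

theorem degenerateId_spaceIdx (j k : RealIdx n) :
    degenerateId n (spaceIdx n j) (spaceIdx n k) = (1 : Matrix (RealIdx n) (RealIdx n) ℝ) j k := by
  rw [degenerateId, Matrix.diagonal_apply, Matrix.one_apply]
  rcases j with j | j <;> rcases k with k | k <;> simp [spaceIdx, Fin.succ_ne_zero]

theorem spaceTimeMatrix_eq_fromBlocks {N : Matrix (RealIdx (n + 1)) (RealIdx (n + 1)) ℝ}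
    (hN : N ∈ degenerateSet n) : (spaceTimeMatrix N).submatrix (splitIdx n) (splitIdx n) =
      Matrix.fromBlocks (0 : Matrix Bool Bool ℂ) 0 0
        (complexMatrix 1 (truncation (projJ N))) := by
  ext j k
  have hrow : ∀ (b : Bool) k, projJ N (splitIdx n (Sum.inl b)) k = 0 := fun b k => by
    cases b
    · exact (hN k).2.1
    · exact (hN k).1
  have hcol : ∀ (b : Bool) k, projJ N k (splitIdx n (Sum.inl b)) = 0 := fun b k => by
    cases b
    · exact (hN k).2.2.2
    · exact (hN k).2.2.1
  have hd : ∀ b : Bool, degenerateId n (splitIdx n (Sum.inl b)) (splitIdx n (Sum.inl b)) = 0 := fun b => by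
    rw [degenerateId, Matrix.diagonal_apply_eq]
    cases b <;> rfl
  have hoff : ∀ j k, j ≠ k → degenerateId n (splitIdx n j) (splitIdx n k) = 0 := fun j k h =>
    Matrix.diagonal_apply_ne _ ((splitIdx n).injective.ne h)
  rcases j with j | j <;> rcases k with k | k
  · by_cases h : j = k
    · subst h; simp [spaceTimeMatrix, complexMatrix_apply, hrow, hd]
    · simp [spaceTimeMatrix, complexMatrix_apply, hrow, hoff (Sum.inl j) (Sum.inl k) (by simpa)]
  · simp [spaceTimeMatrix, complexMatrix_apply, hrow, hoff (Sum.inl j) (Sum.inr k) (by simp)]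
  · simp [spaceTimeMatrix, complexMatrix_apply, hcol, hoff (Sum.inr j) (Sum.inl k) (by simp)]
  · have h := degenerateId_spaceIdx j k
    change ((degenerateId n (spaceIdx n j) (spaceIdx n k) : ℝ) : ℂ) + _ = _
    rw [h]
    rfl

/-! ### The kernel of the space-time matrix and the degenerate set. -/

theorem stdJ_mulVec_inl {m : ℕ} (w : RealIdx m → ℝ) (k : Fin m) :
    (stdJ m *ᵥ w) (Sum.inl k) = -w (Sum.inr k) := by
  simp [stdJ, Matrix.fromBlocks_mulVec, Matrix.neg_mulVec]

theorem stdJ_mulVec_inr {m : ℕ} (w : RealIdx m → ℝ) (k : Fin m) :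
    (stdJ m *ᵥ w) (Sum.inr k) = w (Sum.inl k) := by
  simp [stdJ, Matrix.fromBlocks_mulVec, Matrix.neg_mulVec]

theorem mulVec_of_support (P : Matrix (RealIdx (n + 1)) (RealIdx (n + 1)) ℝ)
    {w : RealIdx (n + 1) → ℝ} (hw : ∀ k, k ≠ 0 → w (Sum.inl k) = 0 ∧ w (Sum.inr k) = 0)
    (j : RealIdx (n + 1)) :
    (P *ᵥ w) j = P j (Sum.inl 0) * w (Sum.inl 0) + P j (Sum.inr 0) * w (Sum.inr 0) := by
  rw [Matrix.mulVec, dotProduct, Fintype.sum_sum_type, Finset.sum_eq_single 0,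
    Finset.sum_eq_single 0]
  all_goals simp +contextual [hw]

/-- With `w` also `Jw` lies in the kernel of `p(N)`. The two span the annulus plane, so both annulus
columns vanish, and by symmetry both rows. -/
theorem mem_degenerateSet_of_mulVec {N : Matrix (RealIdx (n + 1)) (RealIdx (n + 1)) ℝ}
    (hN : N.IsSymm) {w : RealIdx (n + 1) → ℝ} (h0 : w ≠ 0)
    (hw : ∀ k, k ≠ 0 → w (Sum.inl k) = 0 ∧ w (Sum.inr k) = 0) (hP : projJ N *ᵥ w = 0) :
    N ∈ degenerateSet n := by
  set P := projJ N with hPdef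
  have hJw : P *ᵥ (stdJ (n + 1) *ᵥ w) = 0 := by
    rw [Matrix.mulVec_mulVec, projJ_mul_stdJ, ← Matrix.mulVec_mulVec, hP, Matrix.mulVec_zero]
  have h1 : ∀ j, P j (Sum.inl 0) * w (Sum.inl 0) + P j (Sum.inr 0) * w (Sum.inr 0) = 0 := fun j => by
    rw [← mulVec_of_support P hw, hP]; rfl
  have h2 : ∀ j, -(P j (Sum.inl 0) * w (Sum.inr 0)) + P j (Sum.inr 0) * w (Sum.inl 0) = 0 :=
    fun j => by
      have := mulVec_of_support P (w := stdJ (n + 1) *ᵥ w) (fun k hk => by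
        rw [stdJ_mulVec_inl, stdJ_mulVec_inr, (hw k hk).1, (hw k hk).2]; simp) j
      rw [hJw, stdJ_mulVec_inl, stdJ_mulVec_inr] at this
      simp only [Pi.zero_apply, mul_neg] at this
      exact this.symm
  -- This is the determinant of the linear system `h1`, `h2` for the two entries of row `j`.
  have hne : w (Sum.inl 0) ^ 2 + w (Sum.inr 0) ^ 2 ≠ 0 := by
    intro h
    have ha : w (Sum.inl 0) = 0 := by nlinarith [sq_nonneg (w (Sum.inl 0)), sq_nonneg (w (Sum.inr 0))]
    have hb : w (Sum.inr 0) = 0 := by nlinarith [sq_nonneg (w (Sum.inl 0)), sq_nonneg (w (Sum.inr 0))]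
    apply h0
    funext k
    rcases k with k | k <;> by_cases hk : k = 0
    · rw [hk]; exact ha
    · exact (hw k hk).1
    · rw [hk]; exact hb
    · exact (hw k hk).2
  have hl : ∀ j, P j (Sum.inl 0) = 0 := fun j => by
    have : P j (Sum.inl 0) * (w (Sum.inl 0) ^ 2 + w (Sum.inr 0) ^ 2) = 0 := by
      linear_combination w (Sum.inl 0) * h1 j - w (Sum.inr 0) * h2 j
    exact (mul_eq_zero.1 this).resolve_right hne
  have hr : ∀ j, P j (Sum.inr 0) = 0 := fun j => by
    have : P j (Sum.inr 0) * (w (Sum.inl 0) ^ 2 + w (Sum.inr 0) ^ 2) = 0 := by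
      linear_combination w (Sum.inr 0) * h1 j + w (Sum.inl 0) * h2 j
    exact (mul_eq_zero.1 this).resolve_right hne
  have hs : ∀ j k, P j k = P k j := fun j k => (projJ_isSymm hN).apply k j
  exact fun k => ⟨(hs _ _).trans (hl k), (hs _ _).trans (hr k), hl k, hr k⟩

/-- For a kernel vector `v`, the real part of `v*M_N v` is the sum of `|v_k|²` over the space
coordinates. So `v` lives in the annulus coordinates and `p(N)v = 0`; its real or imaginary part is
a nonzero real vector of this kind. -/
theorem det_spaceTimeMatrix_ne_zero {N : Matrix (RealIdx (n + 1)) (RealIdx (n + 1)) ℝ}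
    (hN : N.IsSymm) (hS : N ∉ degenerateSet n) : (spaceTimeMatrix N).det ≠ 0 := by
  intro hdet
  rw [← Matrix.exists_mulVec_eq_zero_iff] at hdet
  obtain ⟨v, hv, h⟩ := hdet
  have hH : ((projJ N).map Complex.ofReal).IsHermitian := by
    ext j k
    simpa [Matrix.conjTranspose_apply] using congrFun (congrFun (projJ_isSymm hN) j) k
  have him : (star v ⬝ᵥ (projJ N).map Complex.ofReal *ᵥ v).im = 0 :=
    hH.im_star_dotProduct_mulVec_self v
  have hre : (star v ⬝ᵥ (degenerateId n).map Complex.ofReal *ᵥ v).re = 0 := by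
    have h1 := congrArg (fun u => (star v ⬝ᵥ u).re) h
    simp only [spaceTimeMatrix, complexMatrix] at h1
    rw [Matrix.add_mulVec, dotProduct_add, Matrix.smul_mulVec, dotProduct_smul,
      smul_eq_mul, Complex.add_re, Complex.mul_re, him] at h1
    simpa using h1
  have hd : (degenerateId n).map Complex.ofReal = Matrix.diagonal (fun k => ((Sum.elim
      (fun k : Fin (n + 1) => if k = 0 then (0 : ℝ) else 1) (fun k => if k = 0 then 0 else 1) k : ℝ) : ℂ)) := by
    rw [degenerateId, Matrix.diagonal_map (by simp)]
  have hsum : ∀ k, (Sum.elim (fun k : Fin (n + 1) => if k = 0 then (0 : ℝ) else 1)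
      (fun k => if k = 0 then 0 else 1) k) * Complex.normSq (v k) = 0 := by
    rw [hd] at hre
    simp only [dotProduct, Matrix.mulVec_diagonal, Complex.re_sum] at hre
    have hterm : ∀ k : RealIdx (n + 1), (star v k * (((Sum.elim (fun k : Fin (n + 1) => if k = 0 then (0 : ℝ) else 1)
      (fun k => if k = 0 then 0 else 1) k : ℝ) : ℂ) * v k)).re = (Sum.elim (fun k : Fin (n + 1) => if k = 0 then (0 : ℝ) else 1)
      (fun k => if k = 0 then 0 else 1) k) * Complex.normSq (v k) := fun k => by
      simp [Complex.normSq_apply]; ring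
    simp only [hterm] at hre
    have := (Finset.sum_eq_zero_iff_of_nonneg (fun k _ => mul_nonneg (by
      rcases k with k | k <;> by_cases h : k = 0 <;> simp [h]) (Complex.normSq_nonneg _))).1 hre
    exact fun k => this k (Finset.mem_univ k)
  have hv0 : ∀ k, k ≠ 0 → v (Sum.inl k) = 0 ∧ v (Sum.inr k) = 0 := fun k hk => by
    have h1 := hsum (Sum.inl k)
    have h2 := hsum (Sum.inr k)
    simp only [Sum.elim_inl, Sum.elim_inr, if_neg hk, one_mul, Complex.normSq_eq_zero] at h1 h2
    exact ⟨h1, h2⟩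
  have hdv : (degenerateId n).map Complex.ofReal *ᵥ v = 0 := by
    rw [hd]
    funext k
    rw [Matrix.mulVec_diagonal]
    rcases k with k | k <;> by_cases hk : k = 0 <;> simp [hk, hv0]
  have hPv : (projJ N).map Complex.ofReal *ᵥ v = 0 := by
    rw [spaceTimeMatrix, complexMatrix, Matrix.add_mulVec, hdv, zero_add, Matrix.smul_mulVec,
      smul_eq_zero] at h
    exact h.resolve_left Complex.I_ne_zero
  have hPre : projJ N *ᵥ (fun k => (v k).re) = 0 := by
    funext j
    have := congrArg Complex.re (congrFun hPv j)
    simpa [Matrix.mulVec, dotProduct] using this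
  have hPim : projJ N *ᵥ (fun k => (v k).im) = 0 := by
    funext j
    have := congrArg Complex.im (congrFun hPv j)
    simpa [Matrix.mulVec, dotProduct] using this
  by_cases hr : (fun k => (v k).re) = 0
  · refine hS (mem_degenerateSet_of_mulVec hN (w := fun k => (v k).im) ?_ ?_ hPim)
    · intro hi
      exact hv (funext fun k => Complex.ext (congrFun hr k) (congrFun hi k))
    · exact fun k hk => by simp [hv0 k hk]
  · exact hS (mem_degenerateSet_of_mulVec hN hr (fun k hk => by simp [hv0 k hk]) hPre)

theorem det_complexMatrix_one_ne_zero {m : ℕ} {P : Matrix (RealIdx m) (RealIdx m) ℝ}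
    (hP : P.IsSymm) : (complexMatrix 1 P).det ≠ 0 := by
  intro hdet
  rw [← Matrix.exists_mulVec_eq_zero_iff] at hdet
  obtain ⟨v, hv, h⟩ := hdet
  have hH : (P.map Complex.ofReal).IsHermitian := by
    ext j k
    simpa [Matrix.conjTranspose_apply] using congrFun (congrFun hP j) k
  have him : (star v ⬝ᵥ P.map Complex.ofReal *ᵥ v).im = 0 :=
    hH.im_star_dotProduct_mulVec_self v
  have h1 := congrArg (fun u => (star v ⬝ᵥ u).re) h
  have hone : (1 : Matrix (RealIdx m) (RealIdx m) ℝ).map Complex.ofReal = 1 := by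
    simp
  simp only [complexMatrix] at h1
  rw [Matrix.add_mulVec, dotProduct_add, Matrix.smul_mulVec, dotProduct_smul,
    smul_eq_mul, Complex.add_re, Complex.mul_re, him, hone, Matrix.one_mulVec] at h1
  have h2 : (star v ⬝ᵥ v).re = ∑ k, Complex.normSq (v k) := by
    simp [dotProduct, Complex.normSq_apply]
  rw [h2] at h1
  simp only [Complex.I_re, zero_mul, mul_zero, sub_zero, add_zero, dotProduct_zero,
    Complex.zero_re] at h1
  have h3 := (Finset.sum_eq_zero_iff_of_nonneg fun k _ => Complex.normSq_nonneg (v k)).1 h1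
  exact hv (funext fun k => Complex.normSq_eq_zero.1 (h3 k (Finset.mem_univ k)))

theorem trArg_eq_upperAngle {B : Matrix ι ι ℂ} (hB : B.det ≠ 0) : trArg B = upperAngle B := by
  refine congrArg Multiset.sum (Multiset.map_congr rfl fun x hx => ?_)
  have h0 : x ≠ 0 := fun h => hB ((zero_mem_roots_iff B).1 (h ▸ hx))
  simp [upperArg, h0]

theorem truncation_isSymm {P : Matrix (RealIdx (n + 1)) (RealIdx (n + 1)) ℝ} (hP : P.IsSymm) :
    (truncation P).IsSymm := hP.submatrix _

/-- This removes the case distinction: the summand `π/2` on `𝒮` is half of the upper arguments of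
two zero eigenvalues. -/
theorem spaceTimeAngle_eq {N : Matrix (RealIdx (n + 1)) (RealIdx (n + 1)) ℝ} (hN : N.IsSymm) :
    spaceTimeAngle N = (1 / 2) * upperAngle (spaceTimeMatrix N) := by
  by_cases hS : N ∈ degenerateSet n
  · have hdet := det_complexMatrix_one_ne_zero (truncation_isSymm (projJ_isSymm hN))
    have h1 : (spaceTimeMatrix N).charpoly =
        Polynomial.X ^ 2 * (complexMatrix 1 (truncation (projJ N))).charpoly := by
      have h2 := Matrix.charpoly_reindex (splitIdx n).symm (spaceTimeMatrix N)
      rw [Matrix.reindex_apply, Equiv.symm_symm, spaceTimeMatrix_eq_fromBlocks hS,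
        Matrix.charpoly_fromBlocks_zero₁₂] at h2
      rw [← h2]
      congr 1
      simp [Matrix.charpoly, Matrix.charmatrix]
    rw [spaceTimeAngle, if_pos hS, trArg_eq_upperAngle hdet, upperAngle, upperAngle, h1,
      Polynomial.roots_mul (mul_ne_zero (pow_ne_zero _ Polynomial.X_ne_zero)
        (Matrix.charpoly_monic _).ne_zero), Polynomial.roots_X_pow, Multiset.map_add,
      Multiset.sum_add, Multiset.map_nsmul, Multiset.sum_nsmul]
    simp [upperArg]
    ring
  · rw [spaceTimeAngle, if_neg hS, ← trArg_eq_upperAngle (det_spaceTimeMatrix_ne_zero hN hS)]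
    rfl

/-! ### Duality and monotonicity of the space-time angle. -/

theorem neg_spaceTimeAngle_neg {N : Matrix (RealIdx (n + 1)) (RealIdx (n + 1)) ℝ}
    (hN : N.IsSymm) :
    -spaceTimeAngle (-N) = (1 / 2) * lowerAngle (spaceTimeMatrix N) := by
  rw [spaceTimeAngle_eq hN.neg, spaceTimeMatrix, projJ_neg, spaceTimeMatrix,
    ← neg_upperAngle_complexMatrix_neg (degenerateId_posSemidef n) (projJ_isSymm hN)]
  ring

theorem spaceTimeMatrix_add (N P : Matrix (RealIdx (n + 1)) (RealIdx (n + 1)) ℝ) :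
    spaceTimeMatrix (N + P) = spaceTimeMatrix N + Complex.I • (projJ P).map Complex.ofReal := by
  ext j k
  simp only [spaceTimeMatrix, projJ_add, Matrix.add_apply, complexMatrix_apply, Matrix.smul_apply,
    Matrix.map_apply, smul_eq_mul, Complex.ofReal_add]
  ring

theorem spaceTimeMatrix_add_smul_one (N : Matrix (RealIdx (n + 1)) (RealIdx (n + 1)) ℝ) (t : ℝ) :
    spaceTimeMatrix (N + t • 1) = spaceTimeMatrix N + (t * Complex.I) • 1 := by
  rw [spaceTimeMatrix_add, projJ_smul, projJ_one]
  ext j k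
  by_cases h : j = k
  · subst h; simp [mul_comm]
  · simp [h]

theorem spaceTimeAngle_le_add {N P : Matrix (RealIdx (n + 1)) (RealIdx (n + 1)) ℝ} (hN : N.IsSymm)
    (hP : P.PosSemidef) : spaceTimeAngle N ≤ spaceTimeAngle (N + P) := by
  have hPs : P.IsSymm := by
    have := hP.1
    rwa [Matrix.IsHermitian, Matrix.conjTranspose_eq_transpose_of_trivial] at this
  rw [spaceTimeAngle_eq hN, spaceTimeAngle_eq (hN.add hPs), spaceTimeMatrix_add]
  have := upperAngle_le_add_I_smul (isAccretive_spaceTimeMatrix hN)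
    (posSemidef_map_ofReal (projJ_posSemidef hP))
  linarith

theorem neg_spaceTimeAngle_neg_le {N : Matrix (RealIdx (n + 1)) (RealIdx (n + 1)) ℝ}
    (hN : N.IsSymm) : -spaceTimeAngle (-N) ≤ spaceTimeAngle N := by
  rw [neg_spaceTimeAngle_neg hN, spaceTimeAngle_eq hN]
  linarith [lowerAngle_le_upperAngle (spaceTimeMatrix N)]

/-- Positive exactly when `n ≥ 1`, which is what strict monotonicity needs; `n = 0` has to be
treated by hand. -/
theorem trace_spaceTimeMatrix_re (N : Matrix (RealIdx (n + 1)) (RealIdx (n + 1)) ℝ) :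
    (spaceTimeMatrix N).trace.re = 2 * n := by
  simp only [Matrix.trace, Matrix.diag, spaceTimeMatrix, complexMatrix_apply, Complex.re_sum]
  simp [Fintype.sum_sum_type, degenerateId, Fin.sum_univ_succ, Fin.succ_ne_zero]
  ring

theorem projJ_eq_smul_one {N : Matrix (RealIdx 1) (RealIdx 1) ℝ} (hN : N.IsSymm) :
    projJ N = projJ N (Sum.inl 0) (Sum.inl 0) • 1 := by
  have hs := (projJ_isSymm hN).apply (Sum.inl 0) (Sum.inr 0)
  have hJ := projJ_mul_stdJ N
  have h1 := congrFun (congrFun hJ (Sum.inl 0)) (Sum.inl 0)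
  have h2 := congrFun (congrFun hJ (Sum.inr 0)) (Sum.inl 0)
  simp [Matrix.mul_apply, stdJ, Matrix.fromBlocks, Fintype.sum_sum_type] at h1 h2
  ext j k
  rcases j with j | j <;> rcases k with k | k <;> fin_cases j <;> fin_cases k <;>
    simp <;> linarith

theorem roots_charpoly_spaceTimeMatrix_zero {N : Matrix (RealIdx 1) (RealIdx 1) ℝ}
    (hN : N.IsSymm) : (spaceTimeMatrix (n := 0) N).charpoly.roots =
      Multiset.replicate 2 (projJ N (Sum.inl 0) (Sum.inl 0) * Complex.I) := by
  have h1 : spaceTimeMatrix (n := 0) N = 0 +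
      ((projJ N (Sum.inl 0) (Sum.inl 0) : ℂ) * Complex.I) • (1 : Matrix (RealIdx 1) (RealIdx 1) ℂ) := by
    have h2 : degenerateId 0 = 0 := by
      ext j k
      rcases j with j | j <;> rcases k with k | k <;> fin_cases j <;> fin_cases k <;>
        simp [degenerateId]
    rw [spaceTimeMatrix, h2, projJ_eq_smul_one hN]
    ext j k
    by_cases h : j = k
    · subst h; simp [complexMatrix_apply, mul_comm]
    · simp [complexMatrix_apply, h]
  rw [h1, roots_charpoly_add_smul_one]
  have h3 : (0 : Matrix (RealIdx 1) (RealIdx 1) ℂ).charpoly = Polynomial.X ^ 2 := by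
    simp [Matrix.charpoly, Matrix.charmatrix]
  rw [h3, Polynomial.roots_X_pow]
  simp [Multiset.nsmul_singleton]

/-- Strict monotonicity of the angle. -/
theorem lt_neg_spaceTimeAngle_neg_add {N : Matrix (RealIdx (n + 1)) (RealIdx (n + 1)) ℝ}
    (hN : N.IsSymm) {c : ℝ} (hc : |c| < (n + 1) * Real.pi / 2) (h : c ≤ spaceTimeAngle N) {t : ℝ}
    (ht : 0 < t) : c < -spaceTimeAngle (-(N + t • 1)) := by
  have hNt : (N + t • (1 : Matrix (RealIdx (n + 1)) (RealIdx (n + 1)) ℝ)).IsSymm :=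
    hN.add (Matrix.isSymm_one.smul t)
  rw [neg_spaceTimeAngle_neg hNt]
  rcases n.eq_zero_or_pos with h0 | hn
  -- For `n = 0` both eigenvalues are the same imaginary number `ai`. As `c > -π/2`, the hypothesis
  -- excludes `a < 0`; then `a + t > 0` and the lower angle is `π/2 > c`.
  · subst h0
    rw [abs_lt] at hc
    norm_num at hc
    rw [spaceTimeAngle_eq hN, upperAngle, roots_charpoly_spaceTimeMatrix_zero hN] at h
    rw [lowerAngle, roots_charpoly_spaceTimeMatrix_zero hNt, projJ_add, projJ_smul, projJ_one]
    set a := projJ N (Sum.inl 0) (Sum.inl 0) with ha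
    simp only [Multiset.map_replicate, Multiset.sum_replicate, nsmul_eq_mul, Nat.cast_ofNat] at h ⊢
    have ha0 : 0 ≤ a := by
      by_contra! hneg
      have h2 : upperArg (a * Complex.I) = -(Real.pi / 2) := by
        rw [upperArg, if_neg (by simp [hneg.ne])]
        exact Complex.arg_eq_neg_pi_div_two_iff.2 (by simpa using hneg)
      rw [h2] at h
      linarith
    have hpos : 0 < a + t := by linarith
    have h3 : lowerArg (((projJ N + t • 1) (Sum.inl 0) (Sum.inl 0) : ℝ) * Complex.I) =
        Real.pi / 2 := by
      have h4 : (projJ N + t • (1 : Matrix (RealIdx 1) (RealIdx 1) ℝ)) (Sum.inl 0) (Sum.inl 0) =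
          a + t := by simp [ha]
      rw [h4, lowerArg, if_neg (by simp only [mul_eq_zero, Complex.I_ne_zero, or_false]
                                   exact_mod_cast hpos.ne')]
      exact Complex.arg_eq_pi_div_two_iff.2 (by simpa using hpos)
    refine lt_of_lt_of_eq (b := 1 / 2 * (2 * (Real.pi / 2))) (by linarith) ?_
    exact congrArg (fun x => 1 / 2 * (2 * x)) h3.symm
  · rw [spaceTimeAngle_eq hN] at h
    rw [spaceTimeMatrix_add_smul_one]
    have := upperAngle_lt_lowerAngle_add (isAccretive_spaceTimeMatrix hN)
      (by rw [trace_spaceTimeMatrix_re]; positivity) ht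
    linarith

end Angle

/-! ### Fields of bilinear forms in charts -/

section Fields

variable {n : ℕ} {X : Type*} [TopologicalSpace X] [ChartedSpace (Model n) X]

theorem BilinField.inChart_apply (b : BilinField n X) (x₀ : X) (y v w : Model n) :
    b.inChart x₀ y v w = b ((chartAt (Model n) x₀).symm y)
      (mfderiv 𝓘(ℝ, Model n) 𝓘(ℝ, Model n) (chartAt (Model n) x₀).symm y v)
      (mfderiv 𝓘(ℝ, Model n) 𝓘(ℝ, Model n) (chartAt (Model n) x₀).symm y w) := rfl

/-- The coordinate change from the chart around `x` to the chart around `x₀`. -/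
def chartChange (x₀ x : X) (y : Model n) : Model n :=
  chartAt (Model n) x₀ ((chartAt (Model n) x).symm y)

theorem eventually_mem_chartChange {x₀ x : X} (hx : x ∈ (chartAt (Model n) x₀).source) :
    ∀ᶠ y in 𝓝 (chartAt (Model n) x x), y ∈ (chartAt (Model n) x).target ∧
      (chartAt (Model n) x).symm y ∈ (chartAt (Model n) x₀).source := by
  refine (((chartAt (Model n) x).symm ≫ₕ chartAt (Model n) x₀).open_source.mem_nhds ?_)
  simp [hx]

variable [IsManifold 𝓘(ℂ, Model n) ω X]

theorem mdifferentiableAt_chart {x₀ x : X} (hx : x ∈ (chartAt (Model n) x₀).source) :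
    MDifferentiableAt 𝓘(ℝ, Model n) 𝓘(ℝ, Model n) (chartAt (Model n) x₀) x :=
  (contMDiffAt_of_mem_maximalAtlas (n := ∞) (IsManifold.chart_mem_maximalAtlas x₀)
    hx).mdifferentiableAt (by simp)

theorem contMDiffAt_chart_symm {x₀ : X} {y : Model n} (hy : y ∈ (chartAt (Model n) x₀).target) :
    ContMDiffAt 𝓘(ℝ, Model n) 𝓘(ℝ, Model n) ∞ (chartAt (Model n) x₀).symm y :=
  contMDiffAt_symm_of_mem_maximalAtlas (IsManifold.chart_mem_maximalAtlas x₀) hy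

theorem mdifferentiableAt_chart_symm {x₀ : X} {y : Model n}
    (hy : y ∈ (chartAt (Model n) x₀).target) :
    MDifferentiableAt 𝓘(ℝ, Model n) 𝓘(ℝ, Model n) (chartAt (Model n) x₀).symm y :=
  (contMDiffAt_chart_symm hy).mdifferentiableAt (by simp)

theorem mfderiv_chart_symm_self (x : X) (v : Model n) :
    (mfderiv 𝓘(ℝ, Model n) 𝓘(ℝ, Model n) (chartAt (Model n) x).symm
      (chartAt (Model n) x x) v : Model n) = v := by
  have h := mfderivWithin_range_extChartAt_symm (I := 𝓘(ℝ, Model n)) (x := x)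
  simp only [mfld_simps, mfderivWithin_univ] at h
  rw [h]
  rfl

theorem BilinField.inChart_self (b : BilinField n X) (x : X) (v w : Model n) :
    b.inChart x (chartAt (Model n) x x) v w = b x v w := by
  rw [BilinField.inChart_apply]
  -- The base points are only propositionally equal and index the tangent spaces; generalizing them
  -- lets substitution do the transport.
  have h : ∀ (x' : X), x' = x → ∀ v' w' : Model n, v' = v → w' = w →
      (b x' : Model n →L[ℝ] Model n →L[ℝ] ℝ) v' w' = (b x : Model n →L[ℝ] Model n →L[ℝ] ℝ) v w := by
    rintro _ rfl _ _ rfl rfl; rfl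
  exact h _ ((chartAt (Model n) x).left_inv (mem_chart_source _ x)) _ _
    (mfderiv_chart_symm_self x v) (mfderiv_chart_symm_self x w)

/-- A coordinate vector field is the image of a constant field under the tangent map of the inverse
chart. Evaluating a smooth field of forms on such fields yields its smooth coefficients in the
chart. -/
theorem contMDiffOn_chart_symm_vector (x₀ : X) (v : Model n) :
    ContMDiffOn 𝓘(ℝ, Model n) (𝓘(ℝ, Model n).prod 𝓘(ℝ, Model n)) ∞
      (fun y => TotalSpace.mk' (Model n) (E := fun x : X => TSpace n x)
        ((chartAt (Model n) x₀).symm y)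
        (mfderiv 𝓘(ℝ, Model n) 𝓘(ℝ, Model n) (chartAt (Model n) x₀).symm y v))
      (chartAt (Model n) x₀).target := by
  have ho := (chartAt (Model n) x₀).open_target
  have h1 : ContMDiffOn 𝓘(ℝ, Model n) 𝓘(ℝ, Model n) ∞ (chartAt (Model n) x₀).symm
      (chartAt (Model n) x₀).target := fun y hy => (contMDiffAt_chart_symm hy).contMDiffWithinAt
  have h2 := h1.contMDiffOn_tangentMapWithin (m := ∞) (by simp) ho.uniqueMDiffOn
  have h3 : ContMDiff 𝓘(ℝ, Model n) 𝓘(ℝ, Model n).tangent ∞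
      (fun y : Model n => (⟨y, v⟩ : TangentBundle 𝓘(ℝ, Model n) (Model n))) := by
    rw [contMDiff_vectorSpace_iff_contDiff (V := fun _ => v)]
    exact contDiff_const
  refine (h2.comp h3.contMDiffOn (s := (chartAt (Model n) x₀).target) fun y hy => hy).congr ?_
  intro y hy
  simp only [Function.comp, tangentMapWithin]
  rw [mfderivWithin_of_isOpen ho hy]

theorem contDiffOn_inChart {b : BilinField n X}
    (hb : ContMDiff 𝓘(ℝ, Model n) (𝓘(ℝ, Model n).prod 𝓘(ℝ, Model n →L[ℝ] Model n →L[ℝ] ℝ)) ∞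
      (fun x ↦ TotalSpace.mk' (Model n →L[ℝ] Model n →L[ℝ] ℝ)
        (E := fun x : X ↦ (TSpace n x →L[ℝ] TSpace n x →L[ℝ] ℝ)) x (b x))) (x₀ : X) :
    ContDiffOn ℝ ∞ (b.inChart x₀) (chartAt (Model n) x₀).target := by
  rw [contDiffOn_clm_apply]
  intro v
  rw [contDiffOn_clm_apply]
  intro w
  have h1 : ContMDiffOn 𝓘(ℝ, Model n) 𝓘(ℝ, Model n) ∞ (chartAt (Model n) x₀).symm
      (chartAt (Model n) x₀).target := fun y hy => (contMDiffAt_chart_symm hy).contMDiffWithinAt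
  rw [← contMDiffOn_iff_contDiffOn]
  intro y hy
  have h2 : ContMDiffWithinAt 𝓘(ℝ, Model n) (𝓘(ℝ, Model n).prod 𝓘(ℝ)) ∞
      (fun y ↦ TotalSpace.mk' ℝ (E := Bundle.Trivial X ℝ) ((chartAt (Model n) x₀).symm y)
        (b.inChart x₀ y v w)) (chartAt (Model n) x₀).target y := by
    apply ContMDiffWithinAt.clm_bundle_apply₂ (F₁ := Model n) (F₂ := Model n)
    · exact ContMDiffAt.comp_contMDiffWithinAt y hb.contMDiffAt (h1 y hy)
    · exact contMDiffOn_chart_symm_vector x₀ v y hy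
    · exact contMDiffOn_chart_symm_vector x₀ w y hy
  simp only [contMDiffWithinAt_totalSpace] at h2
  exact h2.2

theorem contDiffAt_chartChange {x₀ x : X} (hx : x ∈ (chartAt (Model n) x₀).source) :
    ContDiffAt ℂ ω (chartChange x₀ x) (chartAt (Model n) x x) := by
  have h := (HasGroupoid.compatible (G := contDiffGroupoid ω 𝓘(ℂ, Model n))
    (chart_mem_atlas (Model n) x) (chart_mem_atlas (Model n) x₀)).1
  have h1 : ContDiffOn ℂ ω ((chartAt (Model n) x).symm ≫ₕ chartAt (Model n) x₀)
      ((chartAt (Model n) x).symm ≫ₕ chartAt (Model n) x₀).source := by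
    simpa [contDiffPregroupoid] using h
  refine h1.contDiffAt (((chartAt (Model n) x).symm ≫ₕ chartAt (Model n) x₀).open_source.mem_nhds ?_)
  simp [hx]

theorem contDiffAt_real_chartChange {x₀ x : X} (hx : x ∈ (chartAt (Model n) x₀).source) :
    ContDiffAt ℝ ∞ (chartChange x₀ x) (chartAt (Model n) x x) :=
  ((contDiffAt_chartChange hx).restrict_scalars ℝ).of_le le_top

/-- Coordinate changes are holomorphic, so their real derivative is the restriction of a complex
linear map. -/
theorem fderiv_chartChange_I {x₀ x : X} (hx : x ∈ (chartAt (Model n) x₀).source) (v : Model n) :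
    fderiv ℝ (chartChange x₀ x) (chartAt (Model n) x x) (Complex.I • v) =
      Complex.I • fderiv ℝ (chartChange x₀ x) (chartAt (Model n) x x) v := by
  have h := (contDiffAt_chartChange hx).differentiableAt (by simp)
  rw [h.fderiv_restrictScalars ℝ]
  simp

/-- Chain rule: near `y` the inverse chart around `x` is the inverse chart around `x₀` after the
coordinate change. -/
theorem BilinField.inChart_eq_chartChange (b : BilinField n X) {x₀ x : X} {y : Model n}
    (hy : y ∈ (chartAt (Model n) x).target)
    (hy' : (chartAt (Model n) x).symm y ∈ (chartAt (Model n) x₀).source)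
    (v w : Model n) :
    b.inChart x y v w = b.inChart x₀ (chartChange x₀ x y) (fderiv ℝ (chartChange x₀ x) y v)
      (fderiv ℝ (chartChange x₀ x) y w) := by
  set τ : Model n → Model n := chartChange x₀ x with hτ
  have hev : (chartAt (Model n) x).symm =ᶠ[𝓝 y] (chartAt (Model n) x₀).symm ∘ τ := by
    filter_upwards [((chartAt (Model n) x).symm ≫ₕ chartAt (Model n) x₀).open_source.mem_nhds
      (show y ∈ _ by simp [hy, hy'])] with z hz
    exact ((chartAt (Model n) x₀).left_inv hz.2).symm
  have ht : τ y ∈ (chartAt (Model n) x₀).target := (chartAt (Model n) x₀).map_source hy'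
  have hd : MDifferentiableAt 𝓘(ℝ, Model n) 𝓘(ℝ, Model n) τ y :=
    (mdifferentiableAt_chart hy').comp y (mdifferentiableAt_chart_symm hy)
  have hD : ∀ u : Model n, (mfderiv 𝓘(ℝ, Model n) 𝓘(ℝ, Model n) (chartAt (Model n) x).symm y u :
      Model n) = mfderiv 𝓘(ℝ, Model n) 𝓘(ℝ, Model n) (chartAt (Model n) x₀).symm (τ y)
        (fderiv ℝ τ y u) := by
    intro u
    have h1 := mfderiv_comp y (mdifferentiableAt_chart_symm ht) hd
    rw [mfderiv_eq_fderiv] at h1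
    have h2 := hev.mfderiv_eq (I := 𝓘(ℝ, Model n)) (I' := 𝓘(ℝ, Model n))
    exact (congrArg (fun L : Model n →L[ℝ] Model n => L u) h2).trans
      (congrArg (fun L : Model n →L[ℝ] Model n => L u) h1)
  rw [BilinField.inChart_apply, BilinField.inChart_apply]
  have h : ∀ (x₁ x₂ : X), x₁ = x₂ → ∀ v₁ v₂ w₁ w₂ : Model n, v₁ = v₂ → w₁ = w₂ →
      (b x₁ : Model n →L[ℝ] Model n →L[ℝ] ℝ) v₁ w₁ =
        (b x₂ : Model n →L[ℝ] Model n →L[ℝ] ℝ) v₂ w₂ := by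
    rintro _ _ rfl _ _ _ _ rfl rfl; rfl
  exact h _ _ hev.self_of_nhds _ _ _ _ (hD v) (hD w)

end Fields

/-! ### Change of coordinates for Christoffel symbols and Hessians -/

section ChangeOfCoordinates

variable {V : Type*} [NormedAddCommGroup V] [NormedSpace ℝ V]

theorem isInvertible_of_pos [FiniteDimensional ℝ V] {β : V →L[ℝ] V →L[ℝ] ℝ}
    (hβ : ∀ x, x ≠ 0 → 0 < β x x) : β.IsInvertible := by
  have hinj : Function.Injective β := by
    rw [injective_iff_map_eq_zero]
    intro x hx
    by_contra h
    have := hβ x h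
    rw [hx] at this
    exact lt_irrefl _ this
  have hfin : Module.finrank ℝ V = Module.finrank ℝ (V →L[ℝ] ℝ) := by
    rw [← (LinearMap.toContinuousLinearMap (𝕜 := ℝ) (E := V) (F' := ℝ)).finrank_eq]
    exact (Subspace.dual_finrank_eq (K := ℝ) (V := V)).symm
  exact ⟨(LinearEquiv.ofInjectiveOfFinrankEq (β : V →ₗ[ℝ] (V →L[ℝ] ℝ)) hinj
    hfin).toContinuousLinearEquiv, by ext; rfl⟩

theorem apply_christoffel {G : V → V →L[ℝ] V →L[ℝ] ℝ} {v : V} (hG : (G v).IsInvertible) (a b e : V) :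
    G v (christoffel G v a b) e = 1 / 2 * koszul G v a b e := by
  rw [christoffel, hG.self_apply_inverse]
  rfl

theorem eq_christoffel {G : V → V →L[ℝ] V →L[ℝ] ℝ} {v : V} (hG : (G v).IsInvertible) {a b x : V}
    (h : ∀ e, G v x e = 1 / 2 * koszul G v a b e) : x = christoffel G v a b := by
  rw [christoffel]
  have h1 : (1 / 2 : ℝ) • koszul G v a b = G v x := by
    ext e; exact (h e).symm
  rw [h1, hG.inverse_apply_self]

variable {G G₀ : V → V →L[ℝ] V →L[ℝ] ℝ} {τ : V → V} {v : V}

set_option synthInstance.maxHeartbeats 200000 in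
theorem fderiv_pullback (hG : DifferentiableAt ℝ G v) (hG₀ : DifferentiableAt ℝ G₀ (τ v))
    (hτ : ContDiffAt ℝ 2 τ v)
    (h : ∀ᶠ y in 𝓝 v, ∀ a b, G y a b = G₀ (τ y) (fderiv ℝ τ y a) (fderiv ℝ τ y b)) (e a b : V) :
    fderiv ℝ G v e a b = fderiv ℝ G₀ (τ v) (fderiv ℝ τ v e) (fderiv ℝ τ v a) (fderiv ℝ τ v b) +
      G₀ (τ v) (fderiv ℝ (fderiv ℝ τ) v e a) (fderiv ℝ τ v b) +
      G₀ (τ v) (fderiv ℝ τ v a) (fderiv ℝ (fderiv ℝ τ) v e b) := by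
  have hτ1 : HasFDerivAt τ (fderiv ℝ τ v) v := (hτ.differentiableAt (by simp)).hasFDerivAt
  have hτ2 : HasFDerivAt (fderiv ℝ τ) (fderiv ℝ (fderiv ℝ τ) v) v :=
    ((hτ.fderiv_right (m := 1) (by norm_num)).differentiableAt (by simp)).hasFDerivAt
  have h1 : HasFDerivAt (fun y => G₀ (τ y) (fderiv ℝ τ y a) (fderiv ℝ τ y b)) _ v :=
    ((hG₀.hasFDerivAt.comp v hτ1).clm_apply (hτ2.clm_apply (hasFDerivAt_const a v))).clm_apply
      (hτ2.clm_apply (hasFDerivAt_const b v))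
  have h2 : HasFDerivAt (fun y => G y a b) _ v :=
    (hG.hasFDerivAt.clm_apply (hasFDerivAt_const a v)).clm_apply (hasFDerivAt_const b v)
  have h3 : (fun y => G y a b) =ᶠ[𝓝 v] fun y => G₀ (τ y) (fderiv ℝ τ y a) (fderiv ℝ τ y b) :=
    h.mono fun y hy => hy a b
  have h4 := congrArg (fun L : V →L[ℝ] ℝ => L e) (h2.unique (h1.congr_of_eventuallyEq h3))
  simp at h4
  rw [h4]
  ring

/-- Of the six terms with second derivatives of `τ`, four cancel by the symmetry of `G₀` and of
second derivatives; the other two coincide. -/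
theorem koszul_pullback (hG : DifferentiableAt ℝ G v) (hG₀ : DifferentiableAt ℝ G₀ (τ v))
    (hτ : ContDiffAt ℝ 2 τ v)
    (h : ∀ᶠ y in 𝓝 v, ∀ a b, G y a b = G₀ (τ y) (fderiv ℝ τ y a) (fderiv ℝ τ y b))
    (hsymm : ∀ a b, G₀ (τ v) a b = G₀ (τ v) b a) (a b e : V) :
    koszul G v a b e = koszul G₀ (τ v) (fderiv ℝ τ v a) (fderiv ℝ τ v b) (fderiv ℝ τ v e) +
      2 * G₀ (τ v) (fderiv ℝ (fderiv ℝ τ) v a b) (fderiv ℝ τ v e) := by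
  have hs : IsSymmSndFDerivAt ℝ τ v := hτ.isSymmSndFDerivAt (by simp)
  rw [koszul_apply, koszul_apply, fderiv_pullback hG hG₀ hτ h, fderiv_pullback hG hG₀ hτ h,
    fderiv_pullback hG hG₀ hτ h, hs.eq b a, hs.eq e a, hs.eq e b,
    hsymm (fderiv ℝ (fderiv ℝ τ) v a e) (fderiv ℝ τ v b)]
  ring

/-- The transformation law of the Christoffel symbols. -/
theorem fderiv_christoffel_pullback (hG : DifferentiableAt ℝ G v)
    (hG₀ : DifferentiableAt ℝ G₀ (τ v)) (hτ : ContDiffAt ℝ 2 τ v)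
    (h : ∀ᶠ y in 𝓝 v, ∀ a b, G y a b = G₀ (τ y) (fderiv ℝ τ y a) (fderiv ℝ τ y b))
    (hsymm : ∀ a b, G₀ (τ v) a b = G₀ (τ v) b a) (hGi : (G v).IsInvertible)
    (hG₀i : (G₀ (τ v)).IsInvertible) (hsurj : Function.Surjective (fderiv ℝ τ v)) (a b : V) :
    fderiv ℝ τ v (christoffel G v a b) =
      christoffel G₀ (τ v) (fderiv ℝ τ v a) (fderiv ℝ τ v b) + fderiv ℝ (fderiv ℝ τ) v a b := by
  rw [← sub_eq_iff_eq_add]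
  refine eq_christoffel hG₀i fun e' => ?_
  obtain ⟨e, rfl⟩ := hsurj e'
  have h1 := apply_christoffel hGi a b e
  rw [h.self_of_nhds, koszul_pullback hG hG₀ hτ h hsymm] at h1
  rw [map_sub, sub_apply, h1]
  ring

/-- The formula is needed on a neighbourhood, so that it can be differentiated once more at `v`. -/
theorem eventually_fderiv_quadratic_comp {τ : V → V} (hτ : ContDiffAt ℝ 2 τ v) (r : ℝ)
    (l : V →L[ℝ] ℝ) {B : V →L[ℝ] V →L[ℝ] ℝ} (hB : ∀ a b, B a b = B b a) :
    ∀ᶠ y in 𝓝 v, fderiv ℝ (fun y => r + l (τ y - τ v) + (1 / 2) * B (τ y - τ v) (τ y - τ v)) y =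
      (l + B (τ y - τ v)).comp (fderiv ℝ τ y) := by
  filter_upwards [hτ.eventually (by simp)] with y hy
  have h1 : HasFDerivAt (fun y => τ y - τ v) (fderiv ℝ τ y) y :=
    (hy.differentiableAt (by simp)).hasFDerivAt.sub_const _
  have h2 : HasFDerivAt (fun y => B (τ y - τ v) (τ y - τ v)) _ y :=
    (B.hasFDerivAt.comp y h1).clm_apply h1
  have h3 := (((l.hasFDerivAt.comp y h1).const_add r).add (h2.const_mul (1 / 2)))
  refine h3.fderiv.trans ?_
  ext e
  simp [hB (fderiv ℝ τ y e)]
  ring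

theorem fderiv_quadratic_comp {τ : V → V} (hτ : ContDiffAt ℝ 2 τ v) (r : ℝ)
    (l : V →L[ℝ] ℝ) {B : V →L[ℝ] V →L[ℝ] ℝ} (hB : ∀ a b, B a b = B b a) :
    fderiv ℝ (fun y => r + l (τ y - τ v) + (1 / 2) * B (τ y - τ v) (τ y - τ v)) v =
      l.comp (fderiv ℝ τ v) := by
  rw [(eventually_fderiv_quadratic_comp hτ r l hB).self_of_nhds]
  simp

theorem fderiv_fderiv_quadratic_comp {τ : V → V} (hτ : ContDiffAt ℝ 2 τ v) (r : ℝ)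
    (l : V →L[ℝ] ℝ) {B : V →L[ℝ] V →L[ℝ] ℝ} (hB : ∀ a b, B a b = B b a) (a b : V) :
    fderiv ℝ (fderiv ℝ fun y => r + l (τ y - τ v) + (1 / 2) * B (τ y - τ v) (τ y - τ v)) v a b =
      B (fderiv ℝ τ v a) (fderiv ℝ τ v b) + l (fderiv ℝ (fderiv ℝ τ) v a b) := by
  have hτ2 : HasFDerivAt (fderiv ℝ τ) (fderiv ℝ (fderiv ℝ τ) v) v :=
    ((hτ.fderiv_right (m := 1) (by norm_num)).differentiableAt (by simp)).hasFDerivAt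
  have h1 : HasFDerivAt (fun y => τ y - τ v) (fderiv ℝ τ v) v :=
    (hτ.differentiableAt (by simp)).hasFDerivAt.sub_const _
  have h2 : HasFDerivAt (fun y => l + B (τ y - τ v)) (B.comp (fderiv ℝ τ v)) v :=
    (B.hasFDerivAt.comp v h1).const_add l
  rw [Filter.EventuallyEq.fderiv_eq (eventually_fderiv_quadratic_comp hτ r l hB), (h2.clm_comp hτ2).fderiv]
  simp
  ring

/-- The Hessian of a metric is a tensor. -/
theorem hessianInChart_pullback (hG : DifferentiableAt ℝ G v)
    (hG₀ : DifferentiableAt ℝ G₀ (τ v)) (hτ : ContDiffAt ℝ 2 τ v)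
    (h : ∀ᶠ y in 𝓝 v, ∀ a b, G y a b = G₀ (τ y) (fderiv ℝ τ y a) (fderiv ℝ τ y b))
    (hsymm : ∀ a b, G₀ (τ v) a b = G₀ (τ v) b a) (hGi : (G v).IsInvertible)
    (hG₀i : (G₀ (τ v)).IsInvertible) (hsurj : Function.Surjective (fderiv ℝ τ v)) (r : ℝ)
    (l : V →L[ℝ] ℝ) {B : V →L[ℝ] V →L[ℝ] ℝ} (hB : ∀ a b, B a b = B b a) (a b : V) :
    hessianInChart G v
      (fderiv ℝ (fun y => r + l (τ y - τ v) + (1 / 2) * B (τ y - τ v) (τ y - τ v)) v)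
      (fderiv ℝ (fderiv ℝ fun y => r + l (τ y - τ v) + (1 / 2) * B (τ y - τ v) (τ y - τ v)) v) a b =
    hessianInChart G₀ (τ v) l B (fderiv ℝ τ v a) (fderiv ℝ τ v b) := by
  -- The term `l(D²τ(a, b))` of the second derivative cancels the inhomogeneous term in the
  -- transformation law of the Christoffel symbols.
  rw [hessianInChart, LinearMap.mk₂_apply, hessianInChart, LinearMap.mk₂_apply,
    fderiv_quadratic_comp hτ r l hB, fderiv_fderiv_quadratic_comp hτ r l hB,
    ContinuousLinearMap.comp_apply,
    fderiv_christoffel_pullback hG hG₀ hτ h hsymm hGi hG₀i hsurj, map_add]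
  ring

theorem christoffel_symm (hG : DifferentiableAt ℝ G v)
    (hsymm : ∀ᶠ y in 𝓝 v, ∀ a b, G y a b = G y b a) (a b : V) :
    christoffel G v a b = christoffel G v b a := by
  have h1 : ∀ e a b, fderiv ℝ G v e a b = fderiv ℝ G v e b a := by
    intro e a b
    have h2 : ∀ a b, HasFDerivAt (fun y => G y a b) _ v := fun a b =>
      (hG.hasFDerivAt.clm_apply (hasFDerivAt_const a v)).clm_apply (hasFDerivAt_const b v)
    have h3 : (fun y => G y a b) =ᶠ[𝓝 v] fun y => G y b a := hsymm.mono fun y hy => hy a b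
    have h4 := congrArg (fun L : V →L[ℝ] ℝ => L e)
      ((h2 a b).unique ((h2 b a).congr_of_eventuallyEq h3))
    simpa using h4
  rw [christoffel, christoffel]
  congr 2
  ext e
  rw [koszul_apply, koszul_apply, h1 e a b]
  ring

end ChangeOfCoordinates

/-! ### The product metric and the Hessian of a two-jet in an arbitrary chart -/

section ProductMetric

variable {n : ℕ} {X : Type*} [TopologicalSpace X] [ChartedSpace (Model n) X]

/-- The coordinate change of `ℂ × X` from the chart around `x` to the chart around `x₀`. -/
def stChange (x₀ x : X) (v : STModel n) : STModel n := (v.1, chartChange x₀ x v.2)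

theorem stChange_stChart {x₀ : X} (p : SpaceTime X) :
    stChange x₀ p.2 (stChart n p.2 p.pt) = stChart n x₀ p.pt := by
  simp [stChange, stChart, chartChange, SpaceTime.pt]

theorem stChart_mem_target {x₀ : X} {p : SpaceTime X}
    (hp : p.2 ∈ (chartAt (Model n) x₀).source) :
    (stChart n x₀ p.pt).2 ∈ (chartAt (Model n) x₀).target :=
  (chartAt (Model n) x₀).map_source hp

theorem fderiv_stChange {x₀ x : X} {v : STModel n}
    (h : DifferentiableAt ℝ (chartChange x₀ x) v.2) (a : STModel n) :
    fderiv ℝ (stChange x₀ x) v a = (a.1, fderiv ℝ (chartChange x₀ x) v.2 a.2) := by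
  have h1 : HasFDerivAt (stChange x₀ x) _ v :=
    hasFDerivAt_fst.prodMk (h.hasFDerivAt.comp v hasFDerivAt_snd)
  rw [h1.fderiv]
  rfl

theorem isOpen_chart_target_snd (x₀ : X) :
    IsOpen {v : STModel n | v.2 ∈ (chartAt (Model n) x₀).target} :=
  (chartAt (Model n) x₀).open_target.preimage continuous_snd

variable [IsManifold 𝓘(ℂ, Model n) ω X]

theorem contDiffAt_stChange {x₀ : X} {p : SpaceTime X} (hp : p.2 ∈ (chartAt (Model n) x₀).source) :
    ContDiffAt ℝ ∞ (stChange x₀ p.2) (stChart n p.2 p.pt) :=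
  contDiffAt_fst.prodMk (ContDiffAt.comp (g := chartChange x₀ p.2) (stChart n p.2 p.pt)
    (contDiffAt_real_chartChange hp) contDiffAt_snd)

theorem fderiv_stChange_at {x₀ : X} {p : SpaceTime X}
    (hp : p.2 ∈ (chartAt (Model n) x₀).source) (a : STModel n) :
    fderiv ℝ (stChange x₀ p.2) (stChart n p.2 p.pt) a =
      (a.1, fderiv ℝ (chartChange x₀ p.2) (chartAt (Model n) p.2 p.2) a.2) :=
  fderiv_stChange ((contDiffAt_real_chartChange hp).differentiableAt (by simp)) a

variable (g : KahlerMetric n X)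

theorem productInChart_apply (x₀ : X) (v a b : STModel n) :
    g.productInChart x₀ v a b =
      inner ℝ a.1 b.1 + BilinField.inChart (n := n) g.metric.inner x₀ v.2 a.2 b.2 := rfl

theorem inChart_metric_symm (x₀ : X) (y v w : Model n) :
    BilinField.inChart (n := n) g.metric.inner x₀ y v w =
      BilinField.inChart (n := n) g.metric.inner x₀ y w v := by
  rw [BilinField.inChart_apply, BilinField.inChart_apply]
  exact g.metric.symm _ _ _

theorem inChart_metric_pos {x₀ : X} {y : Model n} (hy : y ∈ (chartAt (Model n) x₀).target)
    {v : Model n} (hv : v ≠ 0) : 0 < BilinField.inChart (n := n) g.metric.inner x₀ y v v := by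
  rw [BilinField.inChart_apply]
  refine g.metric.pos _ _ fun h => hv ?_
  have hinj := (mdifferentiable_chart (I := 𝓘(ℝ, Model n)) x₀).symm.mfderiv_injective hy
  exact hinj (h.trans (map_zero _).symm)

theorem productInChart_symm (x₀ : X) (v a b : STModel n) :
    g.productInChart x₀ v a b = g.productInChart x₀ v b a := by
  rw [productInChart_apply, productInChart_apply, inChart_metric_symm, real_inner_comm]

theorem productInChart_pos {x₀ : X} {v : STModel n} (hv : v.2 ∈ (chartAt (Model n) x₀).target)
    {a : STModel n} (ha : a ≠ 0) : 0 < g.productInChart x₀ v a a := by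
  rw [productInChart_apply]
  by_cases h : a.2 = 0
  · have h1 : a.1 ≠ 0 := fun h1 => ha (Prod.ext h1 h)
    rw [h, map_zero, add_zero]
    exact real_inner_self_pos.2 h1
  · exact add_pos_of_nonneg_of_pos real_inner_self_nonneg (inChart_metric_pos g hv h)

theorem isInvertible_productInChart {x₀ : X} {v : STModel n}
    (hv : v.2 ∈ (chartAt (Model n) x₀).target) : (g.productInChart x₀ v).IsInvertible :=
  isInvertible_of_pos fun _ h => productInChart_pos g hv h

theorem contDiffOn_productInChart (x₀ : X) : ContDiffOn ℝ ∞ (g.productInChart x₀)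
    {v | v.2 ∈ (chartAt (Model n) x₀).target} := by
  have h1 : ContDiffOn ℝ ∞ (fun v : STModel n =>
      BilinField.inChart (n := n) g.metric.inner x₀ v.2)
      {v | v.2 ∈ (chartAt (Model n) x₀).target} :=
    (contDiffOn_inChart g.metric.contMDiff x₀).comp contDiff_snd.contDiffOn fun v hv => hv
  rw [contDiffOn_clm_apply]
  intro a
  rw [contDiffOn_clm_apply]
  intro b
  simp only [productInChart_apply]
  exact contDiffOn_const.add ((h1.clm_apply contDiffOn_const).clm_apply contDiffOn_const)

theorem contDiffAt_productInChart {x₀ : X} {v : STModel n}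
    (hv : v.2 ∈ (chartAt (Model n) x₀).target) : ContDiffAt ℝ ∞ (g.productInChart x₀) v :=
  (contDiffOn_productInChart g x₀).contDiffAt ((isOpen_chart_target_snd x₀).mem_nhds hv)

theorem productInChart_eq_stChange {x₀ : X} {p : SpaceTime X}
    (hp : p.2 ∈ (chartAt (Model n) x₀).source) :
    ∀ᶠ v in 𝓝 (stChart n p.2 p.pt), ∀ a b, g.productInChart p.2 v a b =
      g.productInChart x₀ (stChange x₀ p.2 v) (fderiv ℝ (stChange x₀ p.2) v a)
        (fderiv ℝ (stChange x₀ p.2) v b) := by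
  have h1 := (eventually_mem_chartChange hp).and
    (((contDiffAt_real_chartChange hp).of_le (m := 1) (by simp)).eventually (by simp))
  have h2 : Tendsto (fun v : STModel n => v.2) (𝓝 (stChart n p.2 p.pt))
      (𝓝 (chartAt (Model n) p.2 p.2)) := continuous_snd.tendsto _
  filter_upwards [h2.eventually h1] with v hv a b
  have hd := hv.2.differentiableAt (by simp)
  rw [fderiv_stChange hd, fderiv_stChange hd, productInChart_apply, productInChart_apply,
    BilinField.inChart_eq_chartChange _ hv.1.1 hv.1.2]
  rfl

/-- The derivative pulls a form back to a positive definite one, so it is injective, and the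
dimensions agree. -/
theorem fderiv_stChange_surjective (g : KahlerMetric n X) {x₀ : X} {p : SpaceTime X}
    (hp : p.2 ∈ (chartAt (Model n) x₀).source) :
    Function.Surjective (fderiv ℝ (stChange x₀ p.2) (stChart n p.2 p.pt)) := by
  have hinj : Function.Injective
      (fderiv ℝ (stChange x₀ p.2) (stChart n p.2 p.pt) : STModel n →ₗ[ℝ] STModel n) := by
    rw [injective_iff_map_eq_zero]
    intro a ha
    by_contra h
    have h1 := (productInChart_eq_stChange g hp).self_of_nhds a a
    have h2 := productInChart_pos g (show (stChart n p.2 p.pt).2 ∈ _ from mem_chart_target _ p.2) h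
    have h3 : fderiv ℝ (stChange x₀ p.2) (stChart n p.2 p.pt) a = 0 := ha
    rw [h1, h3, map_zero] at h2
    exact lt_irrefl _ h2
  exact LinearMap.injective_iff_surjective.1 hinj

/-- The Hessian of a two-jet, computed from its Taylor coefficients in the chart around `x₀`. -/
theorem hessian_jetChart (x₀ : X) (z : {p : SpaceTime X // p.2 ∈ (chartAt (Model n) x₀).source} ×
    ℝ × (STModel n →L[ℝ] ℝ) × SymForm n) (a b : STModel n) :
    g.hessian z.1.1 (jetChart x₀ z).jet a b =
      hessianInChart (g.productInChart x₀) (stChart n x₀ z.1.1.pt) z.2.2.1 z.2.2.2.1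
        (fderiv ℝ (stChange x₀ z.1.1.2) (stChart n z.1.1.2 z.1.1.pt) a)
        (fderiv ℝ (stChange x₀ z.1.1.2) (stChart n z.1.1.2 z.1.1.pt) b) := by
  obtain ⟨⟨p, hp⟩, r, l, B, hB⟩ := z
  have hv : (stChart n p.2 p.pt).2 ∈ (chartAt (Model n) p.2).target :=
    mem_chart_target _ p.2
  have hv₀ := stChart_mem_target hp
  have hτ := stChange_stChart (n := n) (x₀ := x₀) p
  have h := hessianInChart_pullback (G := g.productInChart p.2) (G₀ := g.productInChart x₀)
    (τ := stChange x₀ p.2) (v := stChart n p.2 p.pt)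
    ((contDiffAt_productInChart g hv).differentiableAt (by simp))
    ((contDiffAt_productInChart g (hτ ▸ hv₀)).differentiableAt (by simp))
    ((contDiffAt_stChange hp).of_le ENat.LEInfty.out) (productInChart_eq_stChange g hp)
    (fun a b => productInChart_symm g _ _ a b) (isInvertible_productInChart g hv)
    (isInvertible_productInChart g (hτ ▸ hv₀)) (fderiv_stChange_surjective g hp) r l hB a b
  -- By definition the Taylor polynomial in the chart around `x₀`, read in the chart at `p`, is the
  -- quadratic polynomial composed with the coordinate change.
  rw [hτ] at h
  dsimp only
  rw [← h]
  rfl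

theorem hessian_symm (p : SpaceTime X) (j : JetAt n p) (a b : STModel n)
    (hj : ∀ a b, (jetDerivatives p j).2.2 a b = (jetDerivatives p j).2.2 b a) :
    g.hessian p j a b = g.hessian p j b a := by
  have hv : (stChart n p.2 p.pt).2 ∈ (chartAt (Model n) p.2).target :=
    mem_chart_target _ p.2
  rw [KahlerMetric.hessian, hessianInChart, LinearMap.mk₂_apply, LinearMap.mk₂_apply, hj,
    christoffel_symm ((contDiffAt_productInChart g hv).differentiableAt (by simp))
      (Eventually.of_forall fun v a b => productInChart_symm g p.2 v a b)]

theorem jetDerivatives_symm (p : SpaceTime X) (j : JetAt n p) (a b : STModel n) :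
    (jetDerivatives p j).2.2 a b = (jetDerivatives p j).2.2 b a := by
  obtain ⟨f, rfl⟩ := Submodule.mkQ_surjective _ j
  have h : IsSymmSndFDerivAt ℝ (readInChart n p.2 f) (stChart n p.2 p.pt) :=
    (contDiffAt_readInChart f).isSymmSndFDerivAt (by simpa using ENat.LEInfty.out)
  exact h.eq a b

end ProductMetric

/-! ### Frames -/

section Frames

/-- The `J`-invariant metric `β` is the real part of the Hermitian inner product `β(x, y) - i β(x,
iy)`. A complex orthonormal basis is a unitary frame. -/
theorem exists_unitary_frame {V : Type*} [AddCommGroup V] [Module ℂ V] [FiniteDimensional ℂ V]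
    (β : V → V → ℝ) (hadd : ∀ x y z, β (x + y) z = β x z + β y z)
    (hsmul : ∀ (r : ℝ) x y, β ((r : ℂ) • x) y = r * β x y) (hsymm : ∀ x y, β x y = β y x)
    (hpos : ∀ x, x ≠ 0 → 0 < β x x)
    (hinv : ∀ x y, β (Complex.I • x) (Complex.I • y) = β x y) :
    ∃ e : Fin (Module.finrank ℂ V) → V, ∀ j k, β (e j) (e k) = (if j = k then 1 else 0) ∧
      β (e j) (Complex.I • e k) = 0 := by
  have hneg : ∀ x y, β x (Complex.I • y) = -β (Complex.I • x) y := fun x y => by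
    rw [← hinv x, smul_smul, Complex.I_mul_I]
    have := hsmul (-1) y (Complex.I • x)
    rw [Complex.ofReal_neg, Complex.ofReal_one] at this
    rw [hsymm, this, hsymm]
    ring
  have hzero : ∀ y, β 0 y = 0 := fun y => by
    have := hsmul 0 0 y
    simpa using this
  let c : InnerProductSpace.Core ℂ V :=
    { inner := fun x y => ⟨β x y, -β x (Complex.I • y)⟩
      conj_inner_symm := fun x y => by
        apply Complex.ext
        · exact hsymm y x
        · simp only [Complex.conj_im, neg_neg]
          rw [hneg x y, hsymm y]
          ring
      re_inner_nonneg := fun x => by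
        by_cases h : x = 0
        · subst h; exact (hzero 0).ge
        · exact (hpos x h).le
      add_left := fun x y z => by
        apply Complex.ext
        · exact hadd x y z
        · simp only [Complex.add_im, hadd]; ring
      smul_left := fun x y r => by
        have h1 : ∀ z, β (r • x) z = r.re * β x z + r.im * β (Complex.I • x) z := fun z => by
          conv_lhs => rw [← Complex.re_add_im r, add_smul, mul_smul, hadd, hsmul, hsmul]
        apply Complex.ext
        · rw [Complex.mul_re]
          simp only [h1, Complex.conj_re, Complex.conj_im, hneg x y]
          ring
        · rw [Complex.mul_im]
          simp only [h1, Complex.conj_re, Complex.conj_im, hinv]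
          ring
      definite := fun x h => by
        by_contra hx
        exact (hpos x hx).ne' (congrArg Complex.re h) }
  let _ : NormedAddCommGroup V := c.toNormedAddCommGroup
  let _ : InnerProductSpace ℂ V := InnerProductSpace.ofCore c.toCore
  let b := stdOrthonormalBasis ℂ V
  refine ⟨b, fun j k => ?_⟩
  have h := orthonormal_iff_ite.1 b.orthonormal j k
  have hre : β (b j) (b k) = (inner ℂ (b j) (b k)).re := rfl
  have him : -β (b j) (Complex.I • b k) = (inner ℂ (b j) (b k)).im := rfl
  rw [h] at hre him
  refine ⟨by rw [hre]; split_ifs <;> simp, ?_⟩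
  rw [← neg_eq_zero, him]
  split_ifs <;> simp

/-- The Gram matrix of a bilinear form with respect to a family of vectors. -/
def gramMatrix {ι V : Type*} [AddCommGroup V] [Module ℝ V] (f : ι → V)
    (H : LinearMap.BilinForm ℝ V) : Matrix ι ι ℝ :=
  Matrix.of fun j k => H (f j) (f k)

variable {ι : Type} [Fintype ι] [DecidableEq ι] {V : Type*} [AddCommGroup V] [Module ℝ V]

theorem gramMatrix_eq_mul {κ : Type} [Fintype κ]
    {s f : κ → V} {E : Matrix κ κ ℝ} (hE : ∀ k, f k = ∑ j, E j k • s j)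
    (H : LinearMap.BilinForm ℝ V) : gramMatrix f H = Eᵀ * gramMatrix s H * E := by
  ext j k
  rw [Matrix.mul_apply]
  simp only [Matrix.mul_apply, gramMatrix, Matrix.of_apply, hE, map_sum, LinearMap.sum_apply,
    map_smul, LinearMap.smul_apply, smul_eq_mul, Matrix.transpose_apply, Finset.sum_mul,
    Finset.mul_sum]
  refine Finset.sum_congr rfl fun a _ => Finset.sum_congr rfl fun b _ => ?_
  ring

/-- If `E` expresses `f` through `s`, orthonormality reads `EᵀGE = 1`, that is `G⁻¹ = EEᵀ`. Cyclic
invariance of the characteristic polynomial turns `EᵀME` into `G⁻¹M`, in which `f` no longer occurs.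
-/
theorem charpoly_gramMatrix {s f : ι → V} (hs : ∀ v, ∃ c : ι → ℝ, v = ∑ j, c j • s j)
    {G : LinearMap.BilinForm ℝ V} (hG : gramMatrix f G = 1) (R P : LinearMap.BilinForm ℝ V) :
    (gramMatrix s G).det ≠ 0 ∧ (complexMatrix (gramMatrix f R) (gramMatrix f P)).charpoly =
      (((gramMatrix s G).map Complex.ofReal)⁻¹ *
        complexMatrix (gramMatrix s R) (gramMatrix s P)).charpoly := by
  choose c hc using fun k => hs (f k)
  let E : Matrix ι ι ℝ := Matrix.of fun j k => c k j
  have hE : ∀ k, f k = ∑ j, E j k • s j := hc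
  rw [gramMatrix_eq_mul hE] at hG
  constructor
  · intro h
    have h1 := congrArg Matrix.det hG
    rw [Matrix.det_mul, Matrix.det_mul, h, Matrix.det_one] at h1
    simp at h1
  · set Ec : Matrix ι ι ℂ := E.map Complex.ofReal with hEc
    set Gc : Matrix ι ι ℂ := (gramMatrix s G).map Complex.ofReal with hGc
    have hmul : ∀ A B : Matrix ι ι ℝ, (A * B).map Complex.ofReal =
        A.map Complex.ofReal * B.map Complex.ofReal := fun A B =>
      Matrix.map_mul (f := Complex.ofRealHom)
    have htr : Eᵀ.map Complex.ofReal = Ecᵀ := rfl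
    have h1 : Ecᵀ * Gc * Ec = 1 := by
      rw [← htr, hGc, hEc, ← hmul, ← hmul, hG]
      simp
    have h2 : Gc⁻¹ = Ec * Ecᵀ := by
      apply Matrix.inv_eq_left_inv
      rw [Matrix.mul_assoc]
      exact mul_eq_one_comm.1 h1
    have h3 : complexMatrix (gramMatrix f R) (gramMatrix f P) =
        Ecᵀ * (complexMatrix (gramMatrix s R) (gramMatrix s P) * Ec) := by
      rw [gramMatrix_eq_mul hE R, gramMatrix_eq_mul hE P]
      simp only [complexMatrix, hmul, htr, ← hEc]
      simp only [Matrix.mul_add, Matrix.add_mul, Matrix.mul_smul, Matrix.smul_mul, Matrix.mul_assoc]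
    rw [h3, Matrix.charpoly_mul_comm, h2, Matrix.mul_assoc, Matrix.charpoly_mul_comm]

end Frames

/-! ### The space-time matrix in an arbitrary chart -/

section ChartMatrix

/-- A continuous bilinear form as a bilinear form. -/
def toBilin {V : Type*} [NormedAddCommGroup V] [NormedSpace ℝ V] (B : V →L[ℝ] V →L[ℝ] ℝ) :
    LinearMap.BilinForm ℝ V :=
  LinearMap.mk₂ ℝ (fun a b => B a b) (by intros; simp) (by intros; simp) (by intros; simp)
    (by intros; simp)

theorem gramMatrix_comp {ι V : Type*} [AddCommGroup V] [Module ℝ V] (D : V → V) (f : ι → V)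
    {H H₀ : LinearMap.BilinForm ℝ V} (h : ∀ a b, H a b = H₀ (D a) (D b)) :
    gramMatrix (fun k => D (f k)) H₀ = gramMatrix f H := by
  ext j k
  exact (h _ _).symm

variable {n : ℕ}

/-- Multiplication by `i` on `ℂ × ℂ^n`. -/
def mulI (n : ℕ) : STModel n →ₗ[ℝ] STModel n :=
  (Complex.I • LinearMap.id : STModel n →ₗ[ℂ] STModel n).restrictScalars ℝ

/-- The projection of `ℂ × ℂ^n` onto `ℂ^n`. -/
def spaceProj (n : ℕ) : STModel n →ₗ[ℝ] STModel n :=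
  LinearMap.inr ℝ ℂ (Model n) ∘ₗ LinearMap.snd ℝ ℂ (Model n)

/-- The `J`-invariant part of a bilinear form. -/
def invariantPart (H : LinearMap.BilinForm ℝ (STModel n)) : LinearMap.BilinForm ℝ (STModel n) :=
  (1 / 2 : ℝ) • (H + H.compl₁₂ (mulI n) (mulI n))

/-- The restriction of a bilinear form to `ℂ^n`, extended by zero. -/
def spacePart (H : LinearMap.BilinForm ℝ (STModel n)) : LinearMap.BilinForm ℝ (STModel n) :=
  H.compl₁₂ (spaceProj n) (spaceProj n)

theorem invariantPart_apply (H : LinearMap.BilinForm ℝ (STModel n)) (a b : STModel n) :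
    invariantPart H a b = 1 / 2 * (H a b + H (Complex.I • a) (Complex.I • b)) := rfl

theorem spacePart_apply (H : LinearMap.BilinForm ℝ (STModel n)) (a b : STModel n) :
    spacePart H a b = H (0, a.2) (0, b.2) := rfl

/-- In a frame adapted to the complex structure, multiplication by `i` has the matrix `stdJ m`; so
the matrix projection comes from a construction on bilinear forms that needs no frame. -/
theorem projJ_gramMatrix {m : ℕ} {f : RealIdx m → STModel n}
    (hf : ∀ k, f (Sum.inr k) = Complex.I • f (Sum.inl k)) (H : LinearMap.BilinForm ℝ (STModel n)) :
    projJ (gramMatrix f H) = gramMatrix f (invariantPart H) := by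
  have hE : ∀ k, Complex.I • f k = ∑ j, stdJ m j k • f j := by
    intro k
    rcases k with k | k
    · simp [stdJ, Matrix.fromBlocks, hf, Matrix.one_apply, Fintype.sum_sum_type]
    · simp [stdJ, Matrix.fromBlocks, hf, Matrix.one_apply, Fintype.sum_sum_type, smul_smul]
  have h := gramMatrix_eq_mul (f := fun k => Complex.I • f k) hE H
  rw [projJ, ← h]
  ext j k
  simp [gramMatrix, invariantPart_apply]

/-- The real frame `1, e₁, …, e_n, i, i e₁, …, i e_n` of `ℂ × ℂ^n`. -/
def complexFrame (e : Fin n → Model n) : RealIdx (n + 1) → STModel n :=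
  Sum.elim (Fin.cases (1, 0) fun k => (0, e k)) (Fin.cases (Complex.I, 0) fun k => (0, Complex.I • e k))

theorem complexFrame_inr (e : Fin n → Model n) (k : Fin (n + 1)) :
    complexFrame e (Sum.inr k) = Complex.I • complexFrame e (Sum.inl k) := by
  refine Fin.cases ?_ (fun k => ?_) k <;> simp [complexFrame]

/-- Besides orthonormality, this identifies `I_{2n}` with the Gram matrix of the space part of the
metric, so that the real part of the space-time matrix also has a meaning without frames. -/
theorem gramMatrix_complexFrame {β : Model n →L[ℝ] Model n →L[ℝ] ℝ} {e : Fin n → Model n}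
    (hsymm : ∀ v w, β v w = β w v) (hinv : ∀ v w, β (Complex.I • v) (Complex.I • w) = β v w)
    (he : ∀ j k, β (e j) (e k) = (if j = k then 1 else 0) ∧ β (e j) (Complex.I • e k) = 0)
    {G : LinearMap.BilinForm ℝ (STModel n)} (hG : ∀ a b, G a b = inner ℝ a.1 b.1 + β a.2 b.2) :
    gramMatrix (complexFrame e) G = 1 ∧
      gramMatrix (complexFrame e) (spacePart G) = degenerateId n := by
  have h1 : ∀ j k, β (Complex.I • e j) (e k) = 0 := fun j k => (hsymm _ _).trans (he k j).2
  constructor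
  · ext j k
    change G _ _ = _
    rw [hG]
    rcases j with j | j <;> rcases k with k | k <;> refine Fin.cases ?_ (fun j => ?_) j <;>
      refine Fin.cases ?_ (fun k => ?_) k <;>
      simp [complexFrame, Matrix.one_apply, he, hinv, h1, Complex.inner, Fin.succ_ne_zero,
        (Fin.succ_ne_zero _).symm]
  · ext j k
    change G (0, _) (0, _) = _
    rw [hG, degenerateId, Matrix.diagonal_apply]
    rcases j with j | j <;> rcases k with k | k <;> refine Fin.cases ?_ (fun j => ?_) j <;>
      refine Fin.cases ?_ (fun k => ?_) k <;>
      simp [complexFrame, he, hinv, h1, Fin.succ_ne_zero, (Fin.succ_ne_zero _).symm]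

theorem exists_unitary_frame_model {β : Model n →L[ℝ] Model n →L[ℝ] ℝ}
    (hsymm : ∀ v w, β v w = β w v) (hpos : ∀ v, v ≠ 0 → 0 < β v v)
    (hinv : ∀ v w, β (Complex.I • v) (Complex.I • w) = β v w) :
    ∃ e : Fin n → Model n, ∀ j k, β (e j) (e k) = (if j = k then 1 else 0) ∧
      β (e j) (Complex.I • e k) = 0 := by
  obtain ⟨e, he⟩ := exists_unitary_frame (V := Model n) (fun v w => β v w)
    (fun a b c => by simp) (fun r a b => by simp [Complex.coe_smul]) hsymm hpos hinv
  have hn : Module.finrank ℂ (Model n) = n := by simp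
  refine ⟨fun k => e (Fin.cast hn.symm k), fun j k => ?_⟩
  have h := he (Fin.cast hn.symm j) (Fin.cast hn.symm k)
  exact ⟨h.1.trans (by simp), h.2⟩

/-- The standard real frame of `ℂ × ℂ^n`. -/
def stdFrame (n : ℕ) : RealIdx (n + 1) → STModel n :=
  complexFrame fun k => EuclideanSpace.single k 1

theorem stdFrame_span (v : STModel n) : ∃ c : RealIdx (n + 1) → ℝ, v = ∑ j, c j • stdFrame n j := by
  refine ⟨Sum.elim (Fin.cases v.1.re fun k => (v.2 k).re) (Fin.cases v.1.im fun k => (v.2 k).im), ?_⟩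
  rw [Fintype.sum_sum_type, Fin.sum_univ_succ, Fin.sum_univ_succ]
  refine Prod.ext ?_ ?_
  · simp [stdFrame, complexFrame, Prod.fst_sum]
  · ext i
    simp [stdFrame, complexFrame, Prod.snd_sum, Finset.sum_apply, Pi.single_apply]

variable {X : Type*} [TopologicalSpace X] [ChartedSpace (Model n) X]
  [IsManifold 𝓘(ℂ, Model n) ω X]

/-- A Kähler metric at a point, as a bilinear form on the model space. -/
def metricAt (g : KahlerMetric n X) (x : X) : Model n →L[ℝ] Model n →L[ℝ] ℝ := g.metric.inner x

theorem metricAt_symm (g : KahlerMetric n X) (x : X) (v w : Model n) :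
    metricAt g x v w = metricAt g x w v := g.metric.symm x v w

theorem metricAt_I (g : KahlerMetric n X) (x : X) (v w : Model n) :
    metricAt g x (Complex.I • v) (Complex.I • w) = metricAt g x v w := g.invariant x v w

theorem exists_isUnitaryFrame (g : KahlerMetric n X) (x : X) :
    ∃ e : Fin n → TSpace n x, g.IsUnitaryFrame x e :=
  exists_unitary_frame_model (metricAt_symm g x) (fun v hv => g.metric.pos x v hv) (metricAt_I g x)

theorem productInChart_self (g : KahlerMetric n X) (p : SpaceTime X) (a b : STModel n) :
    g.productInChart p.2 (stChart n p.2 p.pt) a b = inner ℝ a.1 b.1 + metricAt g p.2 a.2 b.2 := by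
  rw [productInChart_apply]
  congr 1
  exact BilinField.inChart_self _ p.2 a.2 b.2

theorem gramMatrix_unitaryFrame (g : KahlerMetric n X) (p : SpaceTime X) {e : Fin n → Model n}
    (he : g.IsUnitaryFrame p.2 e) :
    gramMatrix (complexFrame e)
      (toBilin (g.productInChart p.2 (stChart n p.2 p.pt))) = 1 ∧
    gramMatrix (complexFrame e)
      (spacePart (toBilin (g.productInChart p.2 (stChart n p.2 p.pt)))) = degenerateId n :=
  gramMatrix_complexFrame (metricAt_symm g p.2) (metricAt_I g p.2) he (productInChart_self g p)

/-- The form `ι(Λ)` in the chart around `x₀`. -/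
def iotaInChart (α : ClosedRealOneOneForm n X) (x₀ : X) (v : STModel n) :
    LinearMap.BilinForm ℝ (STModel n) :=
  LinearMap.mk₂ ℝ (fun a b => α.form.inChart x₀ v.2 a.2 (Complex.I • b.2))
    (by intros; simp) (by intros; simp) (by intros; simp)
    (by intros; simp [smul_comm Complex.I])

theorem iotaInChart_apply (α : ClosedRealOneOneForm n X) (x₀ : X) (v a b : STModel n) :
    iotaInChart α x₀ v a b = α.form.inChart x₀ v.2 a.2 (Complex.I • b.2) := rfl

theorem iotaLambda_eq_iotaInChart (α : ClosedRealOneOneForm n X) {x₀ : X} {p : SpaceTime X}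
    (hp : p.2 ∈ (chartAt (Model n) x₀).source) (a b : STModel n) :
    α.iotaLambda p a b = iotaInChart α x₀ (stChart n x₀ p.pt)
      (fderiv ℝ (stChange x₀ p.2) (stChart n p.2 p.pt) a)
      (fderiv ℝ (stChange x₀ p.2) (stChart n p.2 p.pt) b) := by
  have h := (eventually_mem_chartChange hp).self_of_nhds
  have h1 : α.iotaLambda p a b = α.form.inChart p.2 (chartAt (Model n) p.2 p.2) a.2
      (Complex.I • b.2) := (BilinField.inChart_self α.form p.2 a.2 (Complex.I • b.2)).symm
  rw [h1, BilinField.inChart_eq_chartChange _ h.1 h.2, fderiv_chartChange_I hp, iotaInChart_apply,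
    fderiv_stChange_at hp, fderiv_stChange_at hp, ← stChange_stChart]
  rfl

/-- The matrix, in the standard frame of the chart around `x₀`, of the complexified endomorphism
whose matrix in a unitary frame is the space-time matrix. -/
def chartMatrix (g : KahlerMetric n X) (α : ClosedRealOneOneForm n X) (x₀ : X) (v : STModel n)
    (l : STModel n →L[ℝ] ℝ) (B : STModel n →L[ℝ] STModel n →L[ℝ] ℝ) :
    Matrix (RealIdx (n + 1)) (RealIdx (n + 1)) ℂ :=
  ((gramMatrix (stdFrame n) (toBilin (g.productInChart x₀ v))).map Complex.ofReal)⁻¹ *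
    complexMatrix (gramMatrix (stdFrame n) (spacePart (toBilin (g.productInChart x₀ v))))
      (gramMatrix (stdFrame n) (invariantPart
        (hessianInChart (g.productInChart x₀) v l B + iotaInChart α x₀ v)))

/-- The derivative `D` of the coordinate change is a complex linear isometry respecting `ℂ × ℂ^n`.
It carries the unitary frame to a frame in which metric, space part and invariant part keep their
matrices, and `charpoly_gramMatrix` passes to the standard frame. -/
theorem charpoly_spaceTimeMatrix_chart (g : KahlerMetric n X) (α : ClosedRealOneOneForm n X)
    {x₀ : X} {p : SpaceTime X} (hp : p.2 ∈ (chartAt (Model n) x₀).source)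
    {H : LinearMap.BilinForm ℝ (STModel n)} {l : STModel n →L[ℝ] ℝ}
    {B : STModel n →L[ℝ] STModel n →L[ℝ] ℝ}
    (hH : ∀ a b, H a b = hessianInChart (g.productInChart x₀) (stChart n x₀ p.pt) l B
      (fderiv ℝ (stChange x₀ p.2) (stChart n p.2 p.pt) a)
      (fderiv ℝ (stChange x₀ p.2) (stChart n p.2 p.pt) b))
    {e : Fin n → Model n} (he : g.IsUnitaryFrame p.2 e) :
    (gramMatrix (stdFrame n) (toBilin (g.productInChart x₀ (stChart n x₀ p.pt)))).det ≠ 0 ∧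
    (spaceTimeMatrix (gramMatrix (complexFrame e) (H + α.iotaLambda p))).charpoly =
      (chartMatrix g α x₀ (stChart n x₀ p.pt) l B).charpoly := by
  set D := fderiv ℝ (stChange x₀ p.2) (stChart n p.2 p.pt) with hD
  let f : RealIdx (n + 1) → STModel n := fun k => D (complexFrame e k)
  have hDI : ∀ a, D (Complex.I • a) = Complex.I • D a := fun a => by
    rw [hD, fderiv_stChange_at hp, fderiv_stChange_at hp, Prod.smul_snd, fderiv_chartChange_I hp]
    rfl
  have hf : ∀ k, f (Sum.inr k) = Complex.I • f (Sum.inl k) := fun k => by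
    simp only [f]
    rw [complexFrame_inr, hDI]
  have hG : ∀ a b, g.productInChart p.2 (stChart n p.2 p.pt) a b =
      g.productInChart x₀ (stChart n x₀ p.pt) (D a) (D b) := fun a b => by
    rw [(productInChart_eq_stChange g hp).self_of_nhds a b, stChange_stChart]
  obtain ⟨h1, h2⟩ := gramMatrix_unitaryFrame g p he
  rw [← gramMatrix_comp (H₀ := toBilin (g.productInChart x₀ (stChart n x₀ p.pt))) D
    (complexFrame e) hG] at h1
  rw [← gramMatrix_comp (H₀ := spacePart (toBilin (g.productInChart x₀ (stChart n x₀ p.pt)))) D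
    (complexFrame e) fun a b => by
      -- The coordinate change acts only on `X`, so `D` commutes with the projection onto the space
      -- directions.
      have h0 : ∀ a : STModel n, D (0, a.2) = (0, (D a).2) := fun a => by
        rw [hD, fderiv_stChange_at hp, fderiv_stChange_at hp]
      rw [spacePart_apply, spacePart_apply, ← h0, ← h0]
      exact hG _ _] at h2
  have h3 : gramMatrix f (hessianInChart (g.productInChart x₀) (stChart n x₀ p.pt) l B +
      iotaInChart α x₀ (stChart n x₀ p.pt)) =
      gramMatrix (complexFrame e) (H + α.iotaLambda p) :=
    gramMatrix_comp D (complexFrame e) fun a b => by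
      rw [LinearMap.add_apply, LinearMap.add_apply, hH, iotaLambda_eq_iotaInChart α hp]
      rfl
  have h4 := charpoly_gramMatrix stdFrame_span h1
    (spacePart (toBilin (g.productInChart x₀ (stChart n x₀ p.pt))))
    (invariantPart (hessianInChart (g.productInChart x₀) (stChart n x₀ p.pt) l B +
      iotaInChart α x₀ (stChart n x₀ p.pt)))
  rw [h2, ← projJ_gramMatrix hf, h3] at h4
  exact h4

theorem charpoly_spaceTimeMatrix_jetChart (g : KahlerMetric n X) (α : ClosedRealOneOneForm n X)
    (x₀ : X) (z : {p : SpaceTime X // p.2 ∈ (chartAt (Model n) x₀).source} ×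
      ℝ × (STModel n →L[ℝ] ℝ) × SymForm n) {e : Fin n → Model n}
    (he : g.IsUnitaryFrame z.1.1.2 e) :
    (gramMatrix (stdFrame n) (toBilin (g.productInChart x₀ (stChart n x₀ z.1.1.pt)))).det ≠ 0 ∧
    (spaceTimeMatrix (gramMatrix (complexFrame e)
      (g.hessian z.1.1 (jetChart x₀ z).jet + α.iotaLambda z.1.1))).charpoly =
      (chartMatrix g α x₀ (stChart n x₀ z.1.1.pt) z.2.2.1 z.2.2.2.1).charpoly :=
  charpoly_spaceTimeMatrix_chart g α z.1.2 (hessian_jetChart g x₀ z) he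

theorem continuousOn_christoffel (g : KahlerMetric n X) (x₀ : X) (a b : STModel n) :
    ContinuousOn (fun v => christoffel (g.productInChart x₀) v a b)
      {v | v.2 ∈ (chartAt (Model n) x₀).target} := by
  have ho := isOpen_chart_target_snd (n := n) x₀
  have hG := contDiffOn_productInChart g x₀
  have h1 : ContinuousOn (fderiv ℝ (g.productInChart x₀)) {v | v.2 ∈ (chartAt (Model n) x₀).target} :=
    hG.continuousOn_fderiv_of_isOpen ho (by simp)
  have h2 : ContinuousOn (fun v => koszul (g.productInChart x₀) v a b)
      {v | v.2 ∈ (chartAt (Model n) x₀).target} := by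
    rw [continuousOn_clm_apply]
    intro e
    simp only [koszul_apply]
    have h3 : ∀ a b e : STModel n, ContinuousOn (fun v => fderiv ℝ (g.productInChart x₀) v a b e)
        {v | v.2 ∈ (chartAt (Model n) x₀).target} := fun a b e =>
      ((h1.clm_apply continuousOn_const).clm_apply continuousOn_const).clm_apply continuousOn_const
    exact ((h3 _ _ _).add (h3 _ _ _)).sub (h3 _ _ _)
  have h4 : ContinuousOn (fun v => (g.productInChart x₀ v).inverse)
      {v | v.2 ∈ (chartAt (Model n) x₀).target} := fun v hv =>
    ((isInvertible_productInChart g hv).contDiffAt_map_inverse (n := 0)).continuousAt.comp_continuousWithinAt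
      (hG.continuousOn v hv)
  exact h4.clm_apply (h2.const_smul (1 / 2 : ℝ))

theorem continuous_chartMatrix (g : KahlerMetric n X) (α : ClosedRealOneOneForm n X) (x₀ : X) :
    Continuous fun z : {p : SpaceTime X // p.2 ∈ (chartAt (Model n) x₀).source} ×
      ℝ × (STModel n →L[ℝ] ℝ) × SymForm n =>
      chartMatrix g α x₀ (stChart n x₀ z.1.1.pt) z.2.2.1 z.2.2.2.1 := by
  have hv : Continuous fun z : {p : SpaceTime X // p.2 ∈ (chartAt (Model n) x₀).source} ×
      ℝ × (STModel n →L[ℝ] ℝ) × SymForm n => stChart n x₀ z.1.1.pt := by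
    refine Continuous.prodMk (by unfold SpaceTime.pt; fun_prop) ?_
    exact (chartAt (Model n) x₀).continuousOn.comp_continuous
      (by unfold SpaceTime.pt; fun_prop) fun z => z.1.2
  have hmem : ∀ z : {p : SpaceTime X // p.2 ∈ (chartAt (Model n) x₀).source} ×
      ℝ × (STModel n →L[ℝ] ℝ) × SymForm n, stChart n x₀ z.1.1.pt ∈
        {v : STModel n | v.2 ∈ (chartAt (Model n) x₀).target} := fun z => stChart_mem_target z.1.2
  have hG : ∀ a b : STModel n, Continuous fun z : {p : SpaceTime X // p.2 ∈ (chartAt (Model n) x₀).source} ×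
      ℝ × (STModel n →L[ℝ] ℝ) × SymForm n => g.productInChart x₀ (stChart n x₀ z.1.1.pt) a b :=
    fun a b => (((contDiffOn_productInChart g x₀).continuousOn.comp_continuous hv hmem).clm_apply
      continuous_const).clm_apply continuous_const
  have hα : ∀ a b : STModel n, Continuous fun z : {p : SpaceTime X // p.2 ∈ (chartAt (Model n) x₀).source} ×
      ℝ × (STModel n →L[ℝ] ℝ) × SymForm n => iotaInChart α x₀ (stChart n x₀ z.1.1.pt) a b :=
    fun a b => (((contDiffOn_inChart α.smooth x₀).continuousOn.comp_continuous
      (continuous_snd.comp hv) hmem).clm_apply continuous_const).clm_apply continuous_const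
  have hl : Continuous fun z : {p : SpaceTime X // p.2 ∈ (chartAt (Model n) x₀).source} ×
      ℝ × (STModel n →L[ℝ] ℝ) × SymForm n => z.2.2.1 := by fun_prop
  have hB : Continuous fun z : {p : SpaceTime X // p.2 ∈ (chartAt (Model n) x₀).source} ×
      ℝ × (STModel n →L[ℝ] ℝ) × SymForm n => z.2.2.2.1 := by fun_prop
  have hH : ∀ a b : STModel n, Continuous fun z : {p : SpaceTime X // p.2 ∈ (chartAt (Model n) x₀).source} ×
      ℝ × (STModel n →L[ℝ] ℝ) × SymForm n =>
      hessianInChart (g.productInChart x₀) (stChart n x₀ z.1.1.pt) z.2.2.1 z.2.2.2.1 a b :=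
    fun a b => ((hB.clm_apply continuous_const).clm_apply continuous_const).sub
      (hl.clm_apply ((continuousOn_christoffel g x₀ a b).comp_continuous hv hmem))
  have hgram : Continuous fun z : {p : SpaceTime X // p.2 ∈ (chartAt (Model n) x₀).source} ×
      ℝ × (STModel n →L[ℝ] ℝ) × SymForm n =>
      (gramMatrix (stdFrame n) (toBilin (g.productInChart x₀ (stChart n x₀ z.1.1.pt)))).map
        Complex.ofReal :=
    continuous_matrix fun j k => Complex.continuous_ofReal.comp (hG _ _)
  refine Continuous.mul ?_ (continuous_matrix fun j k => ?_)
  · rw [continuous_iff_continuousAt]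
    intro z
    -- A unitary frame at the base point serves only to see that the Gram determinant in the
    -- standard frame is nonzero.
    obtain ⟨e, he⟩ := exists_isUnitaryFrame g z.1.1.2
    have hdet := (charpoly_spaceTimeMatrix_jetChart g α x₀ z he).1
    refine ContinuousAt.comp (continuousAt_matrix_inv _ ?_) hgram.continuousAt
    rw [Ring.inverse_eq_inv']
    refine continuousAt_inv₀ ?_
    have h := RingHom.map_det Complex.ofRealHom
      (gramMatrix (stdFrame n) (toBilin (g.productInChart x₀ (stChart n x₀ z.1.1.pt))))
    intro h0
    apply hdet
    apply Complex.ofReal_injective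
    exact h.trans h0
  · refine Continuous.add ?_ (continuous_const.mul ?_)
    · exact Complex.continuous_ofReal.comp (hG _ _)
    · exact Complex.continuous_ofReal.comp (continuous_const.mul
        (((hH _ _).add (hα _ _)).add ((hH _ _).add (hα _ _))))

end ChartMatrix

/-! ### Two-jets and the space-time angle -/

section JetAngle

variable {n : ℕ} {X : Type*} [TopologicalSpace X] [ChartedSpace (Model n) X]

theorem chartChange_self_eventuallyEq (x : X) :
    chartChange (n := n) x x =ᶠ[𝓝 (chartAt (Model n) x x)] id := by
  filter_upwards [(chartAt (Model n) x).open_target.mem_nhds (mem_chart_target _ x)] with y hy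
  exact (chartAt (Model n) x).right_inv hy

theorem stChange_self_eventuallyEq (p : SpaceTime X) :
    stChange (n := n) p.2 p.2 =ᶠ[𝓝 (stChart n p.2 p.pt)] id := by
  have h : Tendsto (fun v : STModel n => v.2) (𝓝 (stChart n p.2 p.pt))
      (𝓝 (chartAt (Model n) p.2 p.2)) := continuous_snd.tendsto _
  filter_upwards [h.eventually (chartChange_self_eventuallyEq (n := n) p.2)] with v hv
  exact Prod.ext rfl hv

variable [IsManifold 𝓘(ℂ, Model n) ω X]

/-- The two-jet at `p` with given derivatives in the chart at `p`. -/
def jetWith (p : SpaceTime X) (d : ℝ × (STModel n →L[ℝ] ℝ) × SymForm n) : JetAt n p :=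
  jetOf p ⟨taylor n p.2 p d.1 d.2.1 d.2.2.1, taylor_mem p.2 p (mem_chart_source _ _) _ _ _⟩

theorem jetChart_self (p : SpaceTime X) (d : ℝ × (STModel n →L[ℝ] ℝ) × SymForm n) :
    jetChart p.2 (⟨p, mem_chart_source _ _⟩, d) = (⟨p, jetWith p d⟩ : JetBundle n X) := rfl

/-- The change from a chart to itself is the identity near the point: its first derivative is the
identity and its second derivative vanishes. -/
theorem jetDerivatives_jetWith (p : SpaceTime X) (d : ℝ × (STModel n →L[ℝ] ℝ) × SymForm n) :
    jetDerivatives p (jetWith p d) = (d.1, d.2.1, d.2.2.1) := by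
  obtain ⟨r, l, B, hB⟩ := d
  have hev := stChange_self_eventuallyEq (n := n) p
  have h1 : ∀ᶠ v in 𝓝 (stChart n p.2 p.pt), fderiv ℝ (stChange (n := n) p.2 p.2) v =
      ContinuousLinearMap.id ℝ (STModel n) := hev.fderiv.mono fun v hv => by rw [hv, fderiv_id]
  have h2 : fderiv ℝ (fderiv ℝ (stChange (n := n) p.2 p.2)) (stChart n p.2 p.pt) = 0 := by
    rw [Filter.EventuallyEq.fderiv_eq h1]
    simp
  have hτ := (contDiffAt_stChange (n := n) (mem_chart_source (Model n) p.2)).of_le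
    (m := 2) ENat.LEInfty.out
  have h3 := fderiv_quadratic_comp hτ r l hB
  have h4 := fderiv_fderiv_quadratic_comp hτ r l hB
  rw [stChange_stChart] at h3 h4
  refine Prod.ext ?_ (Prod.ext ?_ ?_)
  · change taylor n p.2 p r l B p.pt = r
    simp [taylor]
  · refine Eq.trans h3 ?_
    rw [h1.self_of_nhds]
    rfl
  · refine ContinuousLinearMap.ext fun a => ContinuousLinearMap.ext fun b => ?_
    refine (h4 a b).trans ?_
    rw [h1.self_of_nhds, h2]
    simp

theorem jetDerivatives_injective (p : SpaceTime X) :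
    Function.Injective (jetDerivatives (n := n) p) := by
  rw [← LinearMap.ker_eq_bot]
  exact Submodule.ker_liftQ_eq_bot' _ _ rfl

/-- The derivatives of a two-jet, with the symmetry of the second derivative. -/
def symDerivatives (p : SpaceTime X) (j : JetAt n p) : ℝ × (STModel n →L[ℝ] ℝ) × SymForm n :=
  ((jetDerivatives p j).1, (jetDerivatives p j).2.1,
    ⟨(jetDerivatives p j).2.2, jetDerivatives_symm p j⟩)

theorem jetWith_symDerivatives (p : SpaceTime X) (j : JetAt n p) :
    jetWith p (symDerivatives p j) = j :=
  jetDerivatives_injective p (jetDerivatives_jetWith p _)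

theorem continuous_jetDerivatives (p : SpaceTime X) : Continuous (jetDerivatives (n := n) p) :=
  continuous_induced_dom

theorem continuous_jetChart (x₀ : X) : Continuous (jetChart (n := n) x₀) :=
  continuous_iff_coinduced_le.2
    (le_iSup (fun x₀ : X => TopologicalSpace.coinduced (jetChart (n := n) x₀) inferInstance) x₀)

/-- The fibre inclusion factors through the one parametrization `jetChart p.2`, with fixed base
point. -/
theorem continuous_jetBundle_mk (p : SpaceTime X) :
    Continuous fun j : JetAt n p => (⟨p, j⟩ : JetBundle n X) := by
  have h := continuous_jetDerivatives (n := n) p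
  have h1 : Continuous (symDerivatives (n := n) p) :=
    h.fst.prodMk (h.snd.fst.prodMk (h.snd.snd.subtype_mk _))
  have h2 : Continuous fun j : JetAt n p =>
      ((⟨p, mem_chart_source _ _⟩ : {q : SpaceTime X // q.2 ∈ (chartAt (Model n) p.2).source}),
        symDerivatives p j) := continuous_const.prodMk h1
  refine ((continuous_jetChart p.2).comp h2).congr fun j => ?_
  exact (jetChart_self p _).trans (by rw [jetWith_symDerivatives])

theorem continuous_add_smul (p : SpaceTime X) (j k : JetAt n p) :
    Continuous fun t : ℝ => j + t • k := by
  rw [continuous_induced_rng]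
  have h : (jetDerivatives p) ∘ (fun t : ℝ => j + t • k) =
      fun t => jetDerivatives p j + t • jetDerivatives p k := by
    funext t
    simp
  rw [h]
  exact continuous_const.add (continuous_id.smul continuous_const)

/-! ### Linearity of the Hessian and independence of the unitary frame. -/

variable (g : KahlerMetric n X) (α : ClosedRealOneOneForm n X)

theorem hessian_apply (p : SpaceTime X) (j : JetAt n p) (a b : STModel n) :
    g.hessian p j a b = (jetDerivatives p j).2.2 a b - (jetDerivatives p j).2.1
      (christoffel (g.productInChart p.2) (stChart n p.2 p.pt) a b) := rfl

theorem hessian_add (p : SpaceTime X) (j k : JetAt n p) :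
    g.hessian p (j + k) = g.hessian p j + g.hessian p k := by
  refine LinearMap.ext fun a => LinearMap.ext fun b => ?_
  rw [LinearMap.add_apply, LinearMap.add_apply]
  simp only [hessian_apply, map_add, Prod.snd_add, Prod.fst_add, add_apply]
  ring

theorem hessian_smul (p : SpaceTime X) (t : ℝ) (j : JetAt n p) :
    g.hessian p (t • j) = t • g.hessian p j := by
  refine LinearMap.ext fun a => LinearMap.ext fun b => ?_
  rw [LinearMap.smul_apply, LinearMap.smul_apply]
  simp only [hessian_apply, map_smul, Prod.smul_snd, Prod.smul_fst, smul_apply, smul_eq_mul]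
  ring

theorem hessian_neg (p : SpaceTime X) (j : JetAt n p) : g.hessian p (-j) = -g.hessian p j := by
  refine LinearMap.ext fun a => LinearMap.ext fun b => ?_
  rw [LinearMap.neg_apply, LinearMap.neg_apply]
  simp only [hessian_apply, map_neg, Prod.snd_neg, Prod.fst_neg, neg_apply]
  ring

theorem hessian_of_fderiv_eq_zero (p : SpaceTime X) {k : JetAt n p}
    (hk : (jetDerivatives p k).2.1 = 0) : g.hessian p k = toBilin (jetDerivatives p k).2.2 := by
  refine LinearMap.ext fun a => LinearMap.ext fun b => ?_
  rw [hessian_apply, hk]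
  exact sub_zero _

theorem gramMatrix_add {ι V : Type*} [AddCommGroup V] [Module ℝ V] (f : ι → V)
    (H K : LinearMap.BilinForm ℝ V) : gramMatrix f (H + K) = gramMatrix f H + gramMatrix f K := rfl

theorem gramMatrix_smul {ι V : Type*} [AddCommGroup V] [Module ℝ V] (f : ι → V) (t : ℝ)
    (H : LinearMap.BilinForm ℝ V) : gramMatrix f (t • H) = t • gramMatrix f H := rfl

theorem gramMatrix_neg {ι V : Type*} [AddCommGroup V] [Module ℝ V] (f : ι → V)
    (H : LinearMap.BilinForm ℝ V) : gramMatrix f (-H) = -gramMatrix f H := rfl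

theorem gramMatrix_posSemidef {ι : Type} [Fintype ι] (f : ι → STModel n)
    {B : STModel n →L[ℝ] STModel n →L[ℝ] ℝ} (hsymm : ∀ v w, B v w = B w v)
    (hpos : ∀ v, 0 ≤ B v v) : (gramMatrix f (toBilin B)).PosSemidef := by
  refine .of_dotProduct_mulVec_nonneg ?_ fun x => ?_
  · ext j k
    exact hsymm _ _
  · refine (hpos (∑ j, x j • f j)).trans_eq ?_
    simp only [map_sum, _root_.sum_apply, map_smul, dotProduct, Matrix.mulVec,
      Finset.mul_sum, star_trivial]
    refine Finset.sum_congr rfl fun j _ => ?_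
    rw [smul_eq_mul, Finset.mul_sum]
    refine Finset.sum_congr rfl fun k _ => ?_
    simp only [smul_apply, smul_eq_mul]
    change x j * (x k * B (f k) (f j)) = x j * (B (f j) (f k) * x k)
    rw [hsymm, mul_comm (x k)]

/-- Expand `β(iv + w, iv + w) = 0` and use invariance under `i`. -/
theorem apply_I_smul_symm {β : Model n →L[ℝ] Model n →L[ℝ] ℝ} (halt : ∀ v, β v v = 0)
    (hI : ∀ v w, β (Complex.I • v) (Complex.I • w) = β v w) (v w : Model n) :
    β v (Complex.I • w) = β w (Complex.I • v) := by
  have h := halt (Complex.I • v + w)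
  simp only [map_add, add_apply, halt] at h
  rw [← hI, smul_smul, Complex.I_mul_I, neg_one_smul, map_neg]
  linarith

theorem iotaLambda_symm (p : SpaceTime X) (a b : STModel n) :
    α.iotaLambda p a b = α.iotaLambda p b a :=
  apply_I_smul_symm (β := α.form p.2) (α.alternating p.2) (α.type_one_one p.2) a.2 b.2

/-- A chosen unitary frame at a point. -/
def unitaryFrame (x : X) : Fin n → Model n := (exists_isUnitaryFrame g x).choose

theorem isUnitaryFrame_unitaryFrame (x : X) : g.IsUnitaryFrame x (unitaryFrame g x) :=
  (exists_isUnitaryFrame g x).choose_spec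

/-- The matrix of `Hess u + ι(Λ)` in the chosen unitary frame. -/
def shiftedMatrix (z : JetBundle n X) : Matrix (RealIdx (n + 1)) (RealIdx (n + 1)) ℝ :=
  gramMatrix (complexFrame (unitaryFrame g z.base.2)) (g.hessian z.base z.jet + α.iotaLambda z.base)

theorem gramMatrix_shifted_isSymm (p : SpaceTime X) (j : JetAt n p) (e : Fin n → Model n) :
    (gramMatrix (complexFrame e) (g.hessian p j + α.iotaLambda p)).IsSymm := by
  ext a b
  exact congrArg₂ (· + ·) (hessian_symm g p j _ _ (jetDerivatives_symm p j))
    (iotaLambda_symm α p _ _)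

theorem shiftedMatrix_isSymm (z : JetBundle n X) : (shiftedMatrix g α z).IsSymm :=
  gramMatrix_shifted_isSymm g α z.base z.jet _

/-- Both sides equal the characteristic polynomial of `chartMatrix` in the chart at `p`, which
involves no unitary frame. -/
theorem charpoly_spaceTimeMatrix_eq (p : SpaceTime X) (j : JetAt n p) {e : Fin n → Model n}
    (he : g.IsUnitaryFrame p.2 e) :
    (spaceTimeMatrix (gramMatrix (complexFrame e) (g.hessian p j + α.iotaLambda p))).charpoly =
      (spaceTimeMatrix (shiftedMatrix g α ⟨p, j⟩)).charpoly := by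
  have h : ∀ e, g.IsUnitaryFrame p.2 e → _ := fun e he =>
    (charpoly_spaceTimeMatrix_jetChart g α p.2
      (⟨p, mem_chart_source _ _⟩, symDerivatives p j) (e := e) he).2
  simp only [jetChart_self, jetWith_symDerivatives] at h
  rw [h e he, shiftedMatrix, h _ (isUnitaryFrame_unitaryFrame g p.2)]

/-- The space-time angle does not depend on the unitary frame. -/
theorem spaceTimeAngle_eq_shiftedMatrix (p : SpaceTime X) (j : JetAt n p) {e : Fin n → Model n}
    (he : g.IsUnitaryFrame p.2 e) :
    spaceTimeAngle (gramMatrix (complexFrame e) (g.hessian p j + α.iotaLambda p)) =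
      spaceTimeAngle (shiftedMatrix g α ⟨p, j⟩) := by
  rw [spaceTimeAngle_eq (gramMatrix_shifted_isSymm g α p j e),
    spaceTimeAngle_eq (shiftedMatrix_isSymm g α ⟨p, j⟩), upperAngle, upperAngle,
    charpoly_spaceTimeMatrix_eq g α p j he]

theorem spaceTimeAngle_neg_eq_shiftedMatrix (p : SpaceTime X) (j : JetAt n p)
    {e : Fin n → Model n} (he : g.IsUnitaryFrame p.2 e) :
    spaceTimeAngle (-gramMatrix (complexFrame e) (g.hessian p j + α.iotaLambda p)) =
      spaceTimeAngle (-shiftedMatrix g α ⟨p, j⟩) := by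
  rw [← neg_inj, neg_spaceTimeAngle_neg (gramMatrix_shifted_isSymm g α p j e),
    neg_spaceTimeAngle_neg (shiftedMatrix_isSymm g α ⟨p, j⟩), lowerAngle, lowerAngle,
    charpoly_spaceTimeMatrix_eq g α p j he]

theorem mem_sigmaSet_iff {c : ℝ} (z : JetBundle n X) :
    z ∈ sigmaSet g α c ↔ c ≤ spaceTimeAngle (shiftedMatrix g α z) := by
  obtain ⟨p, j⟩ := z
  constructor
  · rintro ⟨e, he, -, h⟩
    exact le_trans (α := ℝ) h (le_of_eq (spaceTimeAngle_eq_shiftedMatrix g α p j he))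
  · intro h
    exact ⟨unitaryFrame g p.2, isUnitaryFrame_unitaryFrame g p.2, shiftedMatrix_isSymm g α ⟨p, j⟩, h⟩

theorem mem_sigmaTildeSet_iff {c : ℝ} (z : JetBundle n X) :
    z ∈ sigmaTildeSet g α c ↔ c ≤ spaceTimeAngle (-shiftedMatrix g α ⟨z.base, -z.jet⟩) := by
  obtain ⟨p, j⟩ := z
  -- Subtracting the shift for `j` is the negative of adding it for `-j`; this is how the dual set
  -- meets the lower angle.
  have hneg : g.hessian p j - α.iotaLambda p = -(g.hessian p (-j) + α.iotaLambda p) := by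
    rw [hessian_neg]; abel
  constructor
  · rintro ⟨e, he, -, h⟩
    change c ≤ spaceTimeAngle (gramMatrix (complexFrame e) (g.hessian p j - α.iotaLambda p)) at h
    rw [hneg, gramMatrix_neg] at h
    exact h.trans_eq (spaceTimeAngle_neg_eq_shiftedMatrix g α p (-j) he)
  · intro h
    refine ⟨unitaryFrame g p.2, isUnitaryFrame_unitaryFrame g p.2, ?_⟩
    change gramMatrix (complexFrame _) (g.hessian p j - α.iotaLambda p) ∈ localSet n c
    rw [hneg, gramMatrix_neg]
    exact ⟨(shiftedMatrix_isSymm g α ⟨p, -j⟩).neg, h⟩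

theorem shiftedMatrix_add (p : SpaceTime X) (j k : JetAt n p) :
    shiftedMatrix g α ⟨p, j + k⟩ = shiftedMatrix g α ⟨p, j⟩ +
      gramMatrix (complexFrame (unitaryFrame g p.2)) (g.hessian p k) := by
  rw [shiftedMatrix, shiftedMatrix, ← gramMatrix_add, hessian_add]
  congr 1
  abel

/-- The two-jet at `p` with vanishing value and differential whose Hessian is the metric. -/
def metricJet (p : SpaceTime X) : JetAt n p :=
  jetWith p (0, 0, ⟨g.productInChart p.2 (stChart n p.2 p.pt), productInChart_symm g _ _⟩)

/-- The metric has the identity matrix in a unitary frame, so this direction in the fibre shifts all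
eigenvalues of the space-time matrix by `it`. -/
theorem shiftedMatrix_add_smul_metricJet (p : SpaceTime X) (j : JetAt n p) (t : ℝ) :
    shiftedMatrix g α ⟨p, j + t • metricJet g p⟩ = shiftedMatrix g α ⟨p, j⟩ + t • 1 := by
  have h := jetDerivatives_jetWith p
    (0, 0, ⟨g.productInChart p.2 (stChart n p.2 p.pt), productInChart_symm g _ _⟩)
  have h1 : g.hessian p (metricJet g p) = toBilin (g.productInChart p.2 (stChart n p.2 p.pt)) := by
    refine (hessian_of_fderiv_eq_zero g p (congrArg (fun d => d.2.1) h)).trans ?_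
    exact congrArg toBilin (congrArg (fun d => d.2.2) h)
  rw [shiftedMatrix_add, hessian_smul, gramMatrix_smul, h1,
    (gramMatrix_unitaryFrame g p (isUnitaryFrame_unitaryFrame g p.2)).1]

/-- The two-jets whose lower space-time angle exceeds `c`. -/
def strictSet (c : ℝ) : Set (JetBundle n X) := {z | c < -spaceTimeAngle (-shiftedMatrix g α z)}

theorem charpoly_shiftedMatrix_jetChart (x₀ : X)
    (z : {p : SpaceTime X // p.2 ∈ (chartAt (Model n) x₀).source} ×
      ℝ × (STModel n →L[ℝ] ℝ) × SymForm n) :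
    (spaceTimeMatrix (shiftedMatrix g α (jetChart x₀ z))).charpoly =
      (chartMatrix g α x₀ (stChart n x₀ z.1.1.pt) z.2.2.1 z.2.2.2.1).charpoly :=
  (charpoly_spaceTimeMatrix_jetChart g α x₀ z (isUnitaryFrame_unitaryFrame g _)).2

/-! ### Closedness, interior and duality in the jet bundle. -/

theorem roots_chartMatrix_mem (x₀ : X)
    (z : {p : SpaceTime X // p.2 ∈ (chartAt (Model n) x₀).source} ×
      ℝ × (STModel n →L[ℝ] ℝ) × SymForm n) {x : ℂ}
    (hx : x ∈ (chartMatrix g α x₀ (stChart n x₀ z.1.1.pt) z.2.2.1 z.2.2.2.1).charpoly.roots) :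
    x ∈ rightHalfPlane := by
  rw [← charpoly_shiftedMatrix_jetChart] at hx
  exact (isAccretive_spaceTimeMatrix (shiftedMatrix_isSymm g α _)).re_nonneg hx

/-- The topology is glued from the parametrizations `jetChart x₀`, and over each the angle is half
the upper angle of a continuous family; hence the threshold `2 * c`. -/
theorem isClosed_sigmaSet (c : ℝ) : IsClosed (sigmaSet g α c) := by
  refine isClosed_iSup_iff.2 fun x₀ => isClosed_coinduced.2 ?_
  have h := (upperSemicontinuous_iff_isClosed_preimage.1 (upperSemicontinuous_upperAngle
    (continuous_chartMatrix g α x₀) fun z x hx => roots_chartMatrix_mem g α x₀ z hx)) (2 * c)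
  convert! h using 1
  ext z
  rw [mem_preimage, mem_preimage, mem_sigmaSet_iff, spaceTimeAngle_eq (shiftedMatrix_isSymm g α _),
    upperAngle, charpoly_shiftedMatrix_jetChart, mem_Ici, upperAngle]
  constructor <;> intro h <;> linarith

theorem isOpen_strictSet (c : ℝ) : IsOpen (strictSet g α c) := by
  refine isOpen_iSup_iff.2 fun x₀ => isOpen_coinduced.2 ?_
  have h := (lowerSemicontinuous_iff_isOpen_preimage.1 (lowerSemicontinuous_lowerAngle
    (continuous_chartMatrix g α x₀) fun z x hx => roots_chartMatrix_mem g α x₀ z hx)) (2 * c)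
  convert! h using 1
  ext z
  rw [mem_preimage, mem_preimage, strictSet, mem_ofPred_eq,
    neg_spaceTimeAngle_neg (shiftedMatrix_isSymm g α _), lowerAngle,
    charpoly_shiftedMatrix_jetChart, mem_Ioi, lowerAngle]
  constructor <;> intro h <;> linarith

theorem strictSet_subset (c : ℝ) : strictSet g α c ⊆ sigmaSet g α c := fun z hz => by
  rw [mem_sigmaSet_iff]
  exact (le_of_lt hz).trans (neg_spaceTimeAngle_neg_le (shiftedMatrix_isSymm g α z))

theorem add_smul_metricJet_mem_strictSet {c : ℝ} (hc : |c| < (n + 1) * Real.pi / 2)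
    {p : SpaceTime X} {j : JetAt n p} (hj : (⟨p, j⟩ : JetBundle n X) ∈ sigmaSet g α c) {t : ℝ}
    (ht : 0 < t) : (⟨p, j + t • metricJet g p⟩ : JetBundle n X) ∈ strictSet g α c := by
  rw [mem_sigmaSet_iff] at hj
  rw [strictSet, mem_ofPred_eq, shiftedMatrix_add_smul_metricJet]
  exact lt_neg_spaceTimeAngle_neg_add (shiftedMatrix_isSymm g α _) hc hj ht

/-- From an interior point one can step back by a small multiple of the metric without leaving the
set; returning makes the inequality strict. -/
theorem interior_fibre_sigmaSet_subset {c : ℝ} (hc : |c| < (n + 1) * Real.pi / 2)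
    (p : SpaceTime X) : interior (fibre (sigmaSet g α c) p) ⊆ fibre (strictSet g α c) p := by
  intro j hj
  have h1 : ∀ᶠ t : ℝ in 𝓝 0, j + t • (-metricJet g p) ∈ fibre (sigmaSet g α c) p :=
    (continuous_add_smul p j _).continuousAt.eventually (by
      simpa using mem_interior_iff_mem_nhds.1 hj)
  obtain ⟨t, ht, ht0⟩ := ((h1.filter_mono (nhdsWithin_le_nhds (s := Ioi 0))).and
    self_mem_nhdsWithin).exists
  have h2 := add_smul_metricJet_mem_strictSet g α hc ht ht0
  have h3 : j + t • (-metricJet g p) + t • metricJet g p = j := by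
    rw [smul_neg, neg_add_cancel_right]
  rwa [h3] at h2

theorem fibre_interior_subset (F : Set (JetBundle n X)) (p : SpaceTime X) :
    fibre (interior F) p ⊆ interior (fibre F p) :=
  interior_maximal (fun _ hj => interior_subset (s := F) hj)
    (isOpen_interior.preimage (continuous_jetBundle_mk p))

/-- One inclusion holds because the strict set is open, by lower semicontinuity; the other is
checked within single fibres. -/
theorem interior_sigmaSet {c : ℝ} (hc : |c| < (n + 1) * Real.pi / 2) :
    interior (sigmaSet g α c) = strictSet g α c := by
  refine subset_antisymm (fun z hz => ?_)
    (interior_maximal (strictSet_subset g α c) (isOpen_strictSet g α c))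
  exact interior_fibre_sigmaSet_subset g α hc z.base (fibre_interior_subset _ z.base hz)

theorem mem_closure_fibre_strictSet {c : ℝ} (hc : |c| < (n + 1) * Real.pi / 2) {p : SpaceTime X}
    {j : JetAt n p} (hj : (⟨p, j⟩ : JetBundle n X) ∈ sigmaSet g α c) :
    j ∈ closure (fibre (strictSet g α c) p) := by
  have h1 : Tendsto (fun t : ℝ => j + t • metricJet g p) (𝓝[>] 0) (𝓝 j) := by
    have := (continuous_add_smul p j (metricJet g p)).tendsto 0
    simp only [zero_smul, add_zero] at this
    exact this.mono_left nhdsWithin_le_nhds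
  refine mem_closure_of_tendsto h1 ?_
  filter_upwards [self_mem_nhdsWithin] with t ht
  exact add_smul_metricJet_mem_strictSet g α hc hj ht

theorem interior_fibre_sigmaSet {c : ℝ} (hc : |c| < (n + 1) * Real.pi / 2) (p : SpaceTime X) :
    interior (fibre (sigmaSet g α c) p) = fibre (strictSet g α c) p := by
  refine subset_antisymm (interior_fibre_sigmaSet_subset g α hc p) ?_
  rw [← interior_sigmaSet g α hc]
  exact fibre_interior_subset _ p

theorem sigmaSet_positivity {c : ℝ} (p : SpaceTime X) (j k : JetAt n p)
    (hj : j ∈ fibre (sigmaSet g α c) p) (hk : (jetDerivatives p k).2.1 = 0)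
    (hpos : ∀ v, 0 ≤ (jetDerivatives p k).2.2 v v) : j + k ∈ fibre (sigmaSet g α c) p := by
  have hj' := (mem_sigmaSet_iff g α _).1 hj
  refine (mem_sigmaSet_iff g α _).2 ?_
  rw [shiftedMatrix_add, hessian_of_fderiv_eq_zero g p hk]
  exact hj'.trans (spaceTimeAngle_le_add (shiftedMatrix_isSymm g α _)
    (gramMatrix_posSemidef _ (jetDerivatives_symm p k) hpos))

theorem isSubequation_sigmaSet {c : ℝ} (hc : |c| < (n + 1) * Real.pi / 2) :
    IsSubequation (sigmaSet g α c) where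
  isClosed := isClosed_sigmaSet g α c
  positivity p j k hj _ hk hpos := sigmaSet_positivity g α p j k hj hk hpos
  -- A jet with vanishing first and second derivatives has zero Hessian, a special case of a
  -- nonnegative one; its value plays no role.
  negativity p j k hj _ hk hk' :=
    sigmaSet_positivity g α p j k hj hk fun v => by rw [hk']; exact le_rfl
  eq_closure_interior := by
    refine subset_antisymm (fun z hz => ?_)
      (closure_minimal interior_subset (isClosed_sigmaSet g α c))
    rw [interior_sigmaSet g α hc]
    exact image_closure_subset_closure_image (continuous_jetBundle_mk z.base)
      |>.trans (closure_mono (image_subset_iff.2 fun j hj => hj))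
      ⟨z.jet, mem_closure_fibre_strictSet g α hc hz, rfl⟩
  fibre_eq_closure_interior p := by
    refine subset_antisymm (fun j hj => ?_) (closure_minimal interior_subset
      ((isClosed_sigmaSet g α c).preimage (continuous_jetBundle_mk p)))
    rw [interior_fibre_sigmaSet g α hc]
    exact mem_closure_fibre_strictSet g α hc hj
  fibre_interior p := by rw [interior_sigmaSet g α hc, interior_fibre_sigmaSet g α hc]

/-- Negating the strict inequality `c < -Φ̃(-N)`, for the matrix `N` of the jet `-u`, gives `Φ̃(-N)
≥ -c`, and `-N` is the matrix of `Hess u - ι(Λ)`. -/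
theorem dirichletDual_sigmaSet {c : ℝ} (hc : |c| < (n + 1) * Real.pi / 2) :
    dirichletDual (sigmaSet g α c) = sigmaTildeSet g α (-c) := by
  ext z
  rw [mem_sigmaTildeSet_iff, dirichletDual, mem_ofPred_eq, interior_sigmaSet g α hc, strictSet,
    mem_ofPred_eq, not_lt]
  constructor <;> intro h <;> linarith

end JetAngle

end SpaceTimeAngle

end

open SpaceTimeAngle in
theorem mainTheorem4 {n : ℕ} {X : Type*} [TopologicalSpace X] [T2Space X] [CompactSpace X]
    [ChartedSpace (Model n) X] [IsManifold 𝓘(ℂ, Model n) ω X]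
    (g : KahlerMetric n X) (α : ClosedRealOneOneForm n X)
    (c : ℝ) (hc : |c| < (n + 1) * Real.pi / 2) :
    IsSubequation (sigmaSet g α c) ∧
    IsPurelySecondOrder g (sigmaSet g α c) ∧
    (∀ (p : SpaceTime X) (j : JetAt n p) (e : Fin n → TSpace n p.2), g.IsUnitaryFrame p.2 e →
      ((⟨p, j⟩ : JetBundle n X) ∈ sigmaSet g α c ↔
        c ≤ spaceTimeAngle (frameMatrix p.2 e (g.hessian p j + α.iotaLambda p)))) ∧
    dirichletDual (sigmaSet g α c) = sigmaTildeSet g α (-c) := by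
  refine ⟨isSubequation_sigmaSet g α hc,
    ⟨fun p => {H | c ≤ spaceTimeAngle (gramMatrix (complexFrame (unitaryFrame g p.2))
      (H + α.iotaLambda p))}, fun p j => mem_sigmaSet_iff g α ⟨p, j⟩⟩,
    fun p j e he => ?_, dirichletDual_sigmaSet g α hc⟩
  rw [mem_sigmaSet_iff, ← spaceTimeAngle_eq_shiftedMatrix g α p j he]
  rfl
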